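/- Let $d\ge 2$, $1<p<\infty$, let $\omega\subset\mathbb R^{d-1}$ be a bounded open set, and for $\varepsilon>0$ put $\Omega_\varepsilon=\omega\times(0,\varepsilon)\subset\mathbb R^d$; write $x=(x',x_d)$ with $x'\in\mathbb R^{d-1}$. For $s\in(0,1)$ let $$\lfloor u\rfloor_s^p(\Omega_\varepsilon)=\int_{\Omega_\varepsilon\times\Omega_\varepsilon}\frac{|u(x)-u(y)|^p}{|x-y|^{d+sp}}\,dx\,dy ,$$ and let $W^{s,p}(\Omega_\varepsilon)$ be the set of all $u\in L^p(\Omega_\varepsilon)$ for which this is finite. For $s\in[0,1]$ put $$C_{s,d;p}=\int_{\mathbb R^{d-1}}\frac{1}{(1+|\xi|^2)^{\frac{d+sp}{2}}}\,d\xi .$$ Let $s_0\in[0,1]$ and let $(s_\varepsilon)_{\varepsilon>0}\subset(0,1)$ satisfy $s_\varepsilon\to s_0$ as $\varepsilon\to0^+$. Define $$E_\varepsilon(u)=\frac{1}{\varepsilon^{1-s_\varepsilon p}}\lfloor u\rfloor_{s_\varepsilon}^p(\Omega_\varepsilon)\quad\text{if }u\in W^{s_\varepsilon,p}(\Omega_\varepsilon),\qquad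 E_\varepsilon(u)=+\infty\quad\text{otherwise.}$$ We say that $u_\varepsilon\to v$ if the scaled functions $v_\varepsilon(x',x_d)=u_\varepsilon(x',\varepsilon x_d)$ converge to $v$ weakly in $L^p_{\rm loc}(\omega\times(0,1))$, that is, weakly in $L^p(K)$ for every compact $K\subset\omega\times(0,1)$. Functionals $F_\varepsilon$ with values in $[0,+\infty]$ $\Gamma$-converge to $G$ on $L^p_{\rm loc}(\omega\times(0,1))$ if for every sequence $\varepsilon_j\to0^+$ and every $v\in L^p_{\rm loc}(\omega\times(0,1))$: (i) $G(v)\le\liminf_jF_{\varepsilon_j}(u_j)$ for every sequence $u_j\to v$; and (ii) there is a sequence $u_j\to v$ with $\limsup_jF_{\varepsilon_j}(u_j)\le G(v)$. Then, as $\varepsilon\to0^+$ and with respect to this convergence: 1. if $s_0<1$, the functionals $E_\varepsilon$ $\Gamma$-converge to $$G(v)=C_{s_0,d;p}\int_\omega\int_0^1\int_0^1\frac{|v(x',x_d)-v(x',y_d)|^p}{|x_d-y_d|^{1+s_0p}}\,dx_d\,dy_d\,dx' ;$$ 2. if $s_0=1$, the functionals $(1-s_\varepsilon)E_\varepsilon$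 $\Gamma$-converge to $$G(v)=\frac2p\,C_{1,d;p}\int_\omega\int_0^1\Big|\frac{\partial v}{\partial x_d}(x',x_d)\Big|^p\,dx_d\,dx' ,$$ where $\partial v/\partial x_d$ is the weak derivative and $G(v)=+\infty$ if it does not exist as a locally integrable function. -/

import Mathlib

open Set Filter Topology MeasureTheory
open scoped ENNReal

namespace ThinFilm

noncomputable section

/-- The space `ℝᵈ` with `d = n + 1`, whose points are written `x = (x', x_d)` with `x' ∈ ℝⁿ`
(Euclidean) and `x_d ∈ ℝ`. The measure `volume` is Lebesgue measure. The product type carries the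
sup norm, so Euclidean distances are always taken through `eucDist` below. -/
abbrev Pt (n : ℕ) : Type := EuclideanSpace ℝ (Fin n) × ℝ

/-- The Euclidean distance `|x - y|` in `ℝᵈ`. -/
def eucDist {n : ℕ} (x y : Pt n) : ℝ :=
  Real.sqrt (‖x.1 - y.1‖ ^ 2 + |x.2 - y.2| ^ 2)

/-- The film `ω × (0, ε)` of thickness `ε`. -/
def film {n : ℕ} (ω : Set (EuclideanSpace ℝ (Fin n))) (ε : ℝ) : Set (Pt n) :=
  ω ×ˢ Ioo (0 : ℝ) ε

/-- The `p`-th power of the Gagliardo seminorm,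
`∫_{A × A} |u(x) - u(y)|^p / |x - y|^(d + s p) dx dy`, with `d = n + 1`. -/
def gagliardo {n : ℕ} (p s : ℝ) (A : Set (Pt n)) (u : Pt n → ℝ) : ℝ≥0∞ :=
  ∫⁻ z in A ×ˢ A,
    ENNReal.ofReal (|u z.1 - u z.2| ^ p / eucDist z.1 z.2 ^ (((n : ℝ) + 1) + s * p))

/-- `u ∈ W^{s,p}(A)`: `u` is in `L^p(A)` and has finite Gagliardo seminorm on `A`. -/
def MemFracSobolev {n : ℕ} (p s : ℝ) (A : Set (Pt n)) (u : Pt n → ℝ) : Prop :=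
  MemLp u (ENNReal.ofReal p) (volume.restrict A) ∧ gagliardo p s A u < ∞

open Classical in
/-- The functional `ε^{-(1 - s p)} ⌊u⌋_s^p(Ω_ε)` on `W^{s,p}(Ω_ε)`; as usual in `Γ`-convergence it
takes the value `+∞` outside this space. -/
def energy {n : ℕ} (p : ℝ) (ω : Set (EuclideanSpace ℝ (Fin n))) (s ε : ℝ) (u : Pt n → ℝ) :
    ℝ≥0∞ :=
  if MemFracSobolev p s (film ω ε) u then
    ENNReal.ofReal (1 / ε ^ (1 - s * p)) * gagliardo p s (film ω ε) u
  else ∞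

/-- The scaled function `v(x', x_d) = u(x', ε x_d)`. -/
def rescale {n : ℕ} (ε : ℝ) (u : Pt n → ℝ) : Pt n → ℝ :=
  fun x => u (x.1, ε * x.2)

/-- `v ∈ L^p_loc(Ω)`. -/
def MemLpLoc {n : ℕ} (p : ℝ) (Ω : Set (Pt n)) (v : Pt n → ℝ) : Prop :=
  ∀ K : Set (Pt n), K ⊆ Ω → IsCompact K → MemLp v (ENNReal.ofReal p) (volume.restrict K)

/-- Weak convergence `v_j ⇀ v` in `L^p_loc(Ω)`, `1 < p < ∞`: on every compact `K ⊆ Ω` the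
functions `v_j` converge weakly to `v` in `L^p(K)`, that is, when tested with every function of
the dual space `L^{p'}(K)`, `p' = p / (p - 1)`. -/
def WeakConvLpLoc {n : ℕ} (p : ℝ) (Ω : Set (Pt n)) (vs : ℕ → Pt n → ℝ) (v : Pt n → ℝ) : Prop :=
  (∀ j, MemLpLoc p Ω (vs j)) ∧ MemLpLoc p Ω v ∧
  ∀ K : Set (Pt n), K ⊆ Ω → IsCompact K → ∀ φ : Pt n → ℝ,
    MemLp φ (ENNReal.ofReal (p / (p - 1))) (volume.restrict K) →
      Tendsto (fun j => ∫ x in K, vs j x * φ x) atTop (𝓝 (∫ x in K, v x * φ x))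

/-- `G` is the `Γ`-limit, as `ε → 0⁺`, of the functionals `F ε` (of functions `u` on `Ω_ε`) with
respect to the weak convergence in `L^p_loc(ω × (0,1))` of the scaled functions: along every
sequence `ε_j → 0⁺`, and at every `v ∈ L^p_loc(ω × (0,1))`, the liminf inequality holds and a
recovery sequence exists. -/
def IsGammaLimit {n : ℕ} (p : ℝ) (ω : Set (EuclideanSpace ℝ (Fin n)))
    (F : ℝ → (Pt n → ℝ) → ℝ≥0∞) (G : (Pt n → ℝ) → ℝ≥0∞) : Prop :=
  ∀ ε : ℕ → ℝ, (∀ j, 0 < ε j) → Tendsto ε atTop (𝓝 0) →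
    ∀ v : Pt n → ℝ, MemLpLoc p (film ω 1) v →
      (∀ u : ℕ → Pt n → ℝ,
        WeakConvLpLoc p (film ω 1) (fun j => rescale (ε j) (u j)) v →
          G v ≤ liminf (fun j => F (ε j) (u j)) atTop) ∧
      ∃ u : ℕ → Pt n → ℝ,
        WeakConvLpLoc p (film ω 1) (fun j => rescale (ε j) (u j)) v ∧
          limsup (fun j => F (ε j) (u j)) atTop ≤ G v

/-- The constant `C_{s,d;p} = ∫_{ℝ^{d-1}} (1 + |ξ|²)^{-(d + s p)/2} dξ`, with `d = n + 1`. -/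
def filmConst (n : ℕ) (s p : ℝ) : ℝ≥0∞ :=
  ∫⁻ ξ : EuclideanSpace ℝ (Fin n),
    ENNReal.ofReal (1 / (1 + ‖ξ‖ ^ 2) ^ ((((n : ℝ) + 1) + s * p) / 2))

/-- The integral over `ω` of the `p`-th powers of the one-dimensional `W^{s,p}(0,1)` seminorms
of the vertical sections of `v`. -/
def verticalGagliardo {n : ℕ} (p s : ℝ) (ω : Set (EuclideanSpace ℝ (Fin n)))
    (v : Pt n → ℝ) : ℝ≥0∞ :=
  ∫⁻ x' in ω, ∫⁻ t in Ioo (0 : ℝ) 1, ∫⁻ r in Ioo (0 : ℝ) 1,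
    ENNReal.ofReal (|v (x', t) - v (x', r)| ^ p / |t - r| ^ (1 + s * p))

/-- `w` is the weak partial derivative `∂v/∂x_d` in `Ω`. -/
def IsWeakVerticalDeriv {n : ℕ} (Ω : Set (Pt n)) (v w : Pt n → ℝ) : Prop :=
  LocallyIntegrableOn v Ω volume ∧ LocallyIntegrableOn w Ω volume ∧
  ∀ φ : Pt n → ℝ, ContDiff ℝ ((⊤ : ℕ∞) : WithTop ℕ∞) φ → HasCompactSupport φ → tsupport φ ⊆ Ω →
    ∫ x in Ω, v x * fderiv ℝ φ x (0, 1) = - ∫ x in Ω, w x * φ x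

/-- `∫_{ω × (0,1)} |∂v/∂x_d|^p dx`, with value `+∞` if `v` has no weak derivative `∂v/∂x_d`. The
weak derivative is unique almost everywhere, so the infimum is over a single value or is empty. -/
def verticalDirichlet {n : ℕ} (p : ℝ) (ω : Set (EuclideanSpace ℝ (Fin n)))
    (v : Pt n → ℝ) : ℝ≥0∞ :=
  ⨅ (w : Pt n → ℝ) (_ : IsWeakVerticalDeriv (film ω 1) v w),
    ∫⁻ x in film ω 1, ENNReal.ofReal (|w x| ^ p)

end

end ThinFilm

/-! The proof rests on one exact change of variables. Rescale both points to thickness one, write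
the second as the first plus `k = (k', h)`, and substitute `k' = ε |h| ξ`. Since `|(ε |h| ξ, ε h)| =
ε |h| √(1 + |ξ|²)`, the kernel factors and all powers of `ε` cancel: the energy becomes the integral
over `ξ` of `(1 + |ξ|²)^(-(d + s p)/2)` times the integral over `h` of `|h|^(-(1 + s p))` times
`‖v(· + (ε |h| ξ, h)) - v‖_p^p` (`gagliardo_eq`). As `ε → 0` the shift becomes vertical, the
`h`-integral turns into the vertical seminorm, and the `ξ`-integral of the weight is the constant.

Lower bound. For fixed `ξ` and `h` the norm of the increment is lower semicontinuous along weakly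
convergent functions and convergent shifts (`incr_le_liminf`): bounded increments have a weak limit,
which is identified by moving the shift to a test function. Fatou's lemma in `h` and then in `ξ`
gives the case `s₀ < 1`. For `s₀ = 1` write `|h|^(-(1 + s p)) = |h|^(σ - 1) |h|^(-p)` with `σ = p (1
- s)`. The measures `σ |h|^(σ - 1) dh` concentrate at `0` with mass two, and `1 - s = σ / p`, whence
the factor `2 / p`. What remains is a lower bound for difference quotients along slopes tending to
the vertical (`verticalDirichlet_le_liminf`).

Upper bound. For a bounded Lipschitz `w`, differentiable when `s₀ = 1`, the functions `w(x', x_d /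
ε)` are themselves a recovery sequence. The domination is delicate: the Lipschitz bound alone grows
too fast in `ξ`, so it is interpolated with the sup bound to a Hölder bound of exponent `θ` slightly
above `s` (`abs_increment_le`).

A general `v` is cut off horizontally, contracted vertically and mollified. By Jensen's inequality
this raises the limit energy at most by a factor tending to one (`mul_incr_smoothing_le`,
`lintegral_fderiv_smoothing_le`); the horizontal cutoff costs nothing because the limit functional
sees only vertical increments. A diagonal sequence finishes the proof; where the limit is infinite,
any sequence converging to `v` will do. -/

namespace ThinFilm

/-! ### Weak compactness in `L^p` over a finite measure, along an ultrafilter. -/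

section WeakCompactness

variable {X ι : Type*} [MeasurableSpace X] {μ : Measure X}

theorem enorm_integral_mul_le_of_lintegral_rpow_le {p q : ℝ} (hpq : p.HolderConjugate q)
    {G φ : X → ℝ} (hG : AEStronglyMeasurable G μ) (hφ : AEStronglyMeasurable φ μ) {M : ℝ≥0∞}
    (hb : ∫⁻ x, ‖G x‖ₑ ^ p ∂μ ≤ M) :
    ‖∫ x, G x * φ x ∂μ‖ₑ ≤ M ^ (1 / p) * (∫⁻ x, ‖φ x‖ₑ ^ q ∂μ) ^ (1 / q) := by
  calc ‖∫ x, G x * φ x ∂μ‖ₑ ≤ ∫⁻ x, ‖G x * φ x‖ₑ ∂μ := enorm_integral_le_lintegral_enorm _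
    _ = ∫⁻ x, ((fun x => ‖G x‖ₑ) * (fun x => ‖φ x‖ₑ)) x ∂μ := by
        simp only [enorm_mul, Pi.mul_apply]
    _ ≤ _ := ENNReal.lintegral_mul_le_Lp_mul_Lq μ hpq hG.enorm hφ.enorm
    _ ≤ _ := by
        gcongr
        exact one_div_nonneg.2 hpq.nonneg

theorem integrable_of_lintegral_rpow_le [IsFiniteMeasure μ] {p : ℝ} (hp : 1 < p) {G : X → ℝ}
    (hG : AEStronglyMeasurable G μ) {M : ℝ≥0∞} (hM : M ≠ ∞) (hb : ∫⁻ x, ‖G x‖ₑ ^ p ∂μ ≤ M) :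
    Integrable G μ := by
  have h0 : ENNReal.ofReal p ≠ 0 := by simp; linarith
  have : MemLp G (ENNReal.ofReal p) μ := by
    refine ⟨hG, ?_⟩
    rw [eLpNorm_lt_top_iff_lintegral_rpow_enorm_lt_top h0 ENNReal.ofReal_ne_top,
      ENNReal.toReal_ofReal (by linarith)]
    exact hb.trans_lt hM.lt_top
  exact this.integrable (by simpa using hp.le)

theorem lintegral_enorm_rpow_lt_top_of_bounded [IsFiniteMeasure μ] {q : ℝ} (hq : 0 ≤ q)
    {φ : X → ℝ} {B : ℝ} (hB : ∀ x, |φ x| ≤ B) : ∫⁻ x, ‖φ x‖ₑ ^ q ∂μ < ∞ := by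
  calc ∫⁻ x, ‖φ x‖ₑ ^ q ∂μ ≤ ∫⁻ _, (ENNReal.ofReal B) ^ q ∂μ := by
        refine lintegral_mono fun x => ?_
        gcongr
        rw [Real.enorm_eq_ofReal_abs]
        exact ENNReal.ofReal_le_ofReal (hB x)
    _ < ∞ := by
        rw [lintegral_const]
        exact ENNReal.mul_lt_top (ENNReal.rpow_lt_top_of_nonneg hq (by simp)) (measure_lt_top _ _)

/-- By Hölder the pairings stay in a compact interval, so they converge along any ultrafilter. A
single ultrafilter serves all test functions at once, with no separability or extraction of
subsequences. -/
theorem exists_tendsto_integral_mul {p q : ℝ} (hpq : p.HolderConjugate q) [IsFiniteMeasure μ]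
    {G : ι → X → ℝ} (hG : ∀ i, AEStronglyMeasurable (G i) μ) {M : ℝ≥0∞} (hM : M ≠ ∞)
    (hb : ∀ i, ∫⁻ x, ‖G i x‖ₑ ^ p ∂μ ≤ M) (U : Ultrafilter ι) {φ : X → ℝ} (hφ : Measurable φ)
    {B : ℝ} (hB : ∀ x, |φ x| ≤ B) :
    ∃ l : ℝ, Tendsto (fun i => ∫ x, G i x * φ x ∂μ) U (𝓝 l) := by
  set C := M ^ (1 / p) * (∫⁻ x, ‖φ x‖ₑ ^ q ∂μ) ^ (1 / q)
  have hC : C < ∞ := ENNReal.mul_lt_top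
    (ENNReal.rpow_lt_top_of_nonneg (one_div_nonneg.2 hpq.nonneg) hM)
    (ENNReal.rpow_lt_top_of_nonneg (one_div_nonneg.2 hpq.symm.nonneg)
      (lintegral_enorm_rpow_lt_top_of_bounded hpq.symm.nonneg hB).ne)
  have hmem : ∀ i, (∫ x, G i x * φ x ∂μ) ∈ Metric.closedBall (0 : ℝ) C.toReal := by
    intro i
    have h := enorm_integral_mul_le_of_lintegral_rpow_le hpq (hG i) hφ.aestronglyMeasurable (hb i)
    rw [mem_closedBall_zero_iff, ← toReal_enorm]
    exact ENNReal.toReal_mono hC.ne h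
  obtain ⟨l, -, hl⟩ := (isCompact_closedBall (0 : ℝ) C.toReal).ultrafilter_le_nhds
    (U.map (fun i => ∫ x, G i x * φ x ∂μ)) (by
      rw [le_principal_iff]
      exact Filter.mem_map.2 (Filter.univ_mem' hmem))
  exact ⟨l, hl⟩

/-- Weak sequential compactness of bounded sets of `L^p` over a finite measure. -/
theorem exists_weak_limit [IsFiniteMeasure μ] {p : ℝ} (hp : 1 < p)
    {G : ι → X → ℝ} (hG : ∀ i, AEStronglyMeasurable (G i) μ) {M : ℝ≥0∞} (hM : M ≠ ∞)
    (hb : ∀ i, ∫⁻ x, ‖G i x‖ₑ ^ p ∂μ ≤ M) (U : Ultrafilter ι) :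
    ∃ g : X → ℝ, Measurable g ∧ Integrable g μ ∧
      (∀ φ : X → ℝ, Measurable φ → ∀ B : ℝ, (∀ x, |φ x| ≤ B) →
        Tendsto (fun i => ∫ x, G i x * φ x ∂μ) U (𝓝 (∫ x, g x * φ x ∂μ))) ∧
      ∫⁻ x, ‖g x‖ₑ ^ p ∂μ ≤ M := by
  classical
  obtain ⟨q, hpq⟩ : ∃ q, p.HolderConjugate q := ⟨_, Real.HolderConjugate.conjExponent hp⟩
  have hq0 := hpq.symm.pos
  have hp0 := hpq.pos
  have hGi : ∀ i, Integrable (G i) μ := fun i => integrable_of_lintegral_rpow_le hp (hG i) hM (hb i)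
  have hex : ∀ E : Set X, ∃ l : ℝ, MeasurableSet E →
      Tendsto (fun i => ∫ x in E, G i x ∂μ) U (𝓝 l) := by
    intro E
    by_cases hE : MeasurableSet E
    · obtain ⟨l, hl⟩ := exists_tendsto_integral_mul hpq hG hM hb U
        (φ := E.indicator 1) (measurable_one.indicator hE) (B := 1) (by
          intro x; by_cases hx : x ∈ E <;> simp [hx])
      refine ⟨l, fun _ => hl.congr fun i => ?_⟩
      rw [← integral_indicator hE]
      congr 1 with x
      by_cases hx : x ∈ E <;> simp [hx]
    · exact ⟨0, fun h => absurd h hE⟩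
  choose Λ hΛ using hex
  -- This bound does double duty: applied to tails of a disjoint union it gives countable additivity
  -- of `Λ`, and applied to null sets it gives absolute continuity. The weak limit is then the
  -- Radon–Nikodym density.
  have hΛle : ∀ E, MeasurableSet E → ‖Λ E‖ₑ ≤ M ^ (1 / p) * μ E ^ (1 / q) := by
    intro E hE
    refine le_of_tendsto (continuous_enorm.continuousAt.tendsto.comp (hΛ E hE))
      (Eventually.of_forall fun i => ?_)
    have h := enorm_integral_mul_le_of_lintegral_rpow_le hpq (hG i)
      (φ := E.indicator 1) (measurable_one.indicator hE).aestronglyMeasurable (hb i)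
    have e1 : ∫ x, G i x * E.indicator 1 x ∂μ = ∫ x in E, G i x ∂μ := by
      rw [← integral_indicator hE]
      congr 1 with x
      by_cases hx : x ∈ E <;> simp [hx]
    have e2 : ∫⁻ x, ‖E.indicator (1 : X → ℝ) x‖ₑ ^ q ∂μ = μ E := by
      rw [← lintegral_indicator_one hE]
      congr 1 with x
      by_cases hx : x ∈ E <;> simp [hx, hq0]
    rw [e1, e2] at h
    exact h
  have hunion : ∀ E F, MeasurableSet E → MeasurableSet F → Disjoint E F →
      Λ (E ∪ F) = Λ E + Λ F := by
    intro E F hE hF hd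
    refine tendsto_nhds_unique (hΛ _ (hE.union hF)) (((hΛ E hE).add (hΛ F hF)).congr fun i => ?_)
    rw [setIntegral_union hd hF (hGi i).integrableOn (hGi i).integrableOn]
  have hempty : Λ ∅ = 0 :=
    tendsto_nhds_unique (hΛ _ MeasurableSet.empty) (by simp)
  have hfin : ∀ (E : ℕ → Set X), (∀ i, MeasurableSet (E i)) → Pairwise (Function.onFun Disjoint E) →
      ∀ s : Finset ℕ, Λ (⋃ i ∈ s, E i) = ∑ i ∈ s, Λ (E i) := by
    intro E hE hd s
    induction s using Finset.induction_on with
    | empty => simp [hempty]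
    | insert a s ha ih =>
      rw [Finset.set_biUnion_insert, hunion _ _ (hE a) (s.measurableSet_biUnion fun i _ => hE i),
        Finset.sum_insert ha, ih]
      rw [disjoint_iUnion₂_right]
      intro i hi
      exact hd (by rintro rfl; exact ha hi)
  let ν : SignedMeasure X :=
    { measureOf' := fun E => if MeasurableSet E then Λ E else 0
      empty' := by simp [hempty]
      not_measurable' := fun E hE => by simp [hE]
      m_iUnion' := by
        intro E hE hd
        simp only [hE, MeasurableSet.iUnion hE, if_true]
        rw [HasSum, SummationFilter.unconditional_filter, tendsto_iff_edist_tendsto_0]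
        have hsum : ∑' i, μ (E i) ≠ ∞ := by
          rw [← measure_iUnion hd hE]; exact measure_ne_top _ _
        have h1 := ENNReal.tendsto_tsum_compl_atTop_zero hsum
        have h2 : Tendsto (fun s : Finset ℕ => M ^ (1 / p) *
            (∑' b : { x // x ∉ s }, μ (E b)) ^ (1 / q)) atTop (𝓝 0) := by
          have h3 : Tendsto (fun s : Finset ℕ =>
              (∑' b : { x // x ∉ s }, μ (E b)) ^ (1 / q)) atTop (𝓝 0) := by
            have := (ENNReal.continuous_rpow_const (y := 1 / q)).tendsto 0
            rw [ENNReal.zero_rpow_of_pos (by positivity)] at this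
            exact this.comp h1
          simpa using ENNReal.Tendsto.const_mul h3
            (Or.inr (ENNReal.rpow_lt_top_of_nonneg (by positivity) hM).ne)
        refine tendsto_of_tendsto_of_tendsto_of_le_of_le tendsto_const_nhds h2
          (fun _ => zero_le) fun s => ?_
        have hsplit : Λ (⋃ i, E i) = Λ (⋃ i ∈ s, E i) + Λ (⋃ b : { x // x ∉ s }, E b) := by
          rw [← hunion _ _ (s.measurableSet_biUnion fun i _ => hE i)
            (MeasurableSet.iUnion fun i : { x // x ∉ s } => hE i)]
          · congr 1
            ext x
            simp only [mem_union, mem_iUnion, Subtype.exists]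
            constructor
            · rintro ⟨i, hi⟩
              by_cases his : i ∈ s
              · exact Or.inl ⟨i, his, hi⟩
              · exact Or.inr ⟨i, his, hi⟩
            · rintro (⟨i, _, hi⟩ | ⟨i, _, hi⟩) <;> exact ⟨i, hi⟩
          · rw [disjoint_iUnion₂_left]
            intro i hi
            rw [disjoint_iUnion_right]
            rintro ⟨j, hj⟩
            exact hd (by rintro rfl; exact hj hi)
        dsimp only
        rw [edist_comm, edist_eq_enorm_sub, hsplit, hfin E hE hd, add_sub_cancel_left]
        refine (hΛle _ (MeasurableSet.iUnion fun i : { x // x ∉ s } => hE i)).trans ?_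
        gcongr
        exact measure_iUnion_le _ }
  have hνE : ∀ E, MeasurableSet E → ν E = Λ E := fun E hE => if_pos hE
  have hac : ν ≪ᵥ μ.toENNRealVectorMeasure := by
    refine VectorMeasure.AbsolutelyContinuous.mk fun E hE h0 => ?_
    rw [Measure.toENNRealVectorMeasure_apply_measurable hE] at h0
    have := hΛle E hE
    rw [h0, ENNReal.zero_rpow_of_pos (by positivity), mul_zero] at this
    rw [hνE E hE]
    simpa using this
  set g := ν.rnDeriv μ
  have hgi : Integrable g μ := ν.integrable_rnDeriv μ
  have hgm : Measurable g := ν.measurable_rnDeriv μ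
  have hg : ∀ E, MeasurableSet E → Λ E = ∫ x in E, g x ∂μ := by
    intro E hE
    rw [← withDensityᵥ_apply hgi hE, ν.withDensityᵥ_rnDeriv_eq μ hac, hνE E hE]
  have hbm : ∀ {φ : X → ℝ}, Measurable φ → ∀ {B : ℝ}, (∀ x, |φ x| ≤ B) → ∀ {f : X → ℝ},
      Integrable f μ → Integrable (fun x => f x * φ x) μ := by
    intro φ hφ B hB f hf
    exact hf.mul_bdd (c := B) hφ.aestronglyMeasurable (Eventually.of_forall hB)
  have hbs : ∀ φ : SimpleFunc X ℝ, ∃ B, ∀ x, |φ x| ≤ B := fun φ => φ.exists_forall_norm_le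
  have hsimple : ∀ φ : SimpleFunc X ℝ,
      Tendsto (fun i => ∫ x, G i x * φ x ∂μ) U (𝓝 (∫ x, g x * φ x ∂μ)) := by
    intro φ
    induction φ using SimpleFunc.induction with
    | const c hs =>
      rename_i s
      have : ∀ f : X → ℝ, ∫ x, f x * (SimpleFunc.piecewise s hs (SimpleFunc.const X c)
          (SimpleFunc.const X 0)) x ∂μ = (∫ x in s, f x ∂μ) * c := by
        intro f
        rw [← integral_mul_const, ← integral_indicator hs]
        congr 1 with x
        by_cases hx : x ∈ s <;> simp [hx]
      simp only [this, ← hg s hs]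
      exact (hΛ s hs).mul_const c
    | add hd hf hg' =>
      rename_i f f'
      obtain ⟨B, hB⟩ := hbs f
      obtain ⟨B', hB'⟩ := hbs f'
      have : ∀ k : X → ℝ, Integrable k μ → ∫ x, k x * (f + f') x ∂μ =
          ∫ x, k x * f x ∂μ + ∫ x, k x * f' x ∂μ := by
        intro k hk
        rw [← integral_add (hbm f.measurable hB hk) (hbm f'.measurable hB' hk)]
        simp [mul_add]
      rw [this g hgi]
      exact (hf.add hg').congr fun i => (this _ (hGi i)).symm
  have hmain : ∀ φ : X → ℝ, Measurable φ → ∀ B : ℝ, (∀ x, |φ x| ≤ B) →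
      Tendsto (fun i => ∫ x, G i x * φ x ∂μ) U (𝓝 (∫ x, g x * φ x ∂μ)) := by
    intro φ hφ B hB
    let ψ : ℕ → SimpleFunc X ℝ := fun m => SimpleFunc.approxOn φ hφ univ 0 (mem_univ _) m
    have hψ : ∀ x, Tendsto (fun m => ψ m x) atTop (𝓝 (φ x)) := fun x =>
      SimpleFunc.tendsto_approxOn hφ (mem_univ _) (by simp)
    have hψB : ∀ m x, |ψ m x| ≤ B + B := fun m x =>
      (SimpleFunc.norm_approxOn_zero_le hφ (mem_univ _) x m).trans
        (add_le_add (hB x) (hB x))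
    have hg1 : Tendsto (fun m => ∫ x, g x * ψ m x ∂μ) atTop (𝓝 (∫ x, g x * φ x ∂μ)) := by
      refine tendsto_integral_of_dominated_convergence (fun x => ‖g x‖ * (B + B))
        (fun m => (hgm.mul (ψ m).measurable).aestronglyMeasurable) (hgi.norm.mul_const _)
        (fun m => Eventually.of_forall fun x => ?_)
        (Eventually.of_forall fun x => (hψ x).const_mul _)
      rw [norm_mul]
      gcongr
      exact hψB m x
    have hG1 : Tendsto (fun m => M ^ (1 / p) * (∫⁻ x, ‖φ x - ψ m x‖ₑ ^ q ∂μ) ^ (1 / q)) atTop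
        (𝓝 0) := by
      have h1 : Tendsto (fun m => ∫⁻ x, ‖φ x - ψ m x‖ₑ ^ q ∂μ) atTop (𝓝 (∫⁻ x, 0 ∂μ)) := by
        refine tendsto_lintegral_of_dominated_convergence
          (fun _ => (ENNReal.ofReal (B + (B + B))) ^ q)
          (fun m => by have := (ψ m).measurable; fun_prop)
          (fun m => Eventually.of_forall fun x => ?_) ?_ (Eventually.of_forall fun x => ?_)
        · dsimp only
          gcongr
          rw [Real.enorm_eq_ofReal_abs]
          refine ENNReal.ofReal_le_ofReal ((abs_sub _ _).trans ?_)
          exact add_le_add (hB x) (hψB m x)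
        · rw [lintegral_const]
          exact (ENNReal.mul_lt_top (ENNReal.rpow_lt_top_of_nonneg hq0.le (by simp))
            (measure_lt_top _ _)).ne
        · have h2 : Tendsto (fun m => ‖φ x - ψ m x‖ₑ) atTop (𝓝 0) := by
            have := ((tendsto_const_nhds (x := φ x)).sub (hψ x)).enorm
            simpa using this
          have := ((ENNReal.continuous_rpow_const (y := q)).tendsto 0).comp h2
          rwa [ENNReal.zero_rpow_of_pos hq0] at this
      rw [lintegral_zero] at h1
      have h3 := ((ENNReal.continuous_rpow_const (y := 1 / q)).tendsto 0).comp h1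
      rw [ENNReal.zero_rpow_of_pos (by positivity)] at h3
      simpa using ENNReal.Tendsto.const_mul h3
            (Or.inr (ENNReal.rpow_lt_top_of_nonneg (by positivity) hM).ne)
    rw [Metric.tendsto_nhds]
    intro δ hδ
    have h1 := (Metric.tendsto_nhds.1 hg1 (δ / 3) (by positivity))
    have h2 := hG1.eventually_lt_const (u := ENNReal.ofReal (δ / 3)) (by simpa using hδ)
    obtain ⟨m, hm1, hm2⟩ := (h1.and h2).exists
    -- Three-term estimate. The choice of `m` does not depend on `i`, because the error of replacing
    -- `φ` by `ψ m` is bounded by Hölder uniformly in `i`.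
    filter_upwards [Metric.tendsto_nhds.1 (hsimple (ψ m)) (δ / 3) (by positivity)] with i hi
    have h3 : |∫ x, G i x * φ x ∂μ - ∫ x, G i x * ψ m x ∂μ| < δ / 3 := by
      rw [← integral_sub (hbm hφ hB (hGi i)) (hbm (ψ m).measurable (hψB m) (hGi i))]
      simp only [← mul_sub]
      have := (enorm_integral_mul_le_of_lintegral_rpow_le hpq (hG i)
        (φ := fun x => φ x - ψ m x) (hφ.sub (ψ m).measurable).aestronglyMeasurable
        (hb i)).trans_lt hm2
      rw [Real.enorm_eq_ofReal_abs, ENNReal.ofReal_lt_ofReal_iff (by positivity)] at this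
      exact this
    rw [Real.dist_eq] at *
    rw [abs_lt] at *
    constructor <;> linarith [h3.1, h3.2, hi.1, hi.2, hm1.1, hm1.2]
  refine ⟨g, hgm, hgi, hmain, ?_⟩
  -- duality with truncations of `|g|^(p-2) g`
  have htrunc : ∀ N : ℕ, ∫⁻ x in {x | |g x| ≤ N}, ‖g x‖ₑ ^ p ∂μ ≤ M := by
    intro N
    have hms : MeasurableSet {x | |g x| ≤ N} := measurableSet_le (by fun_prop) (by fun_prop)
    set I := ∫⁻ x in {x | |g x| ≤ N}, ‖g x‖ₑ ^ p ∂μ with hI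
    let φ : X → ℝ := {x | |g x| ≤ N}.indicator fun x => SignType.sign (g x) * |g x| ^ (p - 1)
    have hφm : Measurable φ := by
      refine Measurable.indicator (Measurable.mul ?_ (by fun_prop)) hms
      have : Measurable (fun y : ℝ => ((SignType.sign y : SignType) : ℝ)) := by
        have : (fun y : ℝ => ((SignType.sign y : SignType) : ℝ)) =
            fun y => if 0 < y then 1 else if y < 0 then -1 else 0 := by
          ext y
          rw [sign_apply]
          split_ifs <;> simp
        rw [this]
        exact Measurable.ite measurableSet_Ioi measurable_const
          (Measurable.ite measurableSet_Iio measurable_const measurable_const)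
      exact this.comp hgm
    have habs : ∀ x, |φ x| = {x | |g x| ≤ N}.indicator (fun x => |g x| ^ (p - 1)) x := by
      intro x
      by_cases hx : x ∈ {x | |g x| ≤ N}
      · simp only [φ, indicator_of_mem hx, abs_mul, abs_of_nonneg (Real.rpow_nonneg (abs_nonneg _) _)]
        rcases lt_trichotomy (g x) 0 with h | h | h
        · simp [h]
        · simp [h, Real.zero_rpow (by linarith : p - 1 ≠ 0)]
        · simp [h]
      · simp [φ, hx]
    have hφB : ∀ x, |φ x| ≤ (N : ℝ) ^ (p - 1) := by
      intro x
      rw [habs]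
      by_cases hx : x ∈ {x | |g x| ≤ N}
      · rw [indicator_of_mem hx]
        exact Real.rpow_le_rpow (abs_nonneg _) hx (by linarith)
      · rw [indicator_of_notMem hx]
        positivity
    have hgφ : ∀ x, g x * φ x = {x | |g x| ≤ N}.indicator (fun x => |g x| ^ p) x := by
      intro x
      by_cases hx : x ∈ {x | |g x| ≤ N}
      · simp only [φ, indicator_of_mem hx]
        rw [← mul_assoc, self_mul_sign]
        rcases eq_or_ne (g x) 0 with h | h
        · simp [h, Real.zero_rpow hp0.ne']
        · nth_rewrite 1 [← Real.rpow_one |g x|]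
          rw [← Real.rpow_add (abs_pos.2 h)]
          congr 1; ring
      · simp [φ, hx]
    have hIφ : ∫⁻ x, ‖φ x‖ₑ ^ q ∂μ = I := by
      rw [hI, ← lintegral_indicator hms]
      congr 1 with x
      rw [Real.enorm_eq_ofReal_abs, habs]
      by_cases hx : x ∈ {x | |g x| ≤ N}
      · rw [indicator_of_mem hx, indicator_of_mem hx, Real.enorm_eq_ofReal_abs,
          ENNReal.ofReal_rpow_of_nonneg (by positivity) hq0.le,
          ENNReal.ofReal_rpow_of_nonneg (by positivity) hp0.le, ← Real.rpow_mul (abs_nonneg _),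
          hpq.sub_one_mul_conj]
      · simp [indicator_of_notMem hx, hq0]
    have hIfin : I < ∞ := hIφ ▸ lintegral_enorm_rpow_lt_top_of_bounded hq0.le hφB
    have hIg : ENNReal.ofReal (∫ x, g x * φ x ∂μ) = I := by
      rw [ofReal_integral_eq_lintegral_ofReal (hbm hφm hφB hgi), hI, ← lintegral_indicator hms]
      · congr 1 with x
        rw [hgφ]
        by_cases hx : x ∈ {x | |g x| ≤ N}
        · rw [indicator_of_mem hx, indicator_of_mem hx, Real.enorm_eq_ofReal_abs,
            ENNReal.ofReal_rpow_of_nonneg (by positivity) hp0.le]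
        · simp [indicator_of_notMem hx]
      · refine Eventually.of_forall fun x => ?_
        simp only [hgφ, Pi.zero_apply]
        exact indicator_nonneg (fun _ _ => by positivity) _
    -- The test function satisfies `g φ = |g|^p = |φ|^q` on the truncation set. Truncation makes `I`
    -- finite, which is what allows the factor `I ^ (1 / q)` to be cancelled below.
    have hle : I ≤ M ^ (1 / p) * I ^ (1 / q) := by
      have h1 : ‖∫ x, g x * φ x ∂μ‖ₑ ≤ M ^ (1 / p) * I ^ (1 / q) := by
        refine le_of_tendsto (continuous_enorm.continuousAt.tendsto.comp (hmain φ hφm _ hφB))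
          (Eventually.of_forall fun i => ?_)
        rw [← hIφ]
        exact enorm_integral_mul_le_of_lintegral_rpow_le hpq (hG i) hφm.aestronglyMeasurable (hb i)
      refine le_trans ?_ h1
      rw [← hIg, Real.enorm_eq_ofReal_abs]
      exact ENNReal.ofReal_le_ofReal (le_abs_self _)
    rcases eq_or_ne I 0 with h0 | h0
    · rw [h0]; exact zero_le
    have hIq0 : I ^ (1 / q) ≠ 0 := by
      simp [ENNReal.rpow_eq_zero_iff, h0, hIfin.ne]
    have hIqt : I ^ (1 / q) ≠ ∞ := (ENNReal.rpow_lt_top_of_nonneg (by positivity) hIfin.ne).ne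
    have h2 : I ^ (1 / p) ≤ M ^ (1 / p) := by
      have h3 : I = I ^ (1 / p) * I ^ (1 / q) := by
        rw [← ENNReal.rpow_add _ _ h0 hIfin.ne, one_div, one_div, hpq.inv_add_inv_eq_one,
          ENNReal.rpow_one]
      nth_rewrite 1 [h3] at hle
      exact (ENNReal.mul_le_mul_iff_left hIq0 hIqt).1 hle
    exact (ENNReal.rpow_le_rpow_iff (by positivity)).1 h2
  have hmono : Monotone fun N : ℕ => {x | |g x| ≤ N} := by
    intro a b hab x hx
    exact le_trans (show |g x| ≤ a from hx) (by exact_mod_cast hab)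
  have huniv : ⋃ N : ℕ, {x | |g x| ≤ N} = univ := by
    ext x
    simpa using exists_nat_ge |g x|
  rw [← setLIntegral_univ, ← huniv, setLIntegral_iUnion_of_directed _ hmono.directed_le]
  exact iSup_le htrunc

end WeakCompactness

end ThinFilm

namespace ThinFilm

/-! ### Increments of a function over a set. -/

section Incr

variable {V : Type*} [NormedAddCommGroup V]

/-- The points `x` of `A` for which `x + k` is in `A` as well. -/
def shiftSet (A : Set V) (k : V) : Set V := {x | x ∈ A ∧ x + k ∈ A}

/-- The `p`-th power of the `L^p` norm of the increment `v (x + k) - v x`, over the points `x` for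
which `x` and `x + k` are in `A`. -/
noncomputable def incr [MeasureSpace V] (p : ℝ) (A : Set V) (v : V → ℝ) (k : V) : ℝ≥0∞ :=
  ∫⁻ x in shiftSet A k, ‖v (x + k) - v x‖ₑ ^ p

theorem shiftSet_subset (A : Set V) (k : V) : shiftSet A k ⊆ A := fun _ h => h.1

theorem isOpen_shiftSet {A : Set V} (hA : IsOpen A) (k : V) : IsOpen (shiftSet A k) :=
  hA.inter (hA.preimage (continuous_add_const k))

variable [MeasureSpace V] [BorelSpace V] [(volume : Measure V).IsAddHaarMeasure]

theorem ae_shiftSet_of_ae_restrict {A : Set V} (hA : MeasurableSet A) (k : V) {P : V → Prop}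
    (h : ∀ᵐ x ∂(volume.restrict A), P x) :
    ∀ᵐ x ∂(volume.restrict (shiftSet A k)), P x ∧ P (x + k) := by
  have hS : MeasurableSet (shiftSet A k) := hA.inter (hA.preimage (measurable_add_const k))
  rw [ae_restrict_iff' hA] at h
  rw [ae_restrict_iff' hS]
  have h2 := (measurePreserving_add_right volume k).quasiMeasurePreserving.ae h
  filter_upwards [h, h2] with x h1 h2 hx
  exact ⟨h1 hx.1, h2 hx.2⟩

theorem incr_congr (p : ℝ) {A : Set V} (hA : MeasurableSet A) {v w : V → ℝ}
    (h : v =ᵐ[volume.restrict A] w) (k : V) : incr p A v k = incr p A w k := by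
  refine lintegral_congr_ae ?_
  filter_upwards [ae_shiftSet_of_ae_restrict hA k h] with x hx
  rw [hx.1, hx.2]

theorem aestronglyMeasurable_increment {A : Set V} (hA : MeasurableSet A) {v : V → ℝ}
    (hv : AEStronglyMeasurable v (volume.restrict A)) (k : V) :
    AEStronglyMeasurable (fun x => v (x + k) - v x) (volume.restrict (shiftSet A k)) := by
  obtain ⟨w, hw, hvw⟩ := hv
  refine ⟨fun x => w (x + k) - w x, ?_, ?_⟩
  · exact (hw.comp_measurable (measurable_add_const k)).sub hw
  · filter_upwards [ae_shiftSet_of_ae_restrict hA k hvw] with x hx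
    rw [hx.1, hx.2]

end Incr

instance instIsAddHaarMeasurePt (n : ℕ) : (volume : Measure (Pt n)).IsAddHaarMeasure :=
  inferInstanceAs (Measure.prod (volume : Measure (EuclideanSpace ℝ (Fin n)))
    (volume : Measure ℝ)).IsAddHaarMeasure

/-! ### Pairing weakly convergent functions with varying test functions. -/

section BanachSteinhaus

variable {n : ℕ} {p : ℝ} {Ω : Set (Pt n)} {vs : ℕ → Pt n → ℝ} {v : Pt n → ℝ}

theorem MemLpLoc.integrableOn (hp : 1 < p) (hv : MemLpLoc p Ω v) {K : Set (Pt n)} (hK : K ⊆ Ω)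
    (hKc : IsCompact K) : IntegrableOn v K := by
  have : IsFiniteMeasure (volume.restrict K) := ⟨by simpa using hKc.measure_lt_top⟩
  exact (hv K hK hKc).integrable (by simpa using hp.le)

theorem MemLpLoc.locallyIntegrableOn (hp : 1 < p) (hΩ : IsOpen Ω) (hv : MemLpLoc p Ω v) :
    LocallyIntegrableOn v Ω :=
  (locallyIntegrableOn_iff hΩ.isLocallyClosed).2 fun _ hK hKc => hv.integrableOn hp hK hKc

theorem MemLpLoc.aestronglyMeasurable (hp : 1 < p) (hΩ : IsOpen Ω) (hv : MemLpLoc p Ω v) :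
    AEStronglyMeasurable v (volume.restrict Ω) :=
  (hv.locallyIntegrableOn hp hΩ).aestronglyMeasurable

/-- Weak convergence bounds each pairing separately; Banach–Steinhaus makes the bound uniform.
Functionals on bounded continuous functions suffice, since the varying test functions will be
continuous and converge uniformly. -/
theorem WeakConvLpLoc.exists_bound (hp : 1 < p) (h : WeakConvLpLoc p Ω vs v) {K : Set (Pt n)}
    (hK : K ⊆ Ω) (hKc : IsCompact K) :
    ∃ C : ℝ, ∀ j, ∀ φ : BoundedContinuousFunction (Pt n) ℝ,
      |∫ x in K, vs j x * φ x| ≤ C * ‖φ‖ := by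
  have : IsFiniteMeasure (volume.restrict K) := ⟨by simpa using hKc.measure_lt_top⟩
  have hint : ∀ j, ∀ φ : BoundedContinuousFunction (Pt n) ℝ,
      IntegrableOn (fun x => vs j x * φ x) K := fun j φ =>
    ((h.1 j).integrableOn hp hK hKc).mul_bdd (c := ‖φ‖) φ.continuous.aestronglyMeasurable
      (Eventually.of_forall φ.norm_coe_le_norm)
  let T : ℕ → BoundedContinuousFunction (Pt n) ℝ →L[ℝ] ℝ := fun j =>
    LinearMap.mkContinuous
      { toFun := fun φ => ∫ x in K, vs j x * φ x
        map_add' := fun φ ψ => by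
          rw [← integral_add (hint j φ) (hint j ψ)]
          simp [mul_add]
        map_smul' := fun c φ => by
          rw [RingHom.id_apply, smul_eq_mul, ← integral_const_mul]
          simp [mul_left_comm] } (∫ x in K, ‖vs j x‖) (fun φ => by
        dsimp only [LinearMap.coe_mk, AddHom.coe_mk]
        rw [← integral_mul_const]
        refine norm_integral_le_of_norm_le
          (((h.1 j).integrableOn hp hK hKc).norm.mul_const _) (Eventually.of_forall fun x => ?_)
        rw [norm_mul]
        gcongr
        exact φ.norm_coe_le_norm x)
  obtain ⟨C, hC⟩ := banach_steinhaus (g := T) (fun φ => by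
    have hφ : MemLp φ (ENNReal.ofReal (p / (p - 1))) (volume.restrict K) :=
      MemLp.of_bound φ.continuous.aestronglyMeasurable ‖φ‖
        (Eventually.of_forall φ.norm_coe_le_norm)
    obtain ⟨C, hC⟩ := (h.2.2 K hK hKc φ hφ).norm.bddAbove_range
    exact ⟨C, fun i => hC ⟨i, rfl⟩⟩)
  exact ⟨C, fun j φ => (T j).le_of_opNorm_le (hC j) φ⟩

/-- Once a shift depending on `j` is moved to the test function, the test function depends on `j`
too; this lemma handles that situation. -/
theorem WeakConvLpLoc.tendsto_integral (hp : 1 < p) (h : WeakConvLpLoc p Ω vs v) {K : Set (Pt n)}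
    (hK : K ⊆ Ω) (hKc : IsCompact K) {ψs : ℕ → Pt n → ℝ} {ψ : Pt n → ℝ}
    (hψs : ∀ j, Continuous (ψs j)) (hψ : Continuous ψ) {B : ℝ} (hB : ∀ x, |ψ x| ≤ B)
    (hlim : TendstoUniformly ψs ψ atTop) :
    Tendsto (fun j => ∫ x in K, vs j x * ψs j x) atTop (𝓝 (∫ x in K, v x * ψ x)) := by
  have : IsFiniteMeasure (volume.restrict K) := ⟨by simpa using hKc.measure_lt_top⟩
  obtain ⟨C, hC⟩ := h.exists_bound hp hK hKc
  have h1 : Tendsto (fun j => ∫ x in K, vs j x * ψ x) atTop (𝓝 (∫ x in K, v x * ψ x)) :=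
    h.2.2 K hK hKc ψ (MemLp.of_bound hψ.aestronglyMeasurable B (Eventually.of_forall hB))
  have h2 : Tendsto (fun j => (∫ x in K, vs j x * ψs j x) - ∫ x in K, vs j x * ψ x) atTop (𝓝 0) := by
    rw [Metric.tendsto_nhds]
    intro δ hδ
    rw [Metric.tendstoUniformly_iff] at hlim
    have hC0 : 0 < |C| + 1 := by positivity
    filter_upwards [hlim (δ / (|C| + 1)) (by positivity)] with j hj
    have hd : ∀ x, ‖ψs j x - ψ x‖ ≤ δ / (|C| + 1) := fun x => by
      rw [← dist_eq_norm, dist_comm]; exact (hj x).le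
    let φ : BoundedContinuousFunction (Pt n) ℝ :=
      BoundedContinuousFunction.ofNormedAddCommGroup (fun x => ψs j x - ψ x) ((hψs j).sub hψ) _ hd
    have hφ : ‖φ‖ ≤ δ / (|C| + 1) :=
      BoundedContinuousFunction.norm_ofNormedAddCommGroup_le _ (by positivity) hd
    have hi : IntegrableOn (vs j) K := (h.1 j).integrableOn hp hK hKc
    have hi1 : IntegrableOn (fun x => vs j x * ψ x) K :=
      hi.mul_bdd (c := B) hψ.aestronglyMeasurable (Eventually.of_forall hB)
    have hi2 : IntegrableOn (fun x => vs j x * φ x) K :=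
      hi.mul_bdd (c := ‖φ‖) φ.continuous.aestronglyMeasurable
        (Eventually.of_forall φ.norm_coe_le_norm)
    have heq : ∫ x in K, vs j x * ψs j x = (∫ x in K, vs j x * φ x) + ∫ x in K, vs j x * ψ x := by
      rw [← integral_add hi2 hi1]
      congr 1 with x
      simp [φ]; ring
    rw [heq, add_sub_cancel_right, dist_zero_right]
    calc ‖∫ x in K, vs j x * φ x‖ ≤ C * ‖φ‖ := hC j φ
      _ ≤ |C| * (δ / (|C| + 1)) := by
          gcongr
          exact le_abs_self C
      _ < (|C| + 1) * (δ / (|C| + 1)) := by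
          gcongr
          linarith
      _ = δ := by field_simp
  simpa using h2.add h1

theorem WeakConvLpLoc.comp (h : WeakConvLpLoc p Ω vs v) {σ : ℕ → ℕ} (hσ : Tendsto σ atTop atTop) :
    WeakConvLpLoc p Ω (fun j => vs (σ j)) v :=
  ⟨fun j => h.1 (σ j), h.2.1, fun K hK hKc φ hφ => (h.2.2 K hK hKc φ hφ).comp hσ⟩

end BanachSteinhaus

end ThinFilm

namespace ThinFilm

/-! ### Lower semicontinuity of increments and of difference quotients. -/

section LowerSemicontinuity

variable {n : ℕ} {p : ℝ} {Ω : Set (Pt n)}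

/-- Discrete integration by parts. Extending `v` by zero outside `K` allows translation invariance
on the whole space; the two support conditions ensure that the extension is not seen. -/
theorem integral_increment_mul {K : Set (Pt n)} (hΩ : MeasurableSet Ω) (hK : K ⊆ Ω)
    (hKm : MeasurableSet K) {v φ : Pt n → ℝ} (hv : IntegrableOn v K) (hφ : Continuous φ) {B : ℝ}
    (hB : ∀ x, |φ x| ≤ B) (k : Pt n) (c : ℝ) (h1 : ∀ x, φ x ≠ 0 → x ∈ K)
    (h2 : ∀ x, φ x ≠ 0 → x + k ∈ K) :
    ∫ x in Ω, (shiftSet Ω k).indicator (fun x => c * (v (x + k) - v x)) x * φ x =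
      ∫ x in K, v x * (c * (φ (x - k) - φ x)) := by
  set w := K.indicator v with hw
  have hwi : Integrable w := hv.integrable_indicator hKm
  have i1 : Integrable fun x => w (x + k) * φ x :=
    (hwi.comp_add_right k).mul_bdd (c := B) hφ.aestronglyMeasurable (Eventually.of_forall hB)
  have i2 : Integrable fun x => w x * φ x :=
    hwi.mul_bdd (c := B) hφ.aestronglyMeasurable (Eventually.of_forall hB)
  have i3 : Integrable fun x => w x * φ (x - k) :=
    hwi.mul_bdd (c := B) (by fun_prop) (Eventually.of_forall fun x => hB _)
  calc ∫ x in Ω, (shiftSet Ω k).indicator (fun x => c * (v (x + k) - v x)) x * φ x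
      = ∫ x, c * (w (x + k) * φ x - w x * φ x) := by
        rw [← integral_indicator hΩ]
        congr 1 with x
        by_cases hx : φ x = 0
        · by_cases hxΩ : x ∈ Ω <;> simp [hx, hxΩ]
        · have a1 := h1 x hx
          have a2 := h2 x hx
          have a3 : x ∈ shiftSet Ω k := ⟨hK a1, hK a2⟩
          rw [indicator_of_mem (hK a1), indicator_of_mem a3, hw, indicator_of_mem a1,
            indicator_of_mem a2]
          ring
    _ = c * ((∫ x, w (x + k) * φ x) - ∫ x, w x * φ x) := by
        rw [integral_const_mul, integral_sub i1 i2]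
    _ = c * ((∫ x, w x * φ (x - k)) - ∫ x, w x * φ x) := by
        congr 2
        rw [← integral_add_right_eq_self (fun x => w x * φ (x - k)) k]
        simp
    _ = ∫ x, c * (w x * φ (x - k) - w x * φ x) := by
        rw [integral_const_mul, integral_sub i3 i2]
    _ = ∫ x in K, v x * (c * (φ (x - k) - φ x)) := by
        rw [← integral_indicator hKm]
        congr 1 with x
        by_cases hx : x ∈ K
        · simp only [hw, indicator_of_mem hx]; ring
        · simp [hw, hx]

/-- Weak convergence is only available on a fixed compact set, so one is needed that contains the
support and its translates for all shifts near the limit shift. -/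
theorem exists_compact_shift (hΩ : IsOpen Ω) {k : Pt n} {S : Set (Pt n)} (hS : IsCompact S)
    (hSk : S ⊆ shiftSet Ω k) :
    ∃ K ⊆ Ω, IsCompact K ∧ S ⊆ K ∧ ∀ᶠ k' in 𝓝 k, ∀ x ∈ S, x + k' ∈ K := by
  have hS' : IsCompact ((fun x => x + k) '' S) := hS.image (continuous_add_const k)
  obtain ⟨δ, hδ, hsub⟩ := hS'.exists_cthickening_subset_open hΩ (by
    rintro _ ⟨x, hx, rfl⟩
    exact (hSk hx).2)
  refine ⟨S ∪ Metric.cthickening δ ((fun x => x + k) '' S), union_subset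
    (hSk.trans (shiftSet_subset _ _)) hsub, hS.union hS'.cthickening, subset_union_left, ?_⟩
  filter_upwards [Metric.closedBall_mem_nhds k hδ] with k' hk' x hx
  refine Or.inr (Metric.mem_cthickening_of_dist_le (x + k') (x + k) δ _ ⟨x, hx, rfl⟩ ?_)
  rwa [dist_add_left]

theorem HasCompactSupport.exists_abs_le {φ : Pt n → ℝ} (h : HasCompactSupport φ)
    (hφ : Continuous φ) : ∃ B, ∀ x, |φ x| ≤ B :=
  h.exists_bound_of_continuous hφ

theorem tendsto_integral_increment_mul (hp : 1 < p) (hΩ : IsOpen Ω) {vs : ℕ → Pt n → ℝ}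
    {v : Pt n → ℝ} (h : WeakConvLpLoc p Ω vs v) {k : ℕ → Pt n} {k₀ : Pt n}
    (hk : Tendsto k atTop (𝓝 k₀)) (c : ℕ → ℝ) {φ ψ : Pt n → ℝ} (hφ : Continuous φ)
    (hφc : HasCompactSupport φ) (hφs : tsupport φ ⊆ shiftSet Ω k₀) (hψ : Continuous ψ) {B : ℝ}
    (hB : ∀ x, |ψ x| ≤ B)
    (hlim : TendstoUniformly (fun i x => c i * (φ (x - k i) - φ x)) ψ atTop) :
    Tendsto (fun i => ∫ x in Ω,
      (shiftSet Ω (k i)).indicator (fun x => c i * (vs i (x + k i) - vs i x)) x * φ x) atTop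
      (𝓝 (∫ x in Ω, v x * ψ x)) := by
  obtain ⟨K, hK, hKc, hSK, hev⟩ := exists_compact_shift hΩ hφc.isCompact hφs
  have hmem : ∀ x, φ x ≠ 0 → x ∈ tsupport φ := fun x hx => subset_tsupport φ hx
  obtain ⟨B', hB'⟩ := HasCompactSupport.exists_abs_le hφc hφ
  have hevk := hk.eventually hev
  have hψK : ∀ x ∉ K, ψ x = 0 := by
    intro x hx
    refine tendsto_nhds_unique (hlim.tendsto_at x) (tendsto_const_nhds.congr' ?_)
    filter_upwards [hevk] with i hi
    have h1 : φ x = 0 := by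
      by_contra h0
      exact hx (hSK (hmem x h0))
    have h2 : φ (x - k i) = 0 := by
      by_contra h0
      exact hx (by simpa using hi _ (hmem _ h0))
    simp [h1, h2]
  have hlast : ∫ x in Ω, v x * ψ x = ∫ x in K, v x * ψ x := by
    rw [← integral_indicator hΩ.measurableSet, ← integral_indicator hKc.measurableSet]
    congr 1 with x
    by_cases hx : x ∈ K
    · simp [hx, hK hx]
    · by_cases hxΩ : x ∈ Ω <;> simp [hx, hxΩ, hψK x hx]
  rw [hlast]
  refine (h.tendsto_integral hp hK hKc (fun j => by fun_prop) hψ hB hlim).congr' ?_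
  filter_upwards [hevk] with i hi
  exact (integral_increment_mul hΩ.measurableSet hK hKc.measurableSet
    ((h.1 i).integrableOn hp hK hKc) hφ hB' (k i) (c i) (fun x hx => hSK (hmem x hx))
    (fun x hx => hi x (hmem x hx))).symm

/-- Weak limits of (scaled) increments: if the scaled increments of `vs i` are bounded in `L^p`
then there is a function with a smaller norm whose pairings with test functions are computed by
moving the increments to the test functions. -/
theorem exists_limit_increment (hp : 1 < p) (hΩ : IsOpen Ω) (hΩf : volume Ω < ∞)
    {vs : ℕ → Pt n → ℝ} {v : Pt n → ℝ} (h : WeakConvLpLoc p Ω vs v) {k : ℕ → Pt n} {k₀ : Pt n}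
    (hk : Tendsto k atTop (𝓝 k₀)) (c : ℕ → ℝ) {M : ℝ≥0∞}
    (hM : liminf (fun i => ‖c i‖ₑ ^ p * incr p Ω (vs i) (k i)) atTop < M) (hMt : M ≠ ∞) :
    ∃ g : Pt n → ℝ, Measurable g ∧ IntegrableOn g Ω ∧ ∫⁻ x in Ω, ‖g x‖ₑ ^ p ≤ M ∧
      ∀ φ ψ : Pt n → ℝ, Continuous φ → HasCompactSupport φ → tsupport φ ⊆ shiftSet Ω k₀ →
        Continuous ψ → (∃ B, ∀ x, |ψ x| ≤ B) →
        TendstoUniformly (fun i x => c i * (φ (x - k i) - φ x)) ψ atTop →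
        ∫ x in Ω, g x * φ x = ∫ x in Ω, v x * ψ x := by
  have : IsFiniteMeasure (volume.restrict Ω) := ⟨by simpa using hΩf⟩
  -- The bound `M` holds only along a subsequence; the weak limit `g` is then taken along an
  -- ultrafilter finer than `atTop`. The pairings still converge to the integral against `v`, since
  -- those of the full sequence do.
  obtain ⟨σ, hσ, hσM⟩ := extraction_of_frequently_atTop (frequently_lt_of_liminf_lt (by
    isBoundedDefault) hM)
  have hσt := hσ.tendsto_atTop
  let G : ℕ → Pt n → ℝ := fun i => (shiftSet Ω (k (σ i))).indicator
    fun x => c (σ i) * (vs (σ i) (x + k (σ i)) - vs (σ i) x)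
  have hSm : ∀ k, MeasurableSet (shiftSet Ω k) := fun k => (isOpen_shiftSet hΩ k).measurableSet
  have hG : ∀ i, AEStronglyMeasurable (G i) (volume.restrict Ω) := by
    intro i
    rw [aestronglyMeasurable_indicator_iff (hSm _),
      Measure.restrict_restrict_of_subset (shiftSet_subset _ _)]
    exact (aestronglyMeasurable_increment hΩ.measurableSet
      ((h.1 (σ i)).aestronglyMeasurable hp hΩ) (k (σ i))).const_mul _
  have hGM : ∀ i, ∫⁻ x in Ω, ‖G i x‖ₑ ^ p ≤ M := by
    intro i
    refine le_trans (le_of_eq ?_) (hσM i).le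
    have : ∀ x, ‖G i x‖ₑ ^ p = (shiftSet Ω (k (σ i))).indicator
        (fun x => ‖c (σ i)‖ₑ ^ p * ‖vs (σ i) (x + k (σ i)) - vs (σ i) x‖ₑ ^ p) x := by
      intro x
      by_cases hx : x ∈ shiftSet Ω (k (σ i))
      · simp only [G, indicator_of_mem hx, enorm_mul]
        rw [ENNReal.mul_rpow_of_nonneg _ _ (by linarith)]
      · simp [G, hx, show 0 < p by linarith]
    simp_rw [this]
    rw [lintegral_indicator (hSm _), Measure.restrict_restrict_of_subset (shiftSet_subset _ _),
      lintegral_const_mul'' _ ?_]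
    · rfl
    · exact (aestronglyMeasurable_increment hΩ.measurableSet
        ((h.1 (σ i)).aestronglyMeasurable hp hΩ) (k (σ i))).enorm.pow_const p
  obtain ⟨g, hgm, hgi, hgl, hgM⟩ := exists_weak_limit hp hG hMt hGM (hyperfilter ℕ)
  refine ⟨g, hgm, hgi, hgM, fun φ ψ hφ hφc hφs hψ ⟨B, hB⟩ hlim => ?_⟩
  obtain ⟨B', hB'⟩ := HasCompactSupport.exists_abs_le hφc hφ
  refine tendsto_nhds_unique (hgl φ hφ.measurable B' hB') ?_
  have := tendsto_integral_increment_mul hp hΩ (h.comp hσt) (hk.comp hσt) (fun i => c (σ i)) hφ hφc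
    hφs hψ hB (fun s hs => hσt.eventually (hlim s hs))
  exact this.mono_left (Nat.hyperfilter_le_atTop)

/-- The weak limit of the increments of `vs i` agrees almost everywhere with the increment of `v`,
because both have the same pairings with smooth functions supported in the shift set; its norm does
not exceed the liminf. -/
theorem incr_le_liminf (hp : 1 < p) (hΩ : IsOpen Ω) (hΩf : volume Ω < ∞) {vs : ℕ → Pt n → ℝ}
    {v : Pt n → ℝ} (h : WeakConvLpLoc p Ω vs v) {k : ℕ → Pt n} {k₀ : Pt n}
    (hk : Tendsto k atTop (𝓝 k₀)) :
    incr p Ω v k₀ ≤ liminf (fun i => incr p Ω (vs i) (k i)) atTop := by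
  refine le_of_forall_gt_imp_ge_of_dense fun M hM => ?_
  rcases eq_or_ne M ∞ with rfl | hMt
  · exact le_top
  obtain ⟨g, -, hgi, hgM, hg⟩ := exists_limit_increment hp hΩ hΩf h hk (fun _ => 1)
    (by simpa using hM) hMt
  have hSo := isOpen_shiftSet hΩ k₀
  have hvl := h.2.1.locallyIntegrableOn hp hΩ
  have hDl : LocallyIntegrableOn (fun x => v (x + k₀) - v x) (shiftSet Ω k₀) := by
    rw [locallyIntegrableOn_iff hSo.isLocallyClosed]
    intro K hK hKc
    refine IntegrableOn.sub ?_ (h.2.1.integrableOn hp (hK.trans (shiftSet_subset _ _)) hKc)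
    have h1 : IntegrableOn v ((fun x => x + k₀) '' K) :=
      h.2.1.integrableOn hp (by rintro _ ⟨x, hx, rfl⟩; exact (hK hx).2)
        (hKc.image (continuous_add_const k₀))
    rw [show K = (fun x => x + k₀) ⁻¹' ((fun x => x + k₀) '' K) from
      (preimage_image_eq _ (add_left_injective k₀)).symm]
    exact ((measurePreserving_add_right volume k₀).integrableOn_comp_preimage
      (measurableEmbedding_addRight k₀)).2 h1
  have hgl : LocallyIntegrableOn g (shiftSet Ω k₀) :=
    (hgi.mono_set (shiftSet_subset _ _)).locallyIntegrableOn
  have hae : ∀ᵐ x, x ∈ shiftSet Ω k₀ → g x - (v (x + k₀) - v x) = 0 := by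
    refine hSo.ae_eq_zero_of_integral_contDiff_smul_eq_zero (hgl.sub hDl) fun φ hφ hφc hφs => ?_
    obtain ⟨B, hB⟩ := HasCompactSupport.exists_abs_le hφc hφ.continuous
    have hmem : ∀ x, φ x ≠ 0 → x ∈ tsupport φ := fun x hx => subset_tsupport φ hx
    obtain ⟨K, hK, hKc, hSK, hev⟩ := exists_compact_shift hΩ hφc.isCompact hφs
    have hvK := h.2.1.integrableOn hp hK hKc
    have hunif : TendstoUniformly (fun i x => 1 * (φ (x - k i) - φ x))
        (fun x => 1 * (φ (x - k₀) - φ x)) atTop := by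
      rw [Metric.tendstoUniformly_iff]
      intro δ hδ
      obtain ⟨r, hr, hφu⟩ := Metric.uniformContinuous_iff.1
        (hφc.uniformContinuous_of_continuous hφ.continuous) δ hδ
      filter_upwards [Metric.tendsto_nhds.1 hk r hr] with i hi x
      have := hφu (a := x - k₀) (b := x - k i) (by
        rw [dist_sub_left, dist_comm]; exact hi)
      simpa [Real.dist_eq] using this
    have h1 := hg φ (fun x => 1 * (φ (x - k₀) - φ x)) hφ.continuous hφc hφs
      (by have := hφ.continuous; fun_prop)
      ⟨B + B, fun x => by
        rw [one_mul]
        exact (abs_sub _ _).trans (add_le_add (hB _) (hB _))⟩ hunif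
    have h2 := integral_increment_mul hΩ.measurableSet hK hKc.measurableSet hvK hφ.continuous hB k₀ 1
      (fun x hx => hSK (hmem x hx)) (fun x hx => hev.self_of_nhds x (hmem x hx))
    have h3 : ∫ x in K, v x * (1 * (φ (x - k₀) - φ x)) =
        ∫ x in Ω, v x * (1 * (φ (x - k₀) - φ x)) := by
      rw [← integral_indicator hΩ.measurableSet, ← integral_indicator hKc.measurableSet]
      congr 1 with x
      by_cases hx : x ∈ K
      · simp [hx, hK hx]
      · have e1 : φ x = 0 := by
          by_contra h0
          exact hx (hSK (hmem x h0))
        have e2 : φ (x - k₀) = 0 := by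
          by_contra h0
          exact hx (by simpa using hev.self_of_nhds _ (hmem _ h0))
        by_cases hxΩ : x ∈ Ω <;> simp [hx, hxΩ, e1, e2]
    rw [h3, ← h1] at h2
    have e1 : ∫ x, φ x • (g x - (v (x + k₀) - v x)) =
        ∫ x in tsupport φ, (φ x * g x - φ x * (v (x + k₀) - v x)) := by
      rw [← integral_indicator hφc.isCompact.measurableSet]
      congr 1 with x
      by_cases hx : x ∈ tsupport φ
      · simp [hx]; ring
      · simp [hx, image_eq_zero_of_notMem_tsupport hx]
    have hφb : ∀ f : Pt n → ℝ, IntegrableOn f (tsupport φ) →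
        IntegrableOn (fun x => φ x * f x) (tsupport φ) := fun f hf =>
      hf.bdd_mul (c := B) hφ.continuous.aestronglyMeasurable (Eventually.of_forall hB)
    have i1 := hφb g (hgi.mono_set (hφs.trans (shiftSet_subset _ _)))
    have i2 := hφb _ (hDl.integrableOn_compact_subset hφs hφc.isCompact)
    rw [e1, integral_sub i1 i2, sub_eq_zero]
    have e2 : ∫ x in tsupport φ, φ x * g x = ∫ x in Ω, g x * φ x := by
      rw [← integral_indicator hφc.isCompact.measurableSet, ← integral_indicator hΩ.measurableSet]
      congr 1 with x
      by_cases hx : x ∈ tsupport φ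
      · simp [hx, (hφs hx).1, mul_comm]
      · by_cases hxΩ : x ∈ Ω <;> simp [hx, hxΩ, image_eq_zero_of_notMem_tsupport hx]
    rw [e2, ← h2, ← integral_indicator hφc.isCompact.measurableSet,
      ← integral_indicator hΩ.measurableSet]
    congr 1 with x
    by_cases hx : x ∈ tsupport φ
    · simp [hx, (hφs hx).1, hφs hx, mul_comm]
    · by_cases hxΩ : x ∈ Ω <;> simp [hx, hxΩ, image_eq_zero_of_notMem_tsupport hx]
  calc incr p Ω v k₀ = ∫⁻ x in shiftSet Ω k₀, ‖g x‖ₑ ^ p := by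
        refine lintegral_congr_ae ?_
        filter_upwards [(ae_restrict_iff' hSo.measurableSet).2 hae] with x hx
        rw [← sub_eq_zero.1 hx]
    _ ≤ ∫⁻ x in Ω, ‖g x‖ₑ ^ p := lintegral_mono_set (shiftSet_subset _ _)
    _ ≤ M := hgM

theorem abs_sub_sub_fderiv_le {V : Type*} [NormedAddCommGroup V] [NormedSpace ℝ V] {φ : V → ℝ}
    (hφ : Differentiable ℝ φ) {δ r : ℝ}
    (hδ : ∀ x y, dist x y < r → dist (fderiv ℝ φ x) (fderiv ℝ φ y) ≤ δ) (x : V) {k : V}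
    (hk : ‖k‖ < r) : ‖φ (x + k) - φ x - fderiv ℝ φ x k‖ ≤ δ * ‖k‖ := by
  have := (convex_ball x r).norm_image_sub_le_of_norm_fderiv_le' (𝕜 := ℝ) (f := φ)
    (φ := fderiv ℝ φ x) (x := x) (y := x + k) (C := δ) (fun y _ => hφ y) (fun y hy => by
      rw [← dist_eq_norm]
      exact hδ y x hy) (Metric.mem_ball_self ((norm_nonneg k).trans_lt hk)) (by simpa using hk)
  simpa using this

/-- The increments need not be parallel to `e`: it is enough that `k / h` tends to `e`, because the
first-order remainder is small compared with `‖k‖`, hence with `|h|`. The minus sign comes from the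
backward shift. -/
theorem tendstoUniformly_difference_quotient {φ : Pt n → ℝ}
    (hφ : ContDiff ℝ ((⊤ : ℕ∞) : WithTop ℕ∞) φ) (hφc : HasCompactSupport φ) {k : ℕ → Pt n}
    {h : ℕ → ℝ} {e : Pt n} (hk : Tendsto k atTop (𝓝 0))
    (hhk : Tendsto (fun i => (h i)⁻¹ • k i) atTop (𝓝 e)) :
    TendstoUniformly (fun i x => (h i)⁻¹ * (φ (x - k i) - φ x)) (fun x => -fderiv ℝ φ x e)
      atTop := by
  have hdc : Continuous (fderiv ℝ φ) := hφ.continuous_fderiv (by simp)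
  have hd : Differentiable ℝ φ := hφ.differentiable (by simp)
  have hc' := hφc.fderiv (𝕜 := ℝ)
  obtain ⟨L, hL⟩ := hc'.exists_bound_of_continuous hdc
  rw [Metric.tendstoUniformly_iff]
  intro δ hδ
  -- Half of the error goes to the first-order remainder, where `‖k / h‖` is eventually below `‖e‖ +
  -- 1`, and half to the deviation of `k / h` from `e`.
  set δ' := δ / (2 * (‖e‖ + 1)) with hδ'
  have hδ'0 : 0 < δ' := by positivity
  obtain ⟨r, hr, hφu⟩ := Metric.uniformContinuous_iff.1
    (hc'.uniformContinuous_of_continuous hdc) δ' hδ'0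
  have ev1 : ∀ᶠ i in atTop, ‖k i‖ < r := by
    have := hk.norm
    rw [norm_zero] at this
    exact this.eventually_lt_const hr
  have ev2 : ∀ᶠ i in atTop, ‖(h i)⁻¹ • k i‖ < ‖e‖ + 1 :=
    hhk.norm.eventually_lt_const (by linarith)
  have ev3 : ∀ᶠ i in atTop, (|L| + 1) * ‖(h i)⁻¹ • k i - e‖ < δ / 2 := by
    have := (tendsto_const_nhds (x := |L| + 1)).mul (hhk.sub_const e).norm
    rw [sub_self, norm_zero, mul_zero] at this
    exact this.eventually_lt_const (by positivity)
  filter_upwards [ev1, ev2, ev3] with i h1 h2 h3 x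
  have h4 := abs_sub_sub_fderiv_le hd (fun x y hxy => (hφu hxy).le) x (k := -k i) (by simpa using h1)
  rw [norm_neg, ← sub_eq_add_neg] at h4
  have h5 : -fderiv ℝ φ x e - (h i)⁻¹ * (φ (x - k i) - φ x) =
      -((h i)⁻¹ * (φ (x - k i) - φ x - fderiv ℝ φ x (-k i))) +
        fderiv ℝ φ x ((h i)⁻¹ • k i - e) := by
    simp; ring
  rw [dist_eq_norm, h5]
  calc _ ≤ ‖(h i)⁻¹‖ * ‖φ (x - k i) - φ x - fderiv ℝ φ x (-k i)‖ +
        ‖fderiv ℝ φ x ((h i)⁻¹ • k i - e)‖ := by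
        refine (norm_add_le _ _).trans ?_
        rw [norm_neg, norm_mul]
    _ ≤ ‖(h i)⁻¹‖ * (δ' * ‖k i‖) + (|L| + 1) * ‖(h i)⁻¹ • k i - e‖ := by
        gcongr
        refine ((fderiv ℝ φ x).le_opNorm _).trans ?_
        gcongr
        exact (hL x).trans (by linarith [le_abs_self L])
    _ = δ' * ‖(h i)⁻¹ • k i‖ + (|L| + 1) * ‖(h i)⁻¹ • k i - e‖ := by
        rw [norm_smul]; ring
    _ < δ' * (‖e‖ + 1) + δ / 2 := by
        gcongr
    _ = δ := by
        rw [hδ']; field_simp; ring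

/-- The weak limit of the difference quotients is itself a weak vertical derivative: moved to a test
function they converge uniformly to minus its vertical derivative. It is thus a competitor in the
infimum, and existence of the derivative comes as part of the conclusion. -/
theorem verticalDirichlet_le_liminf (hp : 1 < p) {ω : Set (EuclideanSpace ℝ (Fin n))}
    (hΩ : IsOpen (film ω 1)) (hΩf : volume (film ω 1) < ∞) {vs : ℕ → Pt n → ℝ} {v : Pt n → ℝ}
    (hv : WeakConvLpLoc p (film ω 1) vs v) {k : ℕ → Pt n} {h : ℕ → ℝ}
    (hk : Tendsto k atTop (𝓝 0)) (hhk : Tendsto (fun i => (h i)⁻¹ • k i) atTop (𝓝 (0, 1))) :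
    verticalDirichlet p ω v ≤
      liminf (fun i => ‖(h i)⁻¹‖ₑ ^ p * incr p (film ω 1) (vs i) (k i)) atTop := by
  refine le_of_forall_gt_imp_ge_of_dense fun M hM => ?_
  rcases eq_or_ne M ∞ with rfl | hMt
  · exact le_top
  obtain ⟨g, -, hgi, hgM, hg⟩ := exists_limit_increment hp hΩ hΩf hv hk _ hM hMt
  have hw : IsWeakVerticalDeriv (film ω 1) v g := by
    refine ⟨hv.2.1.locallyIntegrableOn hp hΩ, hgi.locallyIntegrableOn, fun φ hφ hφc hφs => ?_⟩
    have hdc : Continuous (fderiv ℝ φ) := hφ.continuous_fderiv (by simp)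
    obtain ⟨L, hL⟩ := (hφc.fderiv (𝕜 := ℝ)).exists_bound_of_continuous hdc
    rw [hg φ (fun x => -fderiv ℝ φ x (0, 1)) hφ.continuous hφc
      -- The limit shift is `0`, so the shift set is the whole film and every test function
      -- supported in it is admissible.
      (fun x hx => ⟨hφs hx, by simpa using hφs hx⟩) (by fun_prop)
      ⟨L * ‖((0, 1) : Pt n)‖, fun x => by
        rw [abs_neg]
        exact ((fderiv ℝ φ x).le_opNorm _).trans (by gcongr; exact hL x)⟩
      (tendstoUniformly_difference_quotient hφ hφc hk hhk)]
    simp [integral_neg]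
  refine (iInf₂_le g hw).trans (le_trans (le_of_eq ?_) hgM)
  congr 1 with x
  rw [Real.enorm_eq_ofReal_abs, ENNReal.ofReal_rpow_of_nonneg (abs_nonneg _) (by linarith)]

end LowerSemicontinuity

end ThinFilm

namespace ThinFilm

/-! ### The exact formula for the energy in slope variables. -/

section EnergyFormula

theorem enorm_rpow_eq_ofReal (a : ℝ) {p : ℝ} (hp : 0 ≤ p) : ‖a‖ₑ ^ p = ENNReal.ofReal (|a| ^ p) := by
  rw [Real.enorm_eq_ofReal_abs, ENNReal.ofReal_rpow_of_nonneg (abs_nonneg _) hp]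

theorem measurable_incr {V : Type*} [NormedAddCommGroup V] [MeasureSpace V] [BorelSpace V]
    [SecondCountableTopology V] [SFinite (volume : Measure V)] (p : ℝ) {A : Set V}
    (hA : MeasurableSet A) {v : V → ℝ} (hv : Measurable v) : Measurable (incr p A v) := by
  have hS : ∀ k, MeasurableSet (shiftSet A k) := fun k =>
    hA.inter (hA.preimage (measurable_add_const k))
  have h1 : incr p A v = fun k => ∫⁻ x,
      ({z : V × V | z.2 ∈ A ∧ z.2 + z.1 ∈ A}.indicator
        fun z => ‖v (z.2 + z.1) - v z.2‖ₑ ^ p) (k, x) := by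
    ext k
    rw [incr, ← lintegral_indicator (hS k)]
    rfl
  rw [h1]
  refine Measurable.lintegral_prod_right' (Measurable.indicator (by fun_prop) ?_)
  exact (hA.preimage measurable_snd).inter
    (hA.preimage (measurable_snd.add measurable_fst))

theorem measurable_incr_of_ae {V : Type*} [NormedAddCommGroup V] [MeasureSpace V] [BorelSpace V]
    [SecondCountableTopology V] [(volume : Measure V).IsAddHaarMeasure]
    [SFinite (volume : Measure V)] (p : ℝ) {A : Set V}
    (hA : MeasurableSet A) {v : V → ℝ} (hv : AEStronglyMeasurable v (volume.restrict A)) :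
    Measurable (incr p A v) := by
  obtain ⟨w, hw, hvw⟩ := hv
  rw [show incr p A v = incr p A w from funext fun k => incr_congr p hA hvw k]
  exact measurable_incr p hA hw.measurable

theorem lintegral_eq_mul_lintegral_smul {V : Type*} [NormedAddCommGroup V] [NormedSpace ℝ V]
    [FiniteDimensional ℝ V] [MeasurableSpace V] [BorelSpace V] (μ : Measure V)
    [μ.IsAddHaarMeasure] {f : V → ℝ≥0∞} (hf : Measurable f) {R : ℝ} (hR : 0 < R) :
    ∫⁻ x, f x ∂μ = ENNReal.ofReal (R ^ Module.finrank ℝ V) * ∫⁻ x, f (R • x) ∂μ := by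
  have h1 : ∫⁻ x, f (R • x) ∂μ = ∫⁻ x, f x ∂(Measure.map (R • ·) μ) :=
    (lintegral_map hf (measurable_const_smul R)).symm
  have hpos : 0 < R ^ Module.finrank ℝ V := by positivity
  rw [h1, Measure.map_addHaar_smul μ hR.ne', lintegral_smul_measure, smul_eq_mul, ← mul_assoc,
    ← ENNReal.ofReal_mul hpos.le, abs_of_pos (by positivity), mul_inv_cancel₀ hpos.ne']
  simp

variable {n : ℕ}

theorem lintegral_eq_mul_lintegral_scale {f : Pt n → ℝ≥0∞} (hf : Measurable f) {ε : ℝ}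
    (hε : 0 < ε) : ∫⁻ x, f x = ENNReal.ofReal ε * ∫⁻ x : Pt n, f (x.1, ε * x.2) := by
  have hf2 : Measurable fun x : Pt n => f (x.1, ε * x.2) := by fun_prop
  rw [Measure.volume_eq_prod, lintegral_prod _ hf.aemeasurable, lintegral_prod _ hf2.aemeasurable,
    ← lintegral_const_mul _ hf2.lintegral_prod_right']
  congr 1 with a
  rw [lintegral_eq_mul_lintegral_smul volume (f := fun t => f (a, t)) (by fun_prop) hε]
  simp

/-- The horizontal part of the increment is measured in units of `ε |h|`, so that the Euclidean
distance factors into a function of `h` times a function of `ξ`. The null set `h = 0` is discarded.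
-/
theorem lintegral_eq_lintegral_lintegral_slope {G : Pt n → ℝ≥0∞} (hG : Measurable G) {ε : ℝ}
    (hε : 0 < ε) :
    ∫⁻ k, G k = ∫⁻ ξ : EuclideanSpace ℝ (Fin n), ∫⁻ h : ℝ,
      ENNReal.ofReal ((ε * |h|) ^ n) * G ((ε * |h|) • ξ, h) := by
  have hswap := lintegral_lintegral_swap (μ := (volume : Measure (EuclideanSpace ℝ (Fin n))))
    (ν := (volume : Measure ℝ))
    (f := fun ξ h => ENNReal.ofReal ((ε * |h|) ^ n) * G ((ε * |h|) • ξ, h))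
    (Measurable.aemeasurable (by dsimp only [Function.uncurry_def]; fun_prop))
  rw [hswap, Measure.volume_eq_prod, lintegral_prod_symm' _ hG]
  refine lintegral_congr_ae ?_
  filter_upwards [compl_mem_ae_iff.2 (measure_singleton (μ := (volume : Measure ℝ)) 0)] with h hh
  have hR : 0 < ε * |h| := mul_pos hε (abs_pos.2 hh)
  rw [lintegral_const_mul _ (by fun_prop), lintegral_eq_mul_lintegral_smul volume
    (f := fun ξ : EuclideanSpace ℝ (Fin n) => G (ξ, h)) (by fun_prop) hR]
  simp

/-- The weight `(1 + |ξ|²)^(-(d + s p) / 2)`, `d = n + 1`. -/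
noncomputable def horizWeight (n : ℕ) (p s : ℝ) (ξ : EuclideanSpace ℝ (Fin n)) : ℝ≥0∞ :=
  ENNReal.ofReal (1 / (1 + ‖ξ‖ ^ 2) ^ ((((n : ℝ) + 1) + s * p) / 2))

/-- The weight `|h|^(-(1 + s p))`. -/
noncomputable def vertWeight (p s h : ℝ) : ℝ≥0∞ := ENNReal.ofReal (1 / |h| ^ (1 + s * p))

/-- The part of the energy due to the increments in the directions `(ε |h| ξ, h)`. -/
noncomputable def slopeEnergy (p s ε : ℝ) (A : Set (Pt n)) (v : Pt n → ℝ)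
    (ξ : EuclideanSpace ℝ (Fin n)) : ℝ≥0∞ :=
  ∫⁻ h : ℝ, vertWeight p s h * incr p A v ((ε * |h|) • ξ, h)

theorem measurable_horizWeight (p s : ℝ) : Measurable (horizWeight n p s) := by
  unfold horizWeight; fun_prop

theorem measurable_vertWeight (p s : ℝ) : Measurable (vertWeight p s) := by
  unfold vertWeight; fun_prop

theorem measurable_slopeEnergy {p s ε : ℝ} {A : Set (Pt n)} (hA : MeasurableSet A) {v : Pt n → ℝ}
    (hv : AEStronglyMeasurable v (volume.restrict A)) : Measurable (slopeEnergy p s ε A v) := by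
  have h1 := measurable_incr_of_ae p hA hv
  have h2 := measurable_vertWeight p s
  unfold slopeEnergy
  refine Measurable.lintegral_prod_right' (f := fun z : EuclideanSpace ℝ (Fin n) × ℝ =>
    vertWeight p s z.2 * incr p A v ((ε * |z.2|) • z.1, z.2)) ?_
  fun_prop

theorem measurableSet_film {ω : Set (EuclideanSpace ℝ (Fin n))} (hω : MeasurableSet ω) (ε : ℝ) :
    MeasurableSet (film ω ε) := hω.prod measurableSet_Ioo

theorem mem_film_scale {ω : Set (EuclideanSpace ℝ (Fin n))} {ε : ℝ} (hε : 0 < ε) (x : Pt n) :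
    (x.1, ε * x.2) ∈ film ω ε ↔ x ∈ film ω 1 := by
  simp only [film, mem_prod, mem_Ioo, mul_pos_iff_of_pos_left hε]
  rw [mul_lt_iff_lt_one_right hε]

/-- Count of powers: `ε²` from the two vertical rescalings and `(ε |h|)^n` from the slope
substitution, against `(ε |h|)^(n + 1 + s p)` from the distance, leave `ε^(1 - s p) |h|^(-(1 + s
p))`. This is why the energy is normalised by `ε^(1 - s p)`. -/
theorem scaled_kernel {p s ε h a : ℝ} (hε : 0 < ε) (hh : h ≠ 0) {m : ℝ}  :
    (1 / ε ^ (1 - s * p)) * (ε ^ 2 * ((ε * |h|) ^ n *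
      (a / Real.sqrt ((ε * |h| * m) ^ 2 + |ε * h| ^ 2) ^ (((n : ℝ) + 1) + s * p)))) =
    (1 / (1 + m ^ 2) ^ ((((n : ℝ) + 1) + s * p) / 2)) * ((1 / |h| ^ (1 + s * p)) * a) := by
  have hh' : 0 < |h| := abs_pos.2 hh
  have hR : 0 < ε * |h| := by positivity
  have e1 : Real.sqrt ((ε * |h| * m) ^ 2 + |ε * h| ^ 2) = (ε * |h|) * Real.sqrt (1 + m ^ 2) := by
    rw [show (ε * |h| * m) ^ 2 + |ε * h| ^ 2 = (ε * |h|) ^ 2 * (1 + m ^ 2) by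
      rw [abs_mul, abs_of_pos hε]; ring, Real.sqrt_mul (by positivity), Real.sqrt_sq hR.le]
  have e2 : Real.sqrt (1 + m ^ 2) ^ (((n : ℝ) + 1) + s * p) =
      (1 + m ^ 2) ^ ((((n : ℝ) + 1) + s * p) / 2) := by
    rw [Real.sqrt_eq_rpow, ← Real.rpow_mul (by positivity)]
    congr 1; ring
  have e3 : (ε * |h|) ^ (((n : ℝ) + 1) + s * p) = (ε * |h|) ^ n * (ε * ε ^ (s * p)) *
      |h| ^ (1 + s * p) := by
    rw [show ((n : ℝ) + 1) + s * p = n + (1 + s * p) by ring, Real.rpow_add hR, Real.rpow_natCast,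
      Real.mul_rpow (x := ε) hε.le hh'.le, Real.rpow_add hε, Real.rpow_one]
    ring
  have e4 : ε ^ (1 - s * p) = ε / ε ^ (s * p) := by
    rw [Real.rpow_sub hε, Real.rpow_one]
  have := Real.rpow_pos_of_pos hε (s * p)
  have := Real.rpow_pos_of_pos hh' (1 + s * p)
  have := Real.rpow_pos_of_pos (show 0 < 1 + m ^ 2 by positivity) ((((n : ℝ) + 1) + s * p) / 2)
  rw [e1, Real.mul_rpow hR.le (Real.sqrt_nonneg _), e2, e3, e4]
  field_simp

/-- The central identity: after it, `ε` survives only in the horizontal part of the shift and in the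
rescaled function. -/
theorem gagliardo_eq {p s ε : ℝ} (hp : 0 ≤ p) (hε : 0 < ε) {ω : Set (EuclideanSpace ℝ (Fin n))}
    (hω : MeasurableSet ω) {u : Pt n → ℝ} (hu : Measurable u) :
    ENNReal.ofReal (1 / ε ^ (1 - s * p)) * gagliardo p s (film ω ε) u =
      ∫⁻ ξ, horizWeight n p s ξ * slopeEnergy p s ε (film ω 1) (rescale ε u) ξ := by
  set A : ℝ := ((n : ℝ) + 1) + s * p with hA
  have hfm := measurableSet_film hω ε
  let F : Pt n × Pt n → ℝ≥0∞ := (film ω ε ×ˢ film ω ε).indicator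
    fun z => ENNReal.ofReal (|u z.1 - u z.2| ^ p / eucDist z.1 z.2 ^ A)
  have hF : Measurable F := by
    refine Measurable.indicator ?_ (hfm.prod hfm)
    unfold eucDist
    fun_prop
  have hv : Measurable (rescale ε u) := by unfold rescale; fun_prop
  let κ : Pt n → ℝ≥0∞ := fun k =>
    ENNReal.ofReal (1 / Real.sqrt (‖k.1‖ ^ 2 + |ε * k.2| ^ 2) ^ A)
  have hκ : Measurable κ := by fun_prop
  have hinc := measurable_incr p (measurableSet_film hω 1) hv
  have step1 : gagliardo p s (film ω ε) u =
      ENNReal.ofReal (ε ^ 2) * ∫⁻ k, κ k * incr p (film ω 1) (rescale ε u) k := by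
    calc gagliardo p s (film ω ε) u = ∫⁻ x, ∫⁻ y, F (x, y) := by
          rw [← lintegral_prod _ hF.aemeasurable, ← Measure.volume_eq_prod, gagliardo,
            ← lintegral_indicator (hfm.prod hfm)]
      _ = ∫⁻ x, ENNReal.ofReal ε * ∫⁻ y : Pt n, F (x, (y.1, ε * y.2)) := by
          congr 1 with x
          exact lintegral_eq_mul_lintegral_scale (f := fun y => F (x, y)) (by fun_prop) hε
      _ = ENNReal.ofReal (ε ^ 2) * ∫⁻ x : Pt n, ∫⁻ y : Pt n, F ((x.1, ε * x.2), (y.1, ε * y.2)) := by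
          have hm : Measurable fun x : Pt n => ∫⁻ y : Pt n, F (x, (y.1, ε * y.2)) :=
            Measurable.lintegral_prod_right' (f := fun z : Pt n × Pt n =>
              F (z.1, (z.2.1, ε * z.2.2))) (by fun_prop)
          rw [lintegral_const_mul _ hm, lintegral_eq_mul_lintegral_scale hm hε, ← mul_assoc,
            ← ENNReal.ofReal_mul hε.le, sq]
      -- The increment `k = y - x` becomes the variable, and Tonelli puts it outside. For fixed `k`
      -- the distance is constant and the `x`-integral is the norm of an increment.
      _ = ENNReal.ofReal (ε ^ 2) * ∫⁻ x : Pt n, ∫⁻ k : Pt n,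
            F ((x.1, ε * x.2), ((x + k).1, ε * (x + k).2)) := by
          congr 2 with x
          exact (lintegral_add_left_eq_self (fun y : Pt n => F ((x.1, ε * x.2), (y.1, ε * y.2)))
            x).symm
      _ = ENNReal.ofReal (ε ^ 2) * ∫⁻ k : Pt n, ∫⁻ x : Pt n,
            F ((x.1, ε * x.2), ((x + k).1, ε * (x + k).2)) := by
          rw [lintegral_lintegral_swap]
          exact Measurable.aemeasurable (by dsimp only [Function.uncurry_def]; fun_prop)
      _ = _ := by
          congr 2 with k
          have hSm : MeasurableSet (shiftSet (film ω 1) k) :=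
            (measurableSet_film hω 1).inter
              ((measurableSet_film hω 1).preimage (measurable_add_const k))
          rw [incr, ← lintegral_const_mul _ (by fun_prop), ← lintegral_indicator hSm]
          congr 1 with x
          by_cases hx : x ∈ shiftSet (film ω 1) k
          · have hx2 : ((x.1, ε * x.2), ((x + k).1, ε * (x + k).2)) ∈ film ω ε ×ˢ film ω ε :=
              ⟨(mem_film_scale hε x).2 hx.1, (mem_film_scale hε (x + k)).2 hx.2⟩
            rw [indicator_of_mem hx]
            simp only [F, indicator_of_mem hx2]
            rw [enorm_rpow_eq_ofReal _ hp, ← ENNReal.ofReal_mul (by positivity)]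
            congr 1
            simp only [eucDist, rescale, Prod.fst_add, Prod.snd_add]
            rw [abs_sub_comm, show x.1 - (x.1 + k.1) = -k.1 by abel, norm_neg,
              show ε * x.2 - ε * (x.2 + k.2) = -(ε * k.2) by ring, abs_neg]
            ring
          · have hx2 : ((x.1, ε * x.2), ((x + k).1, ε * (x + k).2)) ∉ film ω ε ×ˢ film ω ε :=
              fun h => hx ⟨(mem_film_scale hε x).1 h.1, (mem_film_scale hε (x + k)).1 h.2⟩
            rw [indicator_of_notMem hx]
            simp only [F, indicator_of_notMem hx2]
  rw [step1, lintegral_eq_lintegral_lintegral_slope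
    (G := fun k => κ k * incr p (film ω 1) (rescale ε u) k) (hκ.mul hinc) hε, ← mul_assoc,
    ← lintegral_const_mul _ (by
      refine Measurable.lintegral_prod_right' (f := fun z : EuclideanSpace ℝ (Fin n) × ℝ =>
        ENNReal.ofReal ((ε * |z.2|) ^ n) * (κ ((ε * |z.2|) • z.1, z.2) *
          incr p (film ω 1) (rescale ε u) ((ε * |z.2|) • z.1, z.2))) ?_
      fun_prop)]
  congr 1 with ξ
  have hm2 : Measurable fun h : ℝ => ((((ε * |h|) • ξ, h)) : Pt n) := by fun_prop
  have hvw := measurable_vertWeight p s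
  rw [slopeEnergy, ← lintegral_const_mul _ (by fun_prop), ← lintegral_const_mul _ (by fun_prop)]
  refine lintegral_congr_ae ?_
  filter_upwards [compl_mem_ae_iff.2 (measure_singleton (μ := (volume : Measure ℝ)) 0)] with h hh
  rw [← mul_assoc, ← mul_assoc, ← mul_assoc]
  congr 1
  simp only [κ, horizWeight, vertWeight]
  rw [← ENNReal.ofReal_mul (by positivity), ← ENNReal.ofReal_mul (by positivity),
    ← ENNReal.ofReal_mul (by positivity), ← ENNReal.ofReal_mul (by positivity)]
  congr 1
  have := scaled_kernel (n := n) (p := p) (s := s) (a := 1) hε hh (m := ‖ξ‖)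
  rw [mul_one] at this
  rw [← this, norm_smul, Real.norm_eq_abs, abs_mul, abs_abs, abs_of_pos hε]
  ring

theorem gagliardo_congr {p s : ℝ} {A : Set (Pt n)} {u w : Pt n → ℝ}
    (h : u =ᵐ[volume.restrict A] w) : gagliardo p s A u = gagliardo p s A w := by
  refine lintegral_congr_ae ?_
  rw [Measure.volume_eq_prod, ← Measure.prod_restrict]
  filter_upwards [Measure.quasiMeasurePreserving_fst.ae h, Measure.quasiMeasurePreserving_snd.ae h]
    with z h1 h2
  rw [h1, h2]

theorem ae_rescale {ε : ℝ} (hε : 0 < ε) {ω : Set (EuclideanSpace ℝ (Fin n))}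
    (hω : MeasurableSet ω) {P : Pt n → Prop} (h : ∀ᵐ x ∂(volume.restrict (film ω ε)), P x) :
    ∀ᵐ x ∂(volume.restrict (film ω 1)), P (x.1, ε * x.2) := by
  rw [ae_restrict_iff' (measurableSet_film hω ε)] at h
  rw [ae_restrict_iff' (measurableSet_film hω 1)]
  have hq : Measure.QuasiMeasurePreserving (fun x : Pt n => (x.1, ε * x.2)) volume volume := by
    refine ⟨by fun_prop, Measure.AbsolutelyContinuous.mk fun E hE h0 => ?_⟩
    rw [Measure.map_apply (by fun_prop) hE]
    have h1 := lintegral_eq_mul_lintegral_scale (n := n) (f := E.indicator 1)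
      (measurable_one.indicator hE) hε
    rw [lintegral_indicator_one hE, h0] at h1
    have h2 : ∫⁻ x : Pt n, E.indicator 1 (x.1, ε * x.2) = (0 : ℝ≥0∞) := by
      rcases mul_eq_zero.1 h1.symm with h | h
      · simp at h; linarith
      · exact h
    rw [← lintegral_indicator_one (hE.preimage (by fun_prop))]
    exact h2
  filter_upwards [hq.ae h] with x hx hxΩ
  exact hx ((mem_film_scale hε x).2 hxΩ)

theorem gagliardo_eq_of_ae {p s ε : ℝ} (hp : 0 ≤ p) (hε : 0 < ε)
    {ω : Set (EuclideanSpace ℝ (Fin n))} (hω : MeasurableSet ω) {u : Pt n → ℝ}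
    (hu : AEStronglyMeasurable u (volume.restrict (film ω ε))) :
    ENNReal.ofReal (1 / ε ^ (1 - s * p)) * gagliardo p s (film ω ε) u =
      ∫⁻ ξ, horizWeight n p s ξ * slopeEnergy p s ε (film ω 1) (rescale ε u) ξ := by
  obtain ⟨w, hw, huw⟩ := hu
  rw [gagliardo_congr huw, gagliardo_eq hp hε hω hw.measurable]
  have := ae_rescale hε hω huw
  have h2 : ∀ k, incr p (film ω 1) (rescale ε w) k = incr p (film ω 1) (rescale ε u) k := fun k =>
    (incr_congr p (measurableSet_film hω 1) this k).symm
  simp only [slopeEnergy, h2]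

/-- Outside the fractional Sobolev space the energy is infinite while the integral may be finite.
The inequality is all that the lower bound needs. -/
theorem le_energy {p s ε : ℝ} (hp : 0 ≤ p) (hε : 0 < ε)
    {ω : Set (EuclideanSpace ℝ (Fin n))} (hω : MeasurableSet ω) (u : Pt n → ℝ) :
    ∫⁻ ξ, horizWeight n p s ξ * slopeEnergy p s ε (film ω 1) (rescale ε u) ξ ≤
      energy p ω s ε u := by
  rw [energy]
  split_ifs with h
  · exact (gagliardo_eq_of_ae hp hε hω h.1.1).ge
  · exact le_top

/-- Brings the limit functional to the same form as the inner integral of the energy formula, with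
the purely vertical shift `(0, h)`. -/
theorem verticalGagliardo_eq {p s : ℝ} (hp : 0 ≤ p) {ω : Set (EuclideanSpace ℝ (Fin n))}
    (hω : MeasurableSet ω) {v : Pt n → ℝ} (hv : Measurable v) :
    verticalGagliardo p s ω v = ∫⁻ h : ℝ, vertWeight p s h * incr p (film ω 1) v (0, h) := by
  have hfm := measurableSet_film hω 1
  let F : Pt n × ℝ → ℝ≥0∞ := fun z => {z : Pt n × ℝ | z.1 ∈ film ω 1 ∧ z.2 ∈ Ioo (0 : ℝ) 1}.indicator
    (fun z => vertWeight p s (z.2 - z.1.2) * ‖v (z.1.1, z.2) - v z.1‖ₑ ^ p) z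
  have hF : Measurable F := by
    refine Measurable.indicator ?_ ((hfm.preimage measurable_fst).inter
      (measurableSet_Ioo.preimage measurable_snd))
    have := measurable_vertWeight p s
    fun_prop
  calc verticalGagliardo p s ω v = ∫⁻ x', ∫⁻ t, ∫⁻ r, F ((x', t), r) := by
        rw [verticalGagliardo, ← lintegral_indicator hω]
        congr 1 with x'
        by_cases hx : x' ∈ ω
        · rw [indicator_of_mem hx, ← lintegral_indicator measurableSet_Ioo]
          congr 1 with t
          by_cases ht : t ∈ Ioo (0 : ℝ) 1
          · rw [indicator_of_mem ht, ← lintegral_indicator measurableSet_Ioo]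
            congr 1 with r
            by_cases hr : r ∈ Ioo (0 : ℝ) 1
            · have hmem : ((x', t), r) ∈ {z : Pt n × ℝ | z.1 ∈ film ω 1 ∧ z.2 ∈ Ioo (0 : ℝ) 1} :=
                ⟨⟨hx, ht⟩, hr⟩
              simp only [F]
              rw [indicator_of_mem hr, indicator_of_mem hmem]
              dsimp only
              rw [vertWeight, enorm_rpow_eq_ofReal _ hp, ← ENNReal.ofReal_mul (by positivity),
                abs_sub_comm, abs_sub_comm r t]
              congr 1; ring
            · rw [indicator_of_notMem hr]
              exact (indicator_of_notMem (fun h => hr h.2) _).symm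
          · have : ∀ r, F ((x', t), r) = 0 := fun r =>
              indicator_of_notMem (fun h => ht h.1.2) _
            simp [ht, this]
        · have : ∀ t r, F ((x', t), r) = 0 := fun t r =>
            indicator_of_notMem (fun h => hx h.1.1) _
          simp [hx, this]
    _ = ∫⁻ x : Pt n, ∫⁻ r, F (x, r) := by
        rw [Measure.volume_eq_prod, lintegral_prod _ hF.lintegral_prod_right'.aemeasurable]
    _ = ∫⁻ x : Pt n, ∫⁻ h, F (x, x.2 + h) := by
        congr 1 with x
        exact (lintegral_add_left_eq_self (fun r => F (x, r)) x.2).symm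
    _ = ∫⁻ h, ∫⁻ x : Pt n, F (x, x.2 + h) := by
        rw [lintegral_lintegral_swap]
        exact Measurable.aemeasurable (by dsimp only [Function.uncurry_def]; fun_prop)
    _ = _ := by
        congr 1 with h
        have hSm : MeasurableSet (shiftSet (film ω 1) (0, h)) :=
          hfm.inter (hfm.preimage (measurable_add_const _))
        rw [incr, ← lintegral_const_mul _ (by fun_prop), ← lintegral_indicator hSm]
        congr 1 with x
        have hiff : x ∈ shiftSet (film ω 1) (0, h) ↔
            (x, x.2 + h) ∈ {z : Pt n × ℝ | z.1 ∈ film ω 1 ∧ z.2 ∈ Ioo (0 : ℝ) 1} := by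
          simp only [shiftSet, film, mem_ofPred_eq, mem_prod, Prod.fst_add, Prod.snd_add, add_zero]
          tauto
        by_cases hx : x ∈ shiftSet (film ω 1) (0, h)
        · simp only [F]
          rw [indicator_of_mem hx, indicator_of_mem (hiff.1 hx)]
          dsimp only
          rw [add_sub_cancel_left, show x + (0, h) = (x.1, x.2 + h) by
            ext1 <;> simp]
        · simp only [F]
          rw [indicator_of_notMem hx, indicator_of_notMem (fun h => hx (hiff.2 h))]

theorem verticalGagliardo_congr {p s : ℝ} {ω : Set (EuclideanSpace ℝ (Fin n))} {v w : Pt n → ℝ}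
    (h : v =ᵐ[volume.restrict (film ω 1)] w) :
    verticalGagliardo p s ω v = verticalGagliardo p s ω w := by
  rw [film, Measure.volume_eq_prod, ← Measure.prod_restrict] at h
  refine lintegral_congr_ae ?_
  filter_upwards [Measure.ae_ae_of_ae_prod h] with x' hx
  refine lintegral_congr_ae ?_
  filter_upwards [hx] with t ht
  refine lintegral_congr_ae ?_
  filter_upwards [hx] with r hr
  rw [ht, hr]

theorem verticalGagliardo_eq_of_ae {p s : ℝ} (hp : 0 ≤ p) {ω : Set (EuclideanSpace ℝ (Fin n))}
    (hω : MeasurableSet ω) {v : Pt n → ℝ}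
    (hv : AEStronglyMeasurable v (volume.restrict (film ω 1))) :
    verticalGagliardo p s ω v = ∫⁻ h : ℝ, vertWeight p s h * incr p (film ω 1) v (0, h) := by
  obtain ⟨w, hw, hvw⟩ := hv
  rw [verticalGagliardo_congr hvw, verticalGagliardo_eq hp hω hw.measurable]
  simp only [incr_congr p (measurableSet_film hω 1) hvw]

end EnergyFormula

end ThinFilm

namespace ThinFilm

/-! ### Concentration of the weights `σ |h|^(σ - 1)` as `σ → 0`. -/

section Concentration

theorem lintegral_abs_rpow_sub_one {σ δ : ℝ} (hσ : 0 < σ) (hδ : 0 < δ) :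
    ∫⁻ h in Ioo (-δ) δ, ENNReal.ofReal (|h| ^ (σ - 1)) = ENNReal.ofReal (2 * (δ ^ σ / σ)) := by
  have hpos : ∫⁻ h in Ioo 0 δ, ENNReal.ofReal (|h| ^ (σ - 1)) = ENNReal.ofReal (δ ^ σ / σ) := by
    have hi : IntervalIntegrable (fun x : ℝ => x ^ (σ - 1)) volume 0 δ :=
      intervalIntegral.intervalIntegrable_rpow' (by linarith)
    have h1 := integral_rpow (a := 0) (b := δ) (r := σ - 1) (Or.inl (by linarith))
    rw [sub_add_cancel, Real.zero_rpow hσ.ne', sub_zero,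
      intervalIntegral.integral_of_le hδ.le, integral_Ioc_eq_integral_Ioo] at h1
    rw [← h1, ofReal_integral_eq_lintegral_ofReal]
    · refine setLIntegral_congr_fun measurableSet_Ioo fun x hx => ?_
      rw [abs_of_pos hx.1]
    · exact ((intervalIntegrable_iff_integrableOn_Ioo_of_le hδ.le).1 hi)
    · exact (ae_restrict_mem measurableSet_Ioo).mono fun x hx => Real.rpow_nonneg hx.1.le _
  have hneg : ∫⁻ h in Ioo (-δ) 0, ENNReal.ofReal (|h| ^ (σ - 1)) = ENNReal.ofReal (δ ^ σ / σ) := by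
    rw [← hpos, ← (Measure.measurePreserving_neg (volume : Measure ℝ)).setLIntegral_comp_preimage
      measurableSet_Ioo (by fun_prop)]
    simp
  have hae : (Ioo (-δ) δ : Set ℝ) =ᵐ[volume] (Ioo (-δ) 0 ∪ Ioo 0 δ : Set ℝ) := by
    filter_upwards [compl_mem_ae_iff.2 (measure_singleton (μ := (volume : Measure ℝ)) 0)] with h hh
    have hh : h ≠ 0 := hh
    apply propext
    change h ∈ Ioo (-δ) δ ↔ h ∈ Ioo (-δ) 0 ∪ Ioo 0 δ
    simp only [mem_union, mem_Ioo]
    rcases lt_or_gt_of_ne hh with h' | h'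
    · constructor
      · exact fun H => Or.inl ⟨H.1, h'⟩
      · rintro (H | H)
        · exact ⟨H.1, by linarith⟩
        · exact ⟨by linarith [H.1], H.2⟩
    · constructor
      · exact fun H => Or.inr ⟨h', H.2⟩
      · rintro (H | H)
        · exact ⟨H.1, by linarith [H.2]⟩
        · exact ⟨by linarith [H.1], H.2⟩
  rw [setLIntegral_congr hae, lintegral_union measurableSet_Ioo, hpos, hneg, ← two_mul,
    ENNReal.ofReal_mul zero_le_two]
  · simp
  · rw [Set.disjoint_left]
    intro x hx hx'
    exact lt_asymm hx.2 hx'.1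

/-- The mass `2 δ^σ` tends to `2` for every fixed `δ`, so the measures converge to twice the Dirac
mass at the origin. -/
theorem mul_lintegral_abs_rpow_sub_one {σ δ : ℝ} (hσ : 0 < σ) (hδ : 0 < δ) :
    ENNReal.ofReal σ * ∫⁻ h in Ioo (-δ) δ, ENNReal.ofReal (|h| ^ (σ - 1)) =
      2 * ENNReal.ofReal (δ ^ σ) := by
  rw [lintegral_abs_rpow_sub_one hσ hδ, ← ENNReal.ofReal_mul hσ.le,
    show σ * (2 * (δ ^ σ / σ)) = 2 * δ ^ σ by field_simp, ENNReal.ofReal_mul zero_le_two]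
  simp

theorem tendsto_ofReal_rpow_zero {σ : ℕ → ℝ} (hσ : Tendsto σ atTop (𝓝 0)) {δ : ℝ} (hδ : 0 < δ) :
    Tendsto (fun j => ENNReal.ofReal (δ ^ σ j)) atTop (𝓝 1) := by
  have h1 : Tendsto (fun j => δ ^ σ j) atTop (𝓝 (δ ^ (0 : ℝ))) :=
    (Real.continuousAt_const_rpow hδ.ne').tendsto.comp hσ
  rw [Real.rpow_zero] at h1
  simpa using ENNReal.tendsto_ofReal h1

theorem exists_radius_of_eventually {P : ℕ → ℝ → Prop}
    (h : ∀ᶠ z : ℕ × ℝ in atTop ×ˢ 𝓝[≠] (0 : ℝ), P z.1 z.2) :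
    ∃ δ, 0 < δ ∧ δ < 1 ∧ ∀ᶠ j in atTop, ∀ h ∈ Ioo (-δ) δ, h ≠ 0 → P j h := by
  obtain ⟨Q, hQ, R, hR, hQR⟩ := eventually_prod_iff.1 h
  rw [eventually_nhdsWithin_iff] at hR
  obtain ⟨δ, hδ, hδR⟩ := Metric.eventually_nhds_iff.1 hR
  refine ⟨min δ (1 / 2), by positivity, by
    exact (min_le_right _ _).trans_lt (by norm_num), hQ.mono fun j hj h hh h0 => ?_⟩
  refine hQR hj (hδR ?_ h0)
  rw [dist_zero_right, Real.norm_eq_abs, abs_lt]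
  have := min_le_left δ (1 / 2)
  exact ⟨by linarith [hh.1], by linarith [hh.2]⟩

/-- Only a neighbourhood of `h = 0` is kept, where the integrand is at least `c`. The joint filter
in `(j, h)` matters: the radius must not depend on `j`. -/
theorem le_liminf_concentration {σ : ℕ → ℝ} (hσ0 : ∀ j, 0 < σ j) (hσ : Tendsto σ atTop (𝓝 0))
    {Φ : ℕ → ℝ → ℝ≥0∞} {m : ℝ≥0∞}
    (h : ∀ c < m, ∀ᶠ z : ℕ × ℝ in atTop ×ˢ 𝓝[≠] (0 : ℝ), c ≤ Φ z.1 z.2) :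
    2 * m ≤ liminf (fun j => ENNReal.ofReal (σ j) *
      ∫⁻ h, ENNReal.ofReal (|h| ^ (σ j - 1)) * Φ j h) atTop := by
  have key : ∀ c < m, 2 * c ≤ liminf (fun j => ENNReal.ofReal (σ j) *
      ∫⁻ h, ENNReal.ofReal (|h| ^ (σ j - 1)) * Φ j h) atTop := by
    intro c hc
    obtain ⟨δ, hδ, -, hev⟩ := exists_radius_of_eventually (P := fun j h => c ≤ Φ j h) (h c hc)
    have hlim : Tendsto (fun j => 2 * ENNReal.ofReal (δ ^ σ j) * c) atTop (𝓝 (2 * c)) := by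
      have h1 := ENNReal.Tendsto.const_mul (a := 2) (tendsto_ofReal_rpow_zero hσ hδ)
        (Or.inr (by simp))
      rw [mul_one] at h1
      exact ENNReal.Tendsto.mul_const h1 (Or.inr hc.ne_top)
    rw [← hlim.liminf_eq]
    refine liminf_le_liminf ?_
    filter_upwards [hev] with j hj
    rw [← mul_lintegral_abs_rpow_sub_one (hσ0 j) hδ, mul_assoc,
      ← lintegral_mul_const _ (by fun_prop)]
    refine mul_le_mul_right ?_ _
    refine le_trans (lintegral_mono_ae ?_) (setLIntegral_le_lintegral (Ioo (-δ) δ) _)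
    filter_upwards [ae_restrict_mem measurableSet_Ioo, ae_restrict_of_ae
      (compl_mem_ae_iff.2 (measure_singleton (μ := (volume : Measure ℝ)) 0))] with h hh h0
    gcongr
    exact hj h hh h0
  refine le_of_forall_lt fun b hb => ?_
  obtain ⟨b', hb', hb'm⟩ := exists_between hb
  have h2 : b' / 2 < m := by
    rw [ENNReal.div_lt_iff (by simp) (by simp), mul_comm]
    exact hb'm
  have := key _ h2
  rw [ENNReal.mul_div_cancel (by simp) (by simp)] at this
  exact hb'.trans_le this

/-- Splits the kernel into a concentrating weight with `σ = p (1 - s)` and the factor that turns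
increments into difference quotients. -/
theorem vertWeight_eq_mul {p s h : ℝ} (hp : 0 < p) (hh : h ≠ 0) :
    vertWeight p s h = ENNReal.ofReal (|h| ^ (p * (1 - s) - 1)) * ‖h⁻¹‖ₑ ^ p := by
  have hh' : 0 < |h| := abs_pos.2 hh
  rw [vertWeight, enorm_rpow_eq_ofReal _ hp.le, ← ENNReal.ofReal_mul (by positivity)]
  congr 1
  rw [abs_inv, Real.inv_rpow hh'.le, one_div, ← Real.rpow_neg hh'.le, ← Real.rpow_neg hh'.le,
    ← Real.rpow_add hh']
  congr 1; ring

theorem mul_slopeEnergy_eq {n : ℕ} {p s ε : ℝ} (hp : 0 < p) (A : Set (Pt n))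
    (v : Pt n → ℝ) (ξ : EuclideanSpace ℝ (Fin n)) :
    ENNReal.ofReal (1 - s) * slopeEnergy p s ε A v ξ = ENNReal.ofReal (1 / p) *
      (ENNReal.ofReal (p * (1 - s)) * ∫⁻ h : ℝ, ENNReal.ofReal (|h| ^ (p * (1 - s) - 1)) *
        (‖h⁻¹‖ₑ ^ p * incr p A v ((ε * |h|) • ξ, h))) := by
  rw [← mul_assoc, ← ENNReal.ofReal_mul (by positivity),
    show 1 / p * (p * (1 - s)) = 1 - s by field_simp]
  congr 1
  refine lintegral_congr_ae ?_
  filter_upwards [compl_mem_ae_iff.2 (measure_singleton (μ := (volume : Measure ℝ)) 0)] with h hh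
  rw [vertWeight_eq_mul hp hh, mul_assoc]

end Concentration

/-! ### The lower bound. -/

section Liminf

variable {n : ℕ} {p : ℝ} {ω : Set (EuclideanSpace ℝ (Fin n))} {vs : ℕ → Pt n → ℝ} {v : Pt n → ℝ}
  {ε s : ℕ → ℝ} {s₀ : ℝ}

theorem tendsto_slope {ι : Type*} {l : Filter ι} {ε h : ι → ℝ}
    (hε : Tendsto ε l (𝓝 0)) {h₀ : ℝ} (hh : Tendsto h l (𝓝 h₀))
    (ξ : EuclideanSpace ℝ (Fin n)) :
    Tendsto (fun i => (((ε i * |h i|) • ξ, h i) : Pt n)) l (𝓝 (0, h₀)) := by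
  refine Tendsto.prodMk_nhds ?_ hh
  have := (hε.mul hh.abs).smul_const ξ
  simpa using this

/-- After division by `h` the horizontal component still has norm `ε ‖ξ‖`, whatever the size of `h`;
hence only vertical difference quotients survive. -/
theorem tendsto_inv_smul_slope {ι : Type*} {l : Filter ι} {ε h : ι → ℝ}
    (hε : Tendsto ε l (𝓝 0)) (hh : ∀ᶠ i in l, h i ≠ 0) (ξ : EuclideanSpace ℝ (Fin n)) :
    Tendsto (fun i => (h i)⁻¹ • (((ε i * |h i|) • ξ, h i) : Pt n)) l (𝓝 (0, 1)) := by
  have h1 : Tendsto (fun i => ((h i)⁻¹ * (ε i * |h i|)) • ξ) l (𝓝 0) := by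
    rw [tendsto_zero_iff_norm_tendsto_zero]
    have h2 := (hε.norm).mul_const ‖ξ‖
    rw [norm_zero, zero_mul] at h2
    refine h2.congr' ?_
    filter_upwards [hh] with i hi
    rw [norm_smul, norm_mul, norm_mul, norm_inv, Real.norm_eq_abs |h i|, abs_abs,
      Real.norm_eq_abs (h i)]
    have := abs_pos.2 hi
    field_simp
  refine (Tendsto.prodMk_nhds h1 tendsto_const_nhds).congr' ?_
  filter_upwards [hh] with i hi
  simp [smul_smul, inv_mul_cancel₀ hi]

theorem tendsto_vertWeight {ι : Type*} {l : Filter ι} {s : ι → ℝ} (hs : Tendsto s l (𝓝 s₀)) {h : ℝ}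
    (hh : h ≠ 0) : Tendsto (fun j => vertWeight p (s j) h) l (𝓝 (vertWeight p s₀ h)) := by
  have hh' : 0 < |h| := abs_pos.2 hh
  refine ENNReal.tendsto_ofReal ?_
  have h1 : Tendsto (fun j => |h| ^ (1 + s j * p)) l (𝓝 (|h| ^ (1 + s₀ * p))) :=
    (Real.continuousAt_const_rpow hh'.ne').tendsto.comp ((hs.mul_const p).const_add 1)
  exact tendsto_const_nhds.div h1 (Real.rpow_pos_of_pos hh' _).ne'

theorem tendsto_horizWeight {ι : Type*} {l : Filter ι} {s : ι → ℝ} (hs : Tendsto s l (𝓝 s₀))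
    (ξ : EuclideanSpace ℝ (Fin n)) :
    Tendsto (fun j => horizWeight n p (s j) ξ) l (𝓝 (horizWeight n p s₀ ξ)) := by
  have hh' : 0 < 1 + ‖ξ‖ ^ 2 := by positivity
  refine ENNReal.tendsto_ofReal ?_
  have h1 : Tendsto (fun j => (1 + ‖ξ‖ ^ 2) ^ ((((n : ℝ) + 1) + s j * p) / 2)) l
      (𝓝 ((1 + ‖ξ‖ ^ 2) ^ ((((n : ℝ) + 1) + s₀ * p) / 2))) :=
    (Real.continuousAt_const_rpow hh'.ne').tendsto.comp
      (((hs.mul_const p).const_add _).div_const 2)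
  exact tendsto_const_nhds.div h1 (Real.rpow_pos_of_pos hh' _).ne'

/-- Fatou's lemma in `h`, with lower semicontinuity of the increment for each fixed `h ≠ 0`. -/
theorem verticalGagliardo_le_liminf_slopeEnergy (hp : 1 < p) (hω : MeasurableSet ω)
    (hΩ : IsOpen (film ω 1)) (hΩf : volume (film ω 1) < ∞) (hv : WeakConvLpLoc p (film ω 1) vs v)
    (hε : Tendsto ε atTop (𝓝 0)) (hs : Tendsto s atTop (𝓝 s₀)) (ξ : EuclideanSpace ℝ (Fin n)) :
    verticalGagliardo p s₀ ω v ≤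
      liminf (fun j => slopeEnergy p (s j) (ε j) (film ω 1) (vs j) ξ) atTop := by
  have hm : ∀ j, Measurable (incr p (film ω 1) (vs j)) := fun j =>
    measurable_incr_of_ae p hΩ.measurableSet ((hv.1 j).aestronglyMeasurable hp hΩ)
  rw [verticalGagliardo_eq_of_ae (by linarith) hω (hv.2.1.aestronglyMeasurable hp hΩ)]
  refine le_trans (lintegral_mono_ae ?_) (lintegral_liminf_le fun j => ?_)
  · filter_upwards [compl_mem_ae_iff.2 (measure_singleton (μ := (volume : Measure ℝ)) 0)] with h hh
    refine le_trans ?_ ENNReal.le_liminf_mul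
    rw [(tendsto_vertWeight hs hh).liminf_eq]
    gcongr
    exact incr_le_liminf hp hΩ hΩf hv (tendsto_slope hε tendsto_const_nhds ξ)
  · have := measurable_vertWeight p (s j)
    have := hm j
    fun_prop

theorem verticalDirichlet_le_liminf_slopeEnergy (hp : 1 < p)
    (hΩ : IsOpen (film ω 1)) (hΩf : volume (film ω 1) < ∞) (hv : WeakConvLpLoc p (film ω 1) vs v)
    (hε : Tendsto ε atTop (𝓝 0)) (hs1 : ∀ j, s j < 1) (hs : Tendsto s atTop (𝓝 1))
    (ξ : EuclideanSpace ℝ (Fin n)) :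
    ENNReal.ofReal (2 / p) * verticalDirichlet p ω v ≤
      liminf (fun j => ENNReal.ofReal (1 - s j) *
        slopeEnergy p (s j) (ε j) (film ω 1) (vs j) ξ) atTop := by
  have hp0 : 0 < p := by linarith
  have h1 := le_liminf_concentration (σ := fun j => p * (1 - s j))
    (fun j => mul_pos hp0 (by linarith [hs1 j]))
    (by simpa using (hs.const_sub 1).const_mul p)
    (Φ := fun j h => ‖h⁻¹‖ₑ ^ p * incr p (film ω 1) (vs j) ((ε j * |h|) • ξ, h))
    (m := verticalDirichlet p ω v) (by
      intro c hc
      -- If the bound failed arbitrarily close to `(∞, 0)`, there would be indices tending to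
      -- infinity and increments tending to `0` along which it fails, against the lower
      -- semicontinuity of difference quotients.
      by_contra hcon
      rw [not_eventually] at hcon
      obtain ⟨z, hz, hzc⟩ := exists_seq_forall_of_frequently hcon
      have hz1 : Tendsto (fun i => (z i).1) atTop atTop := tendsto_fst.comp hz
      have hz2 : Tendsto (fun i => (z i).2) atTop (𝓝[≠] 0) := tendsto_snd.comp hz
      have hz3 : Tendsto (fun i => (z i).2) atTop (𝓝 0) := hz2.mono_right nhdsWithin_le_nhds
      have hz4 : ∀ᶠ i in atTop, (z i).2 ≠ 0 := hz2.eventually self_mem_nhdsWithin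
      have hle := verticalDirichlet_le_liminf hp hΩ hΩf (hv.comp hz1)
        (tendsto_slope (hε.comp hz1) hz3 ξ) (tendsto_inv_smul_slope (hε.comp hz1) hz4 ξ)
      refine absurd (hle.trans ?_) hc.not_ge
      refine (liminf_le_limsup).trans (limsup_le_of_le (by isBoundedDefault) ?_)
      exact Eventually.of_forall fun i => (not_le.1 (hzc i)).le)
  have h2 : ENNReal.ofReal (2 / p) = ENNReal.ofReal (1 / p) * 2 := by
    rw [show 2 / p = 1 / p * 2 by ring, ENNReal.ofReal_mul (by positivity)]
    simp
  rw [h2, mul_assoc]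
  refine (mul_le_mul_right h1 _).trans ?_
  simp_rw [mul_slopeEnergy_eq hp0]
  have h3 := ENNReal.le_liminf_mul (f := atTop) (u := fun _ : ℕ => ENNReal.ofReal (1 / p))
    (v := fun j => ENNReal.ofReal (p * (1 - s j)) *
      ∫⁻ h : ℝ, ENNReal.ofReal (|h| ^ (p * (1 - s j) - 1)) *
        (‖h⁻¹‖ₑ ^ p * incr p (film ω 1) (vs j) ((ε j * |h|) • ξ, h)))
  rw [liminf_const] at h3
  exact h3

/-- Fatou's lemma in `ξ`. The factor `c j` is `1` when `s₀ < 1` and `1 - s` when `s₀ = 1`; the lower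
bound for each slope does not depend on the slope, so the weight integrates to the constant. -/
theorem filmConst_mul_le_liminf (hp : 1 < p) (hω : MeasurableSet ω) (hΩ : IsOpen (film ω 1))
    {u : ℕ → Pt n → ℝ} (hv : WeakConvLpLoc p (film ω 1) (fun j => rescale (ε j) (u j)) v)
    (hε : ∀ j, 0 < ε j) (hs : Tendsto s atTop (𝓝 s₀)) (c : ℕ → ℝ≥0∞) (hc : ∀ j, c j ≠ ∞)
    {L : ℝ≥0∞}
    (hL : ∀ ξ, L ≤ liminf (fun j => c j *
      slopeEnergy p (s j) (ε j) (film ω 1) (rescale (ε j) (u j)) ξ) atTop) :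
    filmConst n s₀ p * L ≤ liminf (fun j => c j * energy p ω (s j) (ε j) (u j)) atTop := by
  have hm : ∀ j, Measurable (slopeEnergy p (s j) (ε j) (film ω 1) (rescale (ε j) (u j))) :=
    fun j => measurable_slopeEnergy hΩ.measurableSet ((hv.1 j).aestronglyMeasurable hp hΩ)
  have hh : ∀ j, Measurable (horizWeight n p (s j)) := fun j => measurable_horizWeight p (s j)
  calc filmConst n s₀ p * L = ∫⁻ ξ, horizWeight n p s₀ ξ * L := by
        rw [lintegral_mul_const _ (measurable_horizWeight p s₀)]
        rfl
    _ ≤ ∫⁻ ξ, liminf (fun j => horizWeight n p (s j) ξ * (c j *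
          slopeEnergy p (s j) (ε j) (film ω 1) (rescale (ε j) (u j)) ξ)) atTop := by
        refine lintegral_mono fun ξ => le_trans ?_ ENNReal.le_liminf_mul
        rw [(tendsto_horizWeight hs ξ).liminf_eq]
        gcongr
        exact hL ξ
    _ ≤ liminf (fun j => ∫⁻ ξ, horizWeight n p (s j) ξ * (c j *
          slopeEnergy p (s j) (ε j) (film ω 1) (rescale (ε j) (u j)) ξ)) atTop :=
        lintegral_liminf_le fun j => (hh j).mul ((hm j).const_mul _)
    _ ≤ _ := by
        refine liminf_le_liminf (Eventually.of_forall fun j => ?_)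
        simp_rw [mul_left_comm _ (c j)]
        rw [lintegral_const_mul' _ _ (hc j)]
        gcongr
        exact le_energy (by linarith) (hε j) hω (u j)

end Liminf

end ThinFilm

open scoped NNReal

namespace ThinFilm

/-! ### Dominating functions for bounded Lipschitz functions. -/

section Domination

variable {n : ℕ} {p : ℝ} {ω : Set (EuclideanSpace ℝ (Fin n))} {w : Pt n → ℝ} {M : ℝ} {L : ℝ≥0}

/-- The Lipschitz bound is used for `r ≤ 1` and the sup bound for `r ≥ 1`. The exponent `θ` is free
because integrability at `h = 0` requires `θ > s`, while integrability at `ξ = ∞` requires `(θ - s)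
p < 1`. -/
theorem abs_increment_le (hM : ∀ x, |w x| ≤ M) (hL : LipschitzWith L w) {θ r : ℝ} (hθ : 0 ≤ θ)
    (hθ1 : θ ≤ 1) (hr : 0 ≤ r) {k : Pt n} (hk : ‖k‖ ≤ r) (x : Pt n) :
    |w (x + k) - w x| ≤ (L + 2 * M) * r ^ θ := by
  have hM0 : 0 ≤ M := (abs_nonneg _).trans (hM 0)
  rcases le_total r 1 with h1 | h1
  · rcases hr.eq_or_lt with rfl | hr0
    · have : k = 0 := by simpa using hk
      subst this
      simp only [add_zero, sub_self, abs_zero]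
      positivity
    have h2 : |w (x + k) - w x| ≤ L * ‖k‖ := by
      have := hL.dist_le_mul (x + k) x
      rwa [Real.dist_eq, dist_self_add_left] at this
    have h3 : r ≤ r ^ θ := by
      nth_rewrite 1 [← Real.rpow_one r]
      exact Real.rpow_le_rpow_of_exponent_ge hr0 h1 hθ1
    calc |w (x + k) - w x| ≤ L * r ^ θ := h2.trans (by gcongr; exact hk.trans h3)
      _ ≤ _ := by
        gcongr
        linarith
  · have h2 : |w (x + k) - w x| ≤ 2 * M := by
      have := abs_sub (w (x + k)) (w x)
      linarith [hM (x + k), hM x]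
    have h3 : 1 ≤ r ^ θ := Real.one_le_rpow h1 hθ
    calc |w (x + k) - w x| ≤ (L + 2 * M) * 1 := by
          have := L.2
          rw [mul_one]
          linarith [show (0 : ℝ) ≤ L from L.2]
      _ ≤ _ := by gcongr

theorem incr_le_of_abs_le {V : Type*} [NormedAddCommGroup V] [MeasureSpace V] {A : Set V}
    {w : V → ℝ} (hp : 0 ≤ p) {k : V} {b : ℝ} (hb : ∀ x, |w (x + k) - w x| ≤ b) :
    incr p A w k ≤ ENNReal.ofReal (b ^ p) * volume A := by
  have hb0 : 0 ≤ b := (abs_nonneg _).trans (hb 0)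
  calc incr p A w k ≤ ∫⁻ _ in shiftSet A k, ENNReal.ofReal (b ^ p) := by
        refine lintegral_mono fun x => ?_
        rw [enorm_rpow_eq_ofReal _ hp]
        exact ENNReal.ofReal_le_ofReal (Real.rpow_le_rpow (abs_nonneg _) (hb x) hp)
    _ = ENNReal.ofReal (b ^ p) * volume (shiftSet A k) := by rw [setLIntegral_const]
    _ ≤ _ := by
        gcongr
        exact shiftSet_subset _ _

theorem shiftSet_film_eq_empty {k : Pt n} (hk : 1 ≤ |k.2|) : shiftSet (film ω 1) k = ∅ := by
  ext x
  simp only [shiftSet, film, mem_ofPred_eq, mem_prod, mem_Ioo, Prod.snd_add, mem_empty_iff_false,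
    iff_false]
  rintro ⟨⟨-, h1⟩, -, h2⟩
  rcases le_abs.1 hk with h | h <;> linarith [h1.1, h1.2, h2.1, h2.2]

theorem incr_film_eq_zero (w : Pt n → ℝ) {k : Pt n} (hk : 1 ≤ |k.2|) :
    incr p (film ω 1) w k = 0 := by
  rw [incr, shiftSet_film_eq_empty hk]
  simp

theorem norm_slope_le {ε : ℝ} (hε : 0 < ε) (hε1 : ε ≤ 1) (ξ : EuclideanSpace ℝ (Fin n)) (h : ℝ) :
    ‖(((ε * |h|) • ξ, h) : Pt n)‖ ≤ |h| * (1 + ‖ξ‖) := by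
  rw [Prod.norm_def, norm_smul, Real.norm_eq_abs, Real.norm_eq_abs, abs_mul, abs_abs,
    abs_of_pos hε]
  have h1 : 0 ≤ |h| := abs_nonneg h
  have h2 : 0 ≤ ‖ξ‖ := norm_nonneg ξ
  refine max_le ?_ ?_
  · calc ε * |h| * ‖ξ‖ ≤ 1 * |h| * ‖ξ‖ := by gcongr
      _ ≤ _ := by nlinarith
  · nlinarith

/-- The film has height one, so increments with `|h| ≥ 1` vanish and the bound may be cut off there;
inside, the Hölder bound lowers the singularity to `|h|^((θ - s) p - 1)`. -/
theorem vertWeight_mul_incr_le (hp : 1 < p) (hM : ∀ x, |w x| ≤ M) (hL : LipschitzWith L w)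
    {s θ ε : ℝ} (hθ : 0 ≤ θ) (hθ1 : θ ≤ 1) (hε : 0 < ε) (hε1 : ε ≤ 1)
    (ξ : EuclideanSpace ℝ (Fin n)) {h : ℝ} (hh : h ≠ 0) :
    vertWeight p s h * incr p (film ω 1) w ((ε * |h|) • ξ, h) ≤
      ENNReal.ofReal (((L + 2 * M) * (1 + ‖ξ‖) ^ θ) ^ p) * volume (film ω 1) *
        (Ioo (-1 : ℝ) 1).indicator (fun h => ENNReal.ofReal (|h| ^ ((θ - s) * p - 1))) h := by
  by_cases h1 : h ∈ Ioo (-1 : ℝ) 1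
  · have hh' : 0 < |h| := abs_pos.2 hh
    have hM0 : 0 ≤ M := (abs_nonneg _).trans (hM 0)
    rw [indicator_of_mem h1]
    have h2 := incr_le_of_abs_le (A := film ω 1) (p := p) (by linarith) fun x =>
      abs_increment_le hM hL hθ hθ1 (r := |h| * (1 + ‖ξ‖)) (by positivity)
        (norm_slope_le hε hε1 ξ h) x
    refine (mul_le_mul_right h2 _).trans (le_of_eq ?_)
    rw [vertWeight, ← mul_assoc, ← ENNReal.ofReal_mul (by positivity),
      mul_right_comm _ (volume _) _, ← ENNReal.ofReal_mul (by positivity)]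
    congr 2
    rw [Real.mul_rpow hh'.le (by positivity), Real.mul_rpow (by positivity) (by positivity),
      Real.mul_rpow (by positivity) (by positivity), Real.mul_rpow (by positivity) (by positivity),
      ← Real.rpow_mul hh'.le,
      one_div, ← Real.rpow_neg hh'.le, show (θ - s) * p - 1 = -(1 + s * p) + θ * p by ring,
      Real.rpow_add hh']
    ring
  · rw [incr_film_eq_zero, mul_zero]
    · exact zero_le
    · by_contra hcon
      exact h1 (abs_lt.1 (not_le.1 hcon))

theorem slopeEnergy_le (hp : 1 < p) (hM : ∀ x, |w x| ≤ M) (hL : LipschitzWith L w)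
    {s θ ε : ℝ} (hθ : 0 ≤ θ) (hsθ : s < θ) (hθ1 : θ ≤ 1) (hε : 0 < ε) (hε1 : ε ≤ 1)
    (ξ : EuclideanSpace ℝ (Fin n)) :
    slopeEnergy p s ε (film ω 1) w ξ ≤
      ENNReal.ofReal (((L + 2 * M) * (1 + ‖ξ‖) ^ θ) ^ p) * volume (film ω 1) *
        ENNReal.ofReal (2 / ((θ - s) * p)) := by
  have hpos : 0 < (θ - s) * p := mul_pos (by linarith) (by linarith)
  calc slopeEnergy p s ε (film ω 1) w ξ ≤
      ∫⁻ h : ℝ, ENNReal.ofReal (((L + 2 * M) * (1 + ‖ξ‖) ^ θ) ^ p) * volume (film ω 1) *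
        (Ioo (-1 : ℝ) 1).indicator (fun h => ENNReal.ofReal (|h| ^ ((θ - s) * p - 1))) h := by
        refine lintegral_mono_ae ?_
        filter_upwards [compl_mem_ae_iff.2 (measure_singleton (μ := (volume : Measure ℝ)) 0)]
          with h hh
        exact vertWeight_mul_incr_le hp hM hL hθ hθ1 hε hε1 ξ hh
    _ = _ := by
        rw [lintegral_const_mul _ (Measurable.indicator (by fun_prop) measurableSet_Ioo),
          lintegral_indicator measurableSet_Ioo, lintegral_abs_rpow_sub_one hpos one_pos,
          Real.one_rpow]
        congr 2
        ring

/-- Uses `(1 + t)² ≤ 2 (1 + t²)`. With `(θ - s) p ≤ 1/2` the total decay is at least of order `n +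
1/2`, integrable over `ℝⁿ`, with constants independent of `s`. -/
theorem one_add_norm_rpow_div_le {s θ t : ℝ} (hp : 0 < p) (hs : 0 ≤ s) (hs1 : s ≤ 1)
    (hsθ : (θ - s) * p ≤ 1 / 2) (ht : 0 ≤ t) :
    1 / (1 + t ^ 2) ^ ((((n : ℝ) + 1) + s * p) / 2) * (1 + t) ^ (θ * p) ≤
      2 ^ ((((n : ℝ) + 1) + p) / 2) * (1 + t) ^ (-((n : ℝ) + 1 / 2)) := by
  have h1t : 1 ≤ 1 + t := by linarith
  have h0t : 0 < 1 + t := by linarith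
  set a := (((n : ℝ) + 1) + s * p) with ha
  have ha0 : 0 ≤ a := by positivity
  have h2 : (1 + t) ^ a ≤ 2 ^ (a / 2) * (1 + t ^ 2) ^ (a / 2) := by
    rw [← Real.mul_rpow (by positivity) (by positivity)]
    calc (1 + t) ^ a = ((1 + t) ^ (2 : ℝ)) ^ (a / 2) := by
          rw [← Real.rpow_mul h0t.le]; congr 1; ring
      _ ≤ _ := by
          refine Real.rpow_le_rpow (by positivity) ?_ (by positivity)
          rw [Real.rpow_two]
          nlinarith [sq_nonneg (1 - t)]
  have h3 : (2 : ℝ) ^ (a / 2) ≤ 2 ^ ((((n : ℝ) + 1) + p) / 2) := by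
    refine Real.rpow_le_rpow_of_exponent_le (by norm_num) ?_
    have : s * p ≤ p := by nlinarith
    linarith
  have hX : 0 < (1 + t ^ 2) ^ (a / 2) := Real.rpow_pos_of_pos (by positivity) _
  have h4 : (1 + t) ^ (θ * p) ≤ (1 + t) ^ a * (1 + t) ^ (-((n : ℝ) + 1 / 2)) := by
    rw [← Real.rpow_add h0t]
    refine Real.rpow_le_rpow_of_exponent_le h1t ?_
    rw [ha]; linarith
  have hY : 0 < (1 + t) ^ (-((n : ℝ) + 1 / 2)) := Real.rpow_pos_of_pos h0t _
  rw [one_div_mul_eq_div, div_le_iff₀ hX]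
  calc (1 + t) ^ (θ * p) ≤ (2 ^ (a / 2) * (1 + t ^ 2) ^ (a / 2)) * (1 + t) ^ (-((n : ℝ) + 1 / 2)) :=
        h4.trans (by gcongr)
    _ ≤ (2 ^ ((((n : ℝ) + 1) + p) / 2) * (1 + t ^ 2) ^ (a / 2)) * (1 + t) ^ (-((n : ℝ) + 1 / 2)) := by
        gcongr
    _ = _ := by ring

theorem horizWeight_mul_slopeEnergy_le (hp : 1 < p) (hM : ∀ x, |w x| ≤ M) (hL : LipschitzWith L w)
    {s θ ε : ℝ} (hs : 0 ≤ s) (hsθ : s < θ) (hθ1 : θ ≤ 1) (hsθ2 : (θ - s) * p ≤ 1 / 2)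
    (hε : 0 < ε) (hε1 : ε ≤ 1) (ξ : EuclideanSpace ℝ (Fin n)) :
    horizWeight n p s ξ * slopeEnergy p s ε (film ω 1) w ξ ≤
      ENNReal.ofReal ((L + 2 * M) ^ p * 2 ^ ((((n : ℝ) + 1) + p) / 2)) * volume (film ω 1) *
        ENNReal.ofReal (2 / ((θ - s) * p)) *
        ENNReal.ofReal ((1 + ‖ξ‖) ^ (-((n : ℝ) + 1 / 2))) := by
  have hM0 : 0 ≤ M := (abs_nonneg _).trans (hM 0)
  have hθ : 0 ≤ θ := by linarith
  refine (mul_le_mul_right (slopeEnergy_le hp hM hL hθ hsθ hθ1 hε hε1 ξ) _).trans ?_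
  suffices h : horizWeight n p s ξ * ENNReal.ofReal (((L + 2 * M) * (1 + ‖ξ‖) ^ θ) ^ p) ≤
      ENNReal.ofReal ((L + 2 * M) ^ p * 2 ^ ((((n : ℝ) + 1) + p) / 2)) *
        ENNReal.ofReal ((1 + ‖ξ‖) ^ (-((n : ℝ) + 1 / 2))) by
    rw [← mul_assoc, ← mul_assoc, mul_right_comm _ _ (ENNReal.ofReal ((1 + ‖ξ‖) ^ _)),
      mul_right_comm _ (volume _) (ENNReal.ofReal ((1 + ‖ξ‖) ^ _))]
    gcongr
  rw [horizWeight, ← ENNReal.ofReal_mul (by positivity), ← ENNReal.ofReal_mul (by positivity)]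
  refine ENNReal.ofReal_le_ofReal ?_
  rw [Real.mul_rpow (by positivity) (by positivity), ← Real.rpow_mul (by positivity)]
  have := one_add_norm_rpow_div_le (n := n) (p := p) (by linarith) hs (by linarith) hsθ2
    (norm_nonneg ξ)
  calc _ = (L + 2 * M) ^ p * (1 / (1 + ‖ξ‖ ^ 2) ^ ((((n : ℝ) + 1) + s * p) / 2) *
        (1 + ‖ξ‖) ^ (θ * p)) := by ring
    _ ≤ _ := by
        rw [mul_assoc]
        gcongr

theorem lintegral_one_add_norm_lt_top (n : ℕ) :
    ∫⁻ ξ : EuclideanSpace ℝ (Fin n), ENNReal.ofReal ((1 + ‖ξ‖) ^ (-((n : ℝ) + 1 / 2))) < ∞ :=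
  finite_integral_one_add_norm (by simp)

end Domination

/-! ### The upper bound for bounded Lipschitz functions. -/

section UpperBound

variable {n : ℕ} {p : ℝ} {ω : Set (EuclideanSpace ℝ (Fin n))} {w : Pt n → ℝ} {M : ℝ} {L : ℝ≥0}

/-- The function on the film of thickness `ε` whose scaled function is `w`. -/
noncomputable def unscale (ε : ℝ) (w : Pt n → ℝ) : Pt n → ℝ := fun x => w (x.1, x.2 / ε)

theorem rescale_unscale {ε : ℝ} (hε : ε ≠ 0) (w : Pt n → ℝ) : rescale ε (unscale ε w) = w := by
  ext x
  simp [rescale, unscale, mul_div_cancel_left₀ _ hε]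

theorem volume_film_lt_top (hωb : Bornology.IsBounded ω) (ε : ℝ) : volume (film ω ε) < ∞ :=
  (hωb.prod (Metric.isBounded_Ioo 0 ε)).measure_lt_top

/-- The domination makes the right-hand side finite, which places the function in the fractional
Sobolev space, so that the energy is not the default value `∞`. -/
theorem energy_unscale_eq (hp : 1 < p) (hω : MeasurableSet ω) (hωb : Bornology.IsBounded ω)
    (hM : ∀ x, |w x| ≤ M) (hL : LipschitzWith L w) {s ε : ℝ} (hs : s ∈ Ioo (0 : ℝ) 1) (hε : 0 < ε)
    (hε1 : ε ≤ 1) :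
    energy p ω s ε (unscale ε w) =
      ∫⁻ ξ, horizWeight n p s ξ * slopeEnergy p s ε (film ω 1) w ξ := by
  have hc : Continuous (unscale ε w) := by
    have := hL.continuous
    unfold unscale
    fun_prop
  have hfin : IsFiniteMeasure (volume.restrict (film ω ε)) :=
    ⟨by simpa using volume_film_lt_top hωb ε⟩
  have heq := gagliardo_eq_of_ae (s := s) (show 0 ≤ p by linarith) hε hω
    (u := unscale ε w) hc.aestronglyMeasurable
  rw [rescale_unscale hε.ne'] at heq
  -- The two terms of the minimum ensure `θ ≤ 1` and `(θ - s) p ≤ 1/2`.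
  set θ := s + min (1 - s) (1 / (2 * p)) with hθ
  have hp0 : 0 < p := by linarith
  have hmin : 0 < min (1 - s) (1 / (2 * p)) := lt_min (by linarith [hs.2]) (by positivity)
  have hlt : ∫⁻ ξ, horizWeight n p s ξ * slopeEnergy p s ε (film ω 1) w ξ < ∞ := by
    refine (lintegral_mono fun ξ => horizWeight_mul_slopeEnergy_le hp hM hL hs.1.le (θ := θ)
      (by linarith) (by linarith [min_le_left (1 - s) (1 / (2 * p))]) ?_ hε hε1 ξ).trans_lt ?_
    · rw [hθ, add_sub_cancel_left]
      calc min (1 - s) (1 / (2 * p)) * p ≤ 1 / (2 * p) * p := by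
            gcongr
            exact min_le_right _ _
        _ = 1 / 2 := by field_simp
    · rw [lintegral_const_mul _ (by fun_prop)]
      refine ENNReal.mul_lt_top (ENNReal.mul_lt_top (ENNReal.mul_lt_top ENNReal.ofReal_lt_top
        (volume_film_lt_top hωb 1)) ENNReal.ofReal_lt_top) (lintegral_one_add_norm_lt_top n)
  have hmem : MemFracSobolev p s (film ω ε) (unscale ε w) := by
    refine ⟨MemLp.of_bound hc.aestronglyMeasurable M (Eventually.of_forall fun x => hM _), ?_⟩
    rw [← heq] at hlt
    refine ENNReal.lt_top_of_mul_ne_top_right hlt.ne ?_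
    have : 0 < ε ^ (1 - s * p) := Real.rpow_pos_of_pos hε _
    simpa using this
  rw [energy, if_pos hmem, heq]

theorem limsup_lintegral_le_of_eventually_le {α : Type*} [MeasurableSpace α] {μ : Measure α}
    {f : ℕ → α → ℝ≥0∞} (g : α → ℝ≥0∞) (hf : ∀ j, Measurable (f j))
    (hg : ∀ᶠ j in atTop, ∀ x, f j x ≤ g x) (hgf : ∫⁻ x, g x ∂μ ≠ ∞) :
    limsup (fun j => ∫⁻ x, f j x ∂μ) atTop ≤ ∫⁻ x, limsup (fun j => f j x) atTop ∂μ := by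
  obtain ⟨N, hN⟩ := eventually_atTop.1 hg
  have h1 := limsup_lintegral_le (μ := μ) (f := fun j => f (j + N)) g (fun j => hf _)
    (fun j => Eventually.of_forall (hN (j + N) (by omega))) hgf
  rw [limsup_nat_add (fun j => ∫⁻ x, f j x ∂μ) N] at h1
  refine h1.trans (le_of_eq ?_)
  congr 1 with x
  exact limsup_nat_add (fun j => f j x) N

/-- Reverse Fatou in `ξ`, for both regimes. The domination contains `2 / ((θ - s) p)`, which may
blow up; it is only required to stay bounded after multiplication by `c j`. -/
theorem limsup_mul_energy_unscale_le (hp : 1 < p) (hω : IsOpen ω) (hωb : Bornology.IsBounded ω)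
    (hM : ∀ x, |w x| ≤ M) (hL : LipschitzWith L w) {s ε : ℕ → ℝ} {s₀ θ : ℝ}
    (hs : ∀ j, s j ∈ Ioo (0 : ℝ) 1) (hs₀ : Tendsto s atTop (𝓝 s₀)) (hε : ∀ j, 0 < ε j)
    (hε₀ : Tendsto ε atTop (𝓝 0)) (hθ1 : θ ≤ 1)
    (hsθ : ∀ᶠ j in atTop, s j < θ ∧ (θ - s j) * p ≤ 1 / 2)
    {c : ℕ → ℝ≥0∞} {B : ℝ≥0∞} (hB : B ≠ ∞) (hc : ∀ j, c j ≠ ∞)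
    (hcB : ∀ᶠ j in atTop, c j * ENNReal.ofReal (2 / ((θ - s j) * p)) ≤ B) {Λ : ℝ≥0∞}
    (hΛ : ∀ ξ, limsup (fun j => c j * slopeEnergy p (s j) (ε j) (film ω 1) w ξ) atTop ≤ Λ) :
    limsup (fun j => c j * energy p ω (s j) (ε j) (unscale (ε j) w)) atTop ≤
      filmConst n s₀ p * Λ := by
  have hfm := measurableSet_film hω.measurableSet 1
  have hm : ∀ j, Measurable (slopeEnergy p (s j) (ε j) (film ω 1) w) := fun j =>
    measurable_slopeEnergy hfm hL.continuous.aestronglyMeasurable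
  have hh : ∀ j, Measurable (horizWeight n p (s j)) := fun j => measurable_horizWeight p (s j)
  have hε1 : ∀ᶠ j in atTop, ε j ≤ 1 := (hε₀.eventually_lt_const one_pos).mono fun _ h => h.le
  calc limsup (fun j => c j * energy p ω (s j) (ε j) (unscale (ε j) w)) atTop
      = limsup (fun j => ∫⁻ ξ, horizWeight n p (s j) ξ *
          (c j * slopeEnergy p (s j) (ε j) (film ω 1) w ξ)) atTop := by
        refine limsup_congr ?_
        filter_upwards [hε1] with j hj
        rw [energy_unscale_eq hp hω.measurableSet hωb hM hL (hs j) (hε j) hj]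
        simp_rw [mul_left_comm _ (c j)]
        rw [lintegral_const_mul' _ _ (hc j)]
    _ ≤ ∫⁻ ξ, limsup (fun j => horizWeight n p (s j) ξ *
          (c j * slopeEnergy p (s j) (ε j) (film ω 1) w ξ)) atTop := by
        refine limsup_lintegral_le_of_eventually_le (fun ξ =>
          ENNReal.ofReal ((L + 2 * M) ^ p * 2 ^ ((((n : ℝ) + 1) + p) / 2)) * volume (film ω 1) *
          B * ENNReal.ofReal ((1 + ‖ξ‖) ^ (-((n : ℝ) + 1 / 2))))
          (fun j => (hh j).mul ((hm j).const_mul _)) ?_ ?_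
        · filter_upwards [hε1, hsθ, hcB] with j h1 h2 h3 ξ
          rw [mul_left_comm]
          refine (mul_le_mul_right (horizWeight_mul_slopeEnergy_le hp hM hL (hs j).1.le h2.1 hθ1
            h2.2 (hε j) h1 ξ) _).trans ?_
          calc _ = ENNReal.ofReal ((L + 2 * M) ^ p * 2 ^ ((((n : ℝ) + 1) + p) / 2)) *
                volume (film ω 1) * (c j * ENNReal.ofReal (2 / ((θ - s j) * p))) *
                ENNReal.ofReal ((1 + ‖ξ‖) ^ (-((n : ℝ) + 1 / 2))) := by ring
            _ ≤ _ := by gcongr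
        · rw [lintegral_const_mul _ (by fun_prop)]
          exact (ENNReal.mul_lt_top (ENNReal.mul_lt_top (ENNReal.mul_lt_top ENNReal.ofReal_lt_top
            (volume_film_lt_top hωb 1)) hB.lt_top) (lintegral_one_add_norm_lt_top n)).ne
    _ ≤ ∫⁻ ξ, horizWeight n p s₀ ξ * Λ := by
        refine lintegral_mono fun ξ => ?_
        have h1 := tendsto_horizWeight (n := n) (p := p) hs₀ ξ
        -- The limit weight is positive and finite, which excludes the forms `0 · ∞` and `∞ · 0` in
        -- the limsup of the product.
        have hpos : horizWeight n p s₀ ξ ≠ 0 := by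
          have : 0 < (1 + ‖ξ‖ ^ 2) ^ ((((n : ℝ) + 1) + s₀ * p) / 2) :=
            Real.rpow_pos_of_pos (by positivity) _
          simpa [horizWeight] using this
        refine (ENNReal.limsup_mul_le' (u := fun j => horizWeight n p (s j) ξ)
          (v := fun j => c j * slopeEnergy p (s j) (ε j) (film ω 1) w ξ) ?_ ?_).trans ?_
        · rw [h1.limsup_eq]; exact Or.inl hpos
        · rw [h1.limsup_eq]; exact Or.inl ENNReal.ofReal_ne_top
        · rw [h1.limsup_eq]
          gcongr
          exact hΛ ξ
    _ = filmConst n s₀ p * Λ := by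
        rw [lintegral_mul_const _ (measurable_horizWeight p s₀)]
        rfl

/-- The domains converge pointwise: since `ω` is open, `x'` stays in `ω` under small horizontal
shifts, while the vertical condition does not involve `j`. Dominated convergence then applies. -/
theorem tendsto_incr_slope (hp : 0 < p) (hω : IsOpen ω) (hωb : Bornology.IsBounded ω)
    (hM : ∀ x, |w x| ≤ M) (hw : Continuous w) {ε : ℕ → ℝ} (hε₀ : Tendsto ε atTop (𝓝 0))
    (ξ : EuclideanSpace ℝ (Fin n)) (h : ℝ) :
    Tendsto (fun j => incr p (film ω 1) w ((ε j * |h|) • ξ, h)) atTop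
      (𝓝 (incr p (film ω 1) w (0, h))) := by
  have hfm := measurableSet_film hω.measurableSet 1
  have hS : ∀ k, MeasurableSet (shiftSet (film ω 1) k) := fun k =>
    hfm.inter (hfm.preimage (measurable_add_const k))
  have hk := tendsto_slope hε₀ (tendsto_const_nhds (x := h)) ξ
  have hM0 : 0 ≤ M := (abs_nonneg _).trans (hM 0)
  unfold incr
  simp_rw [← fun k => lintegral_indicator (μ := (volume : Measure (Pt n))) (hS k)]
  refine tendsto_lintegral_of_dominated_convergence
    ((film ω 1).indicator fun _ => ENNReal.ofReal ((M + M) ^ p)) (fun j => ?_)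
    (fun j => Eventually.of_forall fun x => ?_) ?_ (Eventually.of_forall fun x => ?_)
  · refine Measurable.indicator ?_ (hS _)
    have := hw.measurable
    fun_prop
  · by_cases hx : x ∈ shiftSet (film ω 1) ((ε j * |h|) • ξ, h)
    · rw [indicator_of_mem hx, indicator_of_mem hx.1, enorm_rpow_eq_ofReal _ hp.le]
      refine ENNReal.ofReal_le_ofReal (Real.rpow_le_rpow (abs_nonneg _) ?_ hp.le)
      exact (abs_sub _ _).trans (add_le_add (hM _) (hM _))
    · rw [indicator_of_notMem hx]
      exact zero_le
  · rw [lintegral_indicator hfm, setLIntegral_const]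
    exact (ENNReal.mul_lt_top ENNReal.ofReal_lt_top (volume_film_lt_top hωb 1)).ne
  · have hval : Tendsto (fun j => ‖w (x + ((ε j * |h|) • ξ, h)) - w x‖ₑ ^ p) atTop
        (𝓝 (‖w (x + (0, h)) - w x‖ₑ ^ p)) := by
      have h1 : Tendsto (fun j => w (x + ((ε j * |h|) • ξ, h))) atTop (𝓝 (w (x + (0, h)))) :=
        (hw.tendsto _).comp (hk.const_add x)
      exact ((ENNReal.continuous_rpow_const (y := p)).tendsto _).comp (h1.sub_const _).enorm
    by_cases hx : x ∈ film ω 1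
    · have hx1 : ∀ᶠ j in atTop, x.1 + (ε j * |h|) • ξ ∈ ω := by
        have := (continuous_fst.tendsto _).comp (hk.const_add x)
        refine this.eventually (hω.mem_nhds ?_)
        simpa using hx.1
      by_cases hx2 : x.2 + h ∈ Ioo (0 : ℝ) 1
      · have hm : x ∈ shiftSet (film ω 1) (0, h) := ⟨hx, by simpa using hx.1, hx2⟩
        rw [indicator_of_mem hm]
        refine hval.congr' ?_
        filter_upwards [hx1] with j hj
        have hm : x ∈ shiftSet (film ω 1) ((ε j * |h|) • ξ, h) := ⟨hx, hj, hx2⟩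
        rw [indicator_of_mem hm]
      · have hm : ∀ y, x ∉ shiftSet (film ω 1) (y, h) := fun y hy => hx2 hy.2.2
        simp only [indicator_of_notMem (hm _)]
        exact tendsto_const_nhds
    · have hm : ∀ k, x ∉ shiftSet (film ω 1) k := fun y hy => hx hy.1
      simp only [indicator_of_notMem (hm _)]
      exact tendsto_const_nhds

theorem limsup_energy_unscale_le (hp : 1 < p) (hω : IsOpen ω) (hωb : Bornology.IsBounded ω)
    (hM : ∀ x, |w x| ≤ M) (hL : LipschitzWith L w) {s ε : ℕ → ℝ} {s₀ : ℝ}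
    (hs : ∀ j, s j ∈ Ioo (0 : ℝ) 1) (hs₀ : Tendsto s atTop (𝓝 s₀)) (hs₀0 : 0 ≤ s₀) (hs₀1 : s₀ < 1)
    (hε : ∀ j, 0 < ε j) (hε₀ : Tendsto ε atTop (𝓝 0)) :
    limsup (fun j => energy p ω (s j) (ε j) (unscale (ε j) w)) atTop ≤
      filmConst n s₀ p * verticalGagliardo p s₀ ω w := by
  have hp0 : 0 < p := by linarith
  have hfm := measurableSet_film hω.measurableSet 1
  -- With `θ = s₀ + 2 γ`, eventually `γ ≤ θ - s ≤ 3 γ`. The first term of the minimum gives `θ ≤ 1`,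
  -- the second `(θ - s) p ≤ 1/2`, and the lower bound `γ` keeps the singularity in `h` uniformly
  -- integrable.
  set γ := min ((1 - s₀) / 2) (1 / (6 * p)) with hγ
  have hγ0 : 0 < γ := lt_min (by linarith) (by positivity)
  have hγ1 : γ ≤ (1 - s₀) / 2 := min_le_left _ _
  have hγ2 : 3 * γ * p ≤ 1 / 2 := by
    have : γ ≤ 1 / (6 * p) := min_le_right _ _
    calc 3 * γ * p ≤ 3 * (1 / (6 * p)) * p := by gcongr
      _ = 1 / 2 := by field_simp; norm_num
  set θ := s₀ + 2 * γ with hθ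
  have hev : ∀ᶠ j in atTop, γ ≤ θ - s j ∧ θ - s j ≤ 3 * γ := by
    filter_upwards [Metric.tendsto_nhds.1 hs₀ γ hγ0] with j hj
    rw [Real.dist_eq, abs_lt] at hj
    exact ⟨by linarith [hj.2], by linarith [hj.1]⟩
  have hε1 : ∀ᶠ j in atTop, ε j ≤ 1 := (hε₀.eventually_lt_const one_pos).mono fun _ h => h.le
  have hinner : ∀ ξ, Tendsto (fun j => slopeEnergy p (s j) (ε j) (film ω 1) w ξ) atTop
      (𝓝 (verticalGagliardo p s₀ ω w)) := by
    intro ξ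
    rw [verticalGagliardo_eq hp0.le hω.measurableSet hL.continuous.measurable]
    refine tendsto_lintegral_filter_of_dominated_convergence (fun h =>
      ENNReal.ofReal (((L + 2 * M) * (1 + ‖ξ‖) ^ θ) ^ p) * volume (film ω 1) *
        (Ioo (-1 : ℝ) 1).indicator (fun h => ENNReal.ofReal (|h| ^ (γ * p - 1))) h)
      (Eventually.of_forall fun j => ?_) ?_ ?_ ?_
    · have h1 := measurable_vertWeight p (s j)
      have h2 := measurable_incr p hfm hL.continuous.measurable
      fun_prop
    · filter_upwards [hε1, hev] with j h1 h2
      filter_upwards [compl_mem_ae_iff.2 (measure_singleton (μ := (volume : Measure ℝ)) 0)]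
        with h hh
      refine (vertWeight_mul_incr_le hp hM hL (θ := θ) (by linarith) (by linarith)
        (hε j) h1 ξ hh).trans ?_
      refine mul_le_mul_right ?_ _
      refine indicator_le_indicator' fun hmem => ?_
      refine ENNReal.ofReal_le_ofReal (Real.rpow_le_rpow_of_exponent_ge (abs_pos.2 hh)
        (abs_lt.2 hmem).le ?_)
      have := mul_le_mul_of_nonneg_right h2.1 hp0.le
      linarith
    · rw [lintegral_const_mul _ (Measurable.indicator (by fun_prop) measurableSet_Ioo),
          lintegral_indicator measurableSet_Ioo,
          lintegral_abs_rpow_sub_one (mul_pos hγ0 hp0) one_pos]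
      exact (ENNReal.mul_lt_top (ENNReal.mul_lt_top ENNReal.ofReal_lt_top
        (volume_film_lt_top hωb 1)) ENNReal.ofReal_lt_top).ne
    · filter_upwards [compl_mem_ae_iff.2 (measure_singleton (μ := (volume : Measure ℝ)) 0)]
        with h hh
      refine ENNReal.Tendsto.mul (tendsto_vertWeight hs₀ hh) ?_
        (tendsto_incr_slope hp0 hω hωb hM hL.continuous hε₀ ξ h) (Or.inr ENNReal.ofReal_ne_top)
      refine Or.inr ?_
      refine ((incr_le_of_abs_le hp0.le (b := M + M) fun x =>
        (abs_sub _ _).trans (add_le_add (hM _) (hM _))).trans_lt ?_).ne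
      exact ENNReal.mul_lt_top ENNReal.ofReal_lt_top (volume_film_lt_top hωb 1)
  have := limsup_mul_energy_unscale_le hp hω hωb hM hL hs hs₀ hε hε₀ (θ := θ) (by linarith)
    (hev.mono fun j hj => ⟨by linarith, by
      have := mul_le_mul_of_nonneg_right hj.2 hp0.le
      linarith⟩)
    (c := fun _ => 1) (B := ENNReal.ofReal (2 / (γ * p))) ENNReal.ofReal_ne_top (by simp)
    (hev.mono fun j hj => by
      rw [one_mul]
      gcongr
      exact hj.1) (Λ := verticalGagliardo p s₀ ω w)
    (fun ξ => by simp only [one_mul]; exact (hinner ξ).limsup_eq.le)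
  simpa using this

/-- Unlike for the lower bound, the part away from `0` must be shown negligible: for `δ ≤ |h| < 1`
the weight is at most `1/δ` and `Φ` at most `B`, so the factor `σ j` sends it to zero. -/
theorem limsup_concentration_le {σ : ℕ → ℝ} (hσ0 : ∀ j, 0 < σ j) (hσ : Tendsto σ atTop (𝓝 0))
    {Φ : ℕ → ℝ → ℝ≥0∞} {m B : ℝ≥0∞} (hB : B ≠ ∞)
    (hΦB : ∀ᶠ j in atTop, ∀ h, h ≠ 0 → Φ j h ≤ B) (hΦ0 : ∀ j h, 1 ≤ |h| → Φ j h = 0)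
    (h : ∀ c, m < c → ∀ᶠ z : ℕ × ℝ in atTop ×ˢ 𝓝[≠] (0 : ℝ), Φ z.1 z.2 ≤ c) :
    limsup (fun j => ENNReal.ofReal (σ j) *
      ∫⁻ h, ENNReal.ofReal (|h| ^ (σ j - 1)) * Φ j h) atTop ≤ 2 * m := by
  have key : ∀ c, m < c → c ≠ ∞ → limsup (fun j => ENNReal.ofReal (σ j) *
      ∫⁻ h, ENNReal.ofReal (|h| ^ (σ j - 1)) * Φ j h) atTop ≤ 2 * c := by
    intro c hc hct
    obtain ⟨δ, hδ, hδ1, hev⟩ := exists_radius_of_eventually (P := fun j h => Φ j h ≤ c) (h c hc)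
    have hlim : Tendsto (fun j => 2 * ENNReal.ofReal (δ ^ σ j) * c +
        ENNReal.ofReal (σ j) * (ENNReal.ofReal δ⁻¹ * B * 2)) atTop (𝓝 (2 * c)) := by
      have h1 := ENNReal.Tendsto.const_mul (a := 2) (tendsto_ofReal_rpow_zero hσ hδ)
        (Or.inr (by simp))
      rw [mul_one] at h1
      have h2 : Tendsto (fun j => ENNReal.ofReal (σ j) * (ENNReal.ofReal δ⁻¹ * B * 2)) atTop
          (𝓝 (ENNReal.ofReal 0 * (ENNReal.ofReal δ⁻¹ * B * 2))) :=
        ENNReal.Tendsto.mul_const (ENNReal.tendsto_ofReal hσ) (Or.inr (by finiteness))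
      have := (ENNReal.Tendsto.mul_const h1 (Or.inr hct)).add h2
      simpa using this
    rw [← hlim.limsup_eq]
    refine limsup_le_limsup ?_
    filter_upwards [hev, hΦB, hσ.eventually_lt_const one_pos] with j hj hjB hσ1
    rw [← mul_lintegral_abs_rpow_sub_one (hσ0 j) hδ, mul_assoc,
      ← lintegral_mul_const _ (by fun_prop), ← mul_add]
    refine mul_le_mul_right ?_ _
    have hvol : ENNReal.ofReal δ⁻¹ * B * 2 = ∫⁻ _ in Ioo (-1 : ℝ) 1, ENNReal.ofReal δ⁻¹ * B := by
      rw [setLIntegral_const, Real.volume_Ioo]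
      norm_num
    rw [hvol, ← lintegral_indicator measurableSet_Ioo, ← lintegral_indicator measurableSet_Ioo,
      ← lintegral_add_left (Measurable.indicator (by fun_prop) measurableSet_Ioo)]
    refine lintegral_mono_ae ?_
    filter_upwards [compl_mem_ae_iff.2 (measure_singleton (μ := (volume : Measure ℝ)) 0)]
      with h h0
    have h0 : h ≠ 0 := h0
    by_cases h1 : h ∈ Ioo (-δ) δ
    · rw [indicator_of_mem h1]
      refine le_add_right ?_
      gcongr
      exact hj h h1 h0
    by_cases h2 : h ∈ Ioo (-1 : ℝ) 1
    · rw [indicator_of_mem h2]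
      refine le_add_left ?_
      refine mul_le_mul' (ENNReal.ofReal_le_ofReal ?_) (hjB h h0)
      have hh : δ ≤ |h| := by
        by_contra hcon
        exact h1 (abs_lt.1 (not_le.1 hcon))
      calc |h| ^ (σ j - 1) ≤ |h| ^ (-1 : ℝ) :=
            Real.rpow_le_rpow_of_exponent_ge (abs_pos.2 h0) (abs_lt.2 h2).le (by linarith [hσ0 j])
        _ = |h|⁻¹ := Real.rpow_neg_one _
        _ ≤ δ⁻¹ := by gcongr
    · rw [hΦ0 j h (by
        by_contra hcon
        exact h2 (abs_lt.1 (not_le.1 hcon))), mul_zero]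
      exact zero_le
  rcases eq_or_ne m ∞ with rfl | hm
  · simp
  refine le_of_forall_gt_imp_ge_of_dense fun b hb => ?_
  rcases eq_or_ne b ∞ with rfl | hbt
  · exact le_top
  have h2 : m < b / 2 := by
    rw [ENNReal.lt_div_iff_mul_lt (by simp) (by simp), mul_comm]
    exact hb
  have := key _ h2 (ENNReal.div_lt_top hbt (by simp)).ne
  rwa [ENNReal.mul_div_cancel (by simp) (by simp)] at this

/-- The difference quotients are bounded by `L (1 + ‖ξ‖)` and converge pointwise to the vertical
derivative as `j → ∞` and `h → 0` jointly. Dominated convergence supplies the hypothesis of the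
concentration lemma. -/
theorem limsup_slopeEnergy_le (hp : 1 < p) (hωb : Bornology.IsBounded ω)
    (hL : LipschitzWith L w) (hd : Differentiable ℝ w) {s ε : ℕ → ℝ}
    (hs : ∀ j, s j < 1) (hs₀ : Tendsto s atTop (𝓝 1))
    (hε : ∀ j, 0 < ε j) (hε₀ : Tendsto ε atTop (𝓝 0)) (ξ : EuclideanSpace ℝ (Fin n)) :
    limsup (fun j => ENNReal.ofReal (1 - s j) * slopeEnergy p (s j) (ε j) (film ω 1) w ξ) atTop ≤
      ENNReal.ofReal (2 / p) * ∫⁻ x in film ω 1, ‖fderiv ℝ w x (0, 1)‖ₑ ^ p := by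
  have hp0 : 0 < p := by linarith
  have hε1 : ∀ᶠ j in atTop, ε j ≤ 1 := (hε₀.eventually_lt_const one_pos).mono fun _ h => h.le
  have hfin : IsFiniteMeasure (volume.restrict (film ω 1)) :=
    ⟨by simpa using volume_film_lt_top hωb 1⟩
  have hquot : ∀ j, ε j ≤ 1 → ∀ h : ℝ, h ≠ 0 → ∀ x : Pt n,
      ‖h⁻¹‖ₑ ^ p * ‖w (x + ((ε j * |h|) • ξ, h)) - w x‖ₑ ^ p ≤
        ENNReal.ofReal ((L * (1 + ‖ξ‖)) ^ p) := by
    intro j hj h hh x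
    have hh' : 0 < |h| := abs_pos.2 hh
    rw [← ENNReal.mul_rpow_of_nonneg _ _ hp0.le, ← enorm_mul, enorm_rpow_eq_ofReal _ hp0.le]
    refine ENNReal.ofReal_le_ofReal (Real.rpow_le_rpow (abs_nonneg _) ?_ hp0.le)
    have h1 := hL.dist_le_mul (x + ((ε j * |h|) • ξ, h)) x
    rw [Real.dist_eq, dist_self_add_left] at h1
    rw [abs_mul, abs_inv, inv_mul_le_iff₀ hh']
    calc _ ≤ _ := h1
      _ ≤ L * (|h| * (1 + ‖ξ‖)) := by
          gcongr
          exact norm_slope_le (hε j) hj ξ h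
      _ = _ := by ring
  have h1 := limsup_concentration_le (σ := fun j => p * (1 - s j))
    (fun j => mul_pos hp0 (by linarith [hs j])) (by simpa using (hs₀.const_sub 1).const_mul p)
    (Φ := fun j h => ‖h⁻¹‖ₑ ^ p * incr p (film ω 1) w ((ε j * |h|) • ξ, h))
    (m := ∫⁻ x in film ω 1, ‖fderiv ℝ w x (0, 1)‖ₑ ^ p)
    (B := ENNReal.ofReal ((L * (1 + ‖ξ‖)) ^ p) * volume (film ω 1))
    (ENNReal.mul_lt_top ENNReal.ofReal_lt_top (volume_film_lt_top hωb 1)).ne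
    (by
      filter_upwards [hε1] with j hj h hh
      have hm := hL.continuous.measurable
      rw [incr, ← lintegral_const_mul _ (by fun_prop)]
      calc _ ≤ ∫⁻ _ in shiftSet (film ω 1) ((ε j * |h|) • ξ, h),
            ENNReal.ofReal ((L * (1 + ‖ξ‖)) ^ p) := lintegral_mono fun x => hquot j hj h hh x
        _ ≤ _ := by
            rw [setLIntegral_const]
            gcongr
            exact shiftSet_subset _ _)
    (fun j h hh => by rw [incr_film_eq_zero _ hh, mul_zero])
    (by
      intro c hc
      have hm := hL.continuous.measurable
      have hlim : Tendsto (fun z : ℕ × ℝ => ∫⁻ x in film ω 1,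
          ‖z.2⁻¹‖ₑ ^ p * ‖w (x + ((ε z.1 * |z.2|) • ξ, z.2)) - w x‖ₑ ^ p) (atTop ×ˢ 𝓝[≠] (0 : ℝ))
          (𝓝 (∫⁻ x in film ω 1, ‖fderiv ℝ w x (0, 1)‖ₑ ^ p)) := by
        have hz0 : ∀ᶠ z : ℕ × ℝ in atTop ×ˢ 𝓝[≠] (0 : ℝ), z.2 ≠ 0 :=
          tendsto_snd.eventually self_mem_nhdsWithin
        have hzε : Tendsto (fun z : ℕ × ℝ => ε z.1) (atTop ×ˢ 𝓝[≠] (0 : ℝ)) (𝓝 0) :=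
          hε₀.comp tendsto_fst
        refine tendsto_lintegral_filter_of_dominated_convergence
          (fun _ => ENNReal.ofReal ((L * (1 + ‖ξ‖)) ^ p))
          (Eventually.of_forall fun z => by fun_prop) ?_ ?_ (Eventually.of_forall fun x => ?_)
        · filter_upwards [hz0, tendsto_fst.eventually hε1] with z h1 h2
          exact Eventually.of_forall fun x => hquot z.1 h2 z.2 h1 x
        · rw [lintegral_const]
          exact (ENNReal.mul_lt_top ENNReal.ofReal_lt_top (measure_lt_top _ _)).ne
        · have hder := ((hd x).hasFDerivAt.hasFDerivWithinAt (s := univ)).lim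
            (l := atTop ×ˢ 𝓝[≠] (0 : ℝ)) (c := fun z : ℕ × ℝ => z.2⁻¹)
            (d := fun z : ℕ × ℝ => (((ε z.1 * |z.2|) • ξ, z.2) : Pt n)) (v := (0, 1))
            (tendsto_slope hzε (tendsto_snd.mono_right nhdsWithin_le_nhds) ξ)
            (by simp)
            (tendsto_inv_smul_slope hzε hz0 ξ)
          have h3 := ((ENNReal.continuous_rpow_const (y := p)).tendsto _).comp hder.enorm
          refine h3.congr fun z => ?_
          simp only [Function.comp, smul_eq_mul, enorm_mul]
          rw [ENNReal.mul_rpow_of_nonneg _ _ hp0.le]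
      filter_upwards [hlim.eventually_lt_const hc] with z hz
      refine le_trans ?_ hz.le
      rw [incr, ← lintegral_const_mul _ (by fun_prop)]
      exact lintegral_mono_set (shiftSet_subset _ _))
  have h2 : ENNReal.ofReal (2 / p) = ENNReal.ofReal (1 / p) * 2 := by
    rw [show 2 / p = 1 / p * 2 by ring, ENNReal.ofReal_mul (by positivity)]
    simp
  rw [h2, mul_assoc]
  refine le_trans ?_ (mul_le_mul_right h1 _)
  simp_rw [mul_slopeEnergy_eq hp0]
  rw [ENNReal.limsup_const_mul_of_ne_top ENNReal.ofReal_ne_top]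

/-- Here `θ = 1` is admissible, since `(1 - s) p` is eventually at most `1/2`, and the factor `1 -
s` exactly compensates `2 / ((1 - s) p)`. -/
theorem limsup_one_sub_mul_energy_unscale_le (hp : 1 < p) (hω : IsOpen ω)
    (hωb : Bornology.IsBounded ω) (hM : ∀ x, |w x| ≤ M) (hL : LipschitzWith L w)
    (hd : Differentiable ℝ w) {s ε : ℕ → ℝ}
    (hs : ∀ j, s j ∈ Ioo (0 : ℝ) 1) (hs₀ : Tendsto s atTop (𝓝 1))
    (hε : ∀ j, 0 < ε j) (hε₀ : Tendsto ε atTop (𝓝 0)) :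
    limsup (fun j => ENNReal.ofReal (1 - s j) * energy p ω (s j) (ε j) (unscale (ε j) w)) atTop ≤
      filmConst n 1 p *
        (ENNReal.ofReal (2 / p) * ∫⁻ x in film ω 1, ‖fderiv ℝ w x (0, 1)‖ₑ ^ p) := by
  have hp0 : 0 < p := by linarith
  refine limsup_mul_energy_unscale_le hp hω hωb hM hL hs hs₀ hε hε₀ (θ := 1) le_rfl ?_
    (B := ENNReal.ofReal (2 / p)) ENNReal.ofReal_ne_top (fun _ => ENNReal.ofReal_ne_top) ?_
    (limsup_slopeEnergy_le hp hωb hL hd (fun j => (hs j).2) hs₀ hε hε₀)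
  · have h1 : Tendsto (fun j => (1 - s j) * p) atTop (𝓝 0) := by
      simpa using (hs₀.const_sub 1).mul_const p
    filter_upwards [h1.eventually_lt_const (show (0 : ℝ) < 1 / 2 by norm_num)] with j hj
    exact ⟨(hs j).2, hj.le⟩
  · refine Eventually.of_forall fun j => ?_
    have : 0 < 1 - s j := by linarith [(hs j).2]
    rw [← ENNReal.ofReal_mul this.le]
    refine ENNReal.ofReal_le_ofReal (le_of_eq ?_)
    field_simp

end UpperBound

end ThinFilm

open scoped Convolution

namespace ThinFilm

/-! ### Jensen's inequality for averages along the vertical contraction. -/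

section Averaging

/-- Jensen's inequality for the probability density `ρ`, obtained from Hölder by splitting `ρ =
ρ^(1/p) ρ^(1/q)`. This form needs no integrability of `D`. -/
theorem enorm_integral_mul_rpow_le {X : Type*} [MeasurableSpace X] {μ : Measure X} {p : ℝ}
    (hp : 1 < p) {ρ D : X → ℝ} (hρ : Measurable ρ) (hρ0 : ∀ x, 0 ≤ ρ x) (hρ1 : ∫ x, ρ x ∂μ = 1)
    (hD : Measurable D) :
    ‖∫ x, D x * ρ x ∂μ‖ₑ ^ p ≤ ∫⁻ x, ‖D x‖ₑ ^ p * ENNReal.ofReal (ρ x) ∂μ := by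
  have hp0 : 0 < p := by linarith
  obtain ⟨q, hpq⟩ : ∃ q, p.HolderConjugate q := ⟨_, Real.HolderConjugate.conjExponent hp⟩
  have hq0 := hpq.symm.pos
  have hρi : Integrable ρ μ := by
    by_contra h
    rw [integral_undef h] at hρ1
    exact zero_ne_one hρ1
  have hmass : ∫⁻ x, ENNReal.ofReal (ρ x) ∂μ = 1 := by
    rw [← ofReal_integral_eq_lintegral_ofReal hρi (Eventually.of_forall hρ0), hρ1]
    simp
  have hsplit : ∀ r : ℝ≥0∞, r ^ (1 / p) * r ^ (1 / q) = r := fun r => by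
    rw [← ENNReal.rpow_add_of_nonneg _ _ (by positivity) (by positivity), one_div, one_div,
      hpq.inv_add_inv_eq_one, ENNReal.rpow_one]
  have h1 : ‖∫ x, D x * ρ x ∂μ‖ₑ ≤
      (∫⁻ x, ‖D x‖ₑ ^ p * ENNReal.ofReal (ρ x) ∂μ) ^ (1 / p) := by
    calc ‖∫ x, D x * ρ x ∂μ‖ₑ ≤ ∫⁻ x, ‖D x * ρ x‖ₑ ∂μ := enorm_integral_le_lintegral_enorm _
      _ = ∫⁻ x, ((fun x => ‖D x‖ₑ * ENNReal.ofReal (ρ x) ^ (1 / p)) *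
            (fun x => ENNReal.ofReal (ρ x) ^ (1 / q))) x ∂μ := by
          congr 1 with x
          rw [Pi.mul_apply, mul_assoc, hsplit, enorm_mul, Real.enorm_of_nonneg (hρ0 x)]
      _ ≤ _ := ENNReal.lintegral_mul_le_Lp_mul_Lq μ hpq (by fun_prop) (by fun_prop)
      _ = _ := by
          have e1 : ∀ x, (‖D x‖ₑ * ENNReal.ofReal (ρ x) ^ (1 / p)) ^ p =
              ‖D x‖ₑ ^ p * ENNReal.ofReal (ρ x) := fun x => by
            rw [ENNReal.mul_rpow_of_nonneg _ _ hp0.le, ← ENNReal.rpow_mul,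
              one_div_mul_cancel hp0.ne', ENNReal.rpow_one]
          have e2 : ∀ x, (ENNReal.ofReal (ρ x) ^ (1 / q)) ^ q = ENNReal.ofReal (ρ x) := fun x => by
            rw [← ENNReal.rpow_mul, one_div_mul_cancel hq0.ne', ENNReal.rpow_one]
          simp only [e1, e2, hmass, ENNReal.one_rpow, mul_one]
  calc _ ≤ ((∫⁻ x, ‖D x‖ₑ ^ p * ENNReal.ofReal (ρ x) ∂μ) ^ (1 / p)) ^ p := by gcongr
    _ = _ := by rw [← ENNReal.rpow_mul, one_div_mul_cancel hp0.ne', ENNReal.rpow_one]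

variable {n : ℕ} {p η : ℝ} {ρ : Pt n → ℝ}

/-- A smooth probability density supported in the closed ball of radius `η` about the origin. -/
structure IsMollifier (η : ℝ) (ρ : Pt n → ℝ) : Prop where
  contDiff : ContDiff ℝ ((⊤ : ℕ∞) : WithTop ℕ∞) ρ
  nonneg : ∀ z, 0 ≤ ρ z
  integral_eq_one : ∫ z, ρ z = 1
  tsupport_subset : tsupport ρ ⊆ Metric.closedBall 0 η

theorem exists_isMollifier (n : ℕ) (hη : 0 < η) : ∃ ρ : Pt n → ℝ, IsMollifier η ρ := by
  let φ : ContDiffBump (0 : Pt n) := ⟨η / 2, η, by positivity, by linarith⟩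
  exact ⟨φ.normed volume, φ.contDiff_normed, φ.nonneg_normed, φ.integral_normed,
    φ.tsupport_normed_eq.subset⟩

theorem IsMollifier.hasCompactSupport (h : IsMollifier η ρ) : HasCompactSupport ρ :=
  HasCompactSupport.of_support_subset_isCompact (isCompact_closedBall 0 η)
    ((subset_tsupport ρ).trans h.tsupport_subset)

theorem IsMollifier.norm_le (h : IsMollifier η ρ) {z : Pt n} (hz : ρ z ≠ 0) : ‖z‖ ≤ η := by
  simpa using h.tsupport_subset (subset_tsupport ρ hz)

theorem IsMollifier.lintegral_eq_one (h : IsMollifier η ρ) :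
    ∫⁻ z, ENNReal.ofReal (ρ z) = 1 := by
  rw [← ofReal_integral_eq_lintegral_ofReal
    (h.contDiff.continuous.integrable_of_hasCompactSupport h.hasCompactSupport)
    (Eventually.of_forall h.nonneg), h.integral_eq_one]
  simp

theorem IsMollifier.integrable_mul (h : IsMollifier η ρ) {f : Pt n → ℝ} (hf : Integrable f)
    (y : Pt n) : Integrable fun z => f (y - z) * ρ z := by
  obtain ⟨B, hB⟩ := HasCompactSupport.exists_abs_le h.hasCompactSupport h.contDiff.continuous
  exact (hf.comp_sub_left y).mul_bdd (c := B) h.contDiff.continuous.aestronglyMeasurable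
    (Eventually.of_forall hB)

/-- The affine contraction of the vertical coordinate which maps `[0, 1]` to `[2 η, 1 - 2 η]`. -/
noncomputable def squeeze (η : ℝ) (x : Pt n) : Pt n := (x.1, (1 - 4 * η) * x.2 + 2 * η)

theorem continuous_squeeze (η : ℝ) : Continuous (squeeze η : Pt n → Pt n) := by
  unfold squeeze; fun_prop

theorem squeeze_add (η : ℝ) (x : Pt n) (h : ℝ) :
    squeeze η (x + (0, h)) = squeeze η x + (0, (1 - 4 * η) * h) := by
  ext1
  · simp [squeeze]
  · simp [squeeze]; ring

/-- By Tonelli, `ρ` contributes its unit mass, and the contraction contributes its Jacobian `1 - 4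
η`. -/
theorem mul_lintegral_lintegral_squeeze (h : IsMollifier η ρ) (hη : η < 1 / 4)
    {F : Pt n → ℝ≥0∞} (hF : Measurable F) :
    ENNReal.ofReal (1 - 4 * η) * ∫⁻ x, ∫⁻ z, F (squeeze η x - z) * ENNReal.ofReal (ρ z) =
      ∫⁻ x, F x := by
  have hρ := h.contDiff.continuous.measurable
  have hsq := (continuous_squeeze (n := n) η).measurable
  have hswap := lintegral_lintegral_swap (μ := (volume : Measure (Pt n)))
    (ν := (volume : Measure (Pt n)))
    (f := fun x z => F (squeeze η x - z) * ENNReal.ofReal (ρ z))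
    (Measurable.aemeasurable (by dsimp only [Function.uncurry_def]; fun_prop))
  have hz : ∀ z : Pt n, ENNReal.ofReal (1 - 4 * η) *
      ∫⁻ x, F (squeeze η x - z) * ENNReal.ofReal (ρ z) = (∫⁻ x, F x) * ENNReal.ofReal (ρ z) := by
    intro z
    rw [lintegral_mul_const _ (by fun_prop), ← mul_assoc]
    congr 1
    have h1 := lintegral_eq_mul_lintegral_scale (n := n) (f := fun y => F (y + ((0, 2 * η) - z)))
      (by fun_prop) (ε := 1 - 4 * η) (by linarith)
    rw [lintegral_add_right_eq_self F] at h1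
    rw [h1]
    congr 2 with x
    congr 1
    rw [← add_sub_assoc]
    congr 1
    ext1 <;> simp [squeeze]
  have hm : Measurable fun z => ∫⁻ x : Pt n, F (squeeze η x - z) * ENNReal.ofReal (ρ z) :=
    Measurable.lintegral_prod_left' (f := fun q : Pt n × Pt n =>
      F (squeeze η q.1 - q.2) * ENNReal.ofReal (ρ q.2)) (by fun_prop)
  rw [hswap, ← lintegral_const_mul _ hm]
  simp_rw [hz]
  rw [lintegral_const_mul _ (by fun_prop), h.lintegral_eq_one, mul_one]

theorem mul_lintegral_average_rpow_le (hp : 1 < p) (h : IsMollifier η ρ) (hη : η < 1 / 4)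
    {X : Set (Pt n)} (hX : MeasurableSet X) {T : Pt n → ℝ} {D : Pt n → Pt n → ℝ}
    (hD : ∀ x, Measurable (D x)) (hT : ∀ x ∈ X, T x = ∫ z, D x z * ρ z) {F : Pt n → ℝ≥0∞}
    (hF : Measurable F)
    (hDF : ∀ x ∈ X, ∀ z, ρ z ≠ 0 → ‖D x z‖ₑ ^ p ≤ F (squeeze η x - z)) :
    ENNReal.ofReal (1 - 4 * η) * ∫⁻ x in X, ‖T x‖ₑ ^ p ≤ ∫⁻ x, F x := by
  rw [← mul_lintegral_lintegral_squeeze h hη hF]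
  refine mul_le_mul_right ?_ _
  refine le_trans ?_ (setLIntegral_le_lintegral X _)
  refine setLIntegral_mono' hX fun x hx => ?_
  rw [hT x hx]
  refine (enorm_integral_mul_rpow_le hp h.contDiff.continuous.measurable h.nonneg
    h.integral_eq_one (hD x)).trans (lintegral_mono fun z => ?_)
  by_cases hz : ρ z = 0
  · simp [hz]
  · gcongr
    exact hDF x hx z hz

end Averaging

/-! ### The approximation does not increase the limit energies, up to factors near one. -/

section Approximation

variable {n : ℕ} {p η : ℝ} {ρ : Pt n → ℝ} {ω : Set (EuclideanSpace ℝ (Fin n))} {v : Pt n → ℝ}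
  {χ : EuclideanSpace ℝ (Fin n) → ℝ}

/-- The function `χ(x') v(x)`, cut off to `η ≤ x_d ≤ 1 - η`. -/
noncomputable def cutoff (η : ℝ) (χ : EuclideanSpace ℝ (Fin n) → ℝ) (v : Pt n → ℝ) : Pt n → ℝ :=
  {y : Pt n | y.2 ∈ Icc η (1 - η)}.indicator fun y => χ y.1 * v y

/-- The mollification of `f` with the density `ρ`, composed with `squeeze η`. -/
noncomputable def smoothing (η : ℝ) (ρ f : Pt n → ℝ) (x : Pt n) : ℝ :=
  (f ⋆[ContinuousLinearMap.lsmul ℝ ℝ, volume] ρ) (squeeze η x)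

theorem smoothing_eq (η : ℝ) (ρ f : Pt n → ℝ) (x : Pt n) :
    smoothing η ρ f x = ∫ z, f (squeeze η x - z) * ρ z := by
  rw [smoothing, convolution_lsmul_swap]
  rfl

theorem measurable_cutoff (hχ : Continuous χ) (hv : Measurable v) :
    Measurable (cutoff η χ v) := by
  refine Measurable.indicator ?_ (measurableSet_Icc.preimage measurable_snd)
  have := hχ.measurable
  fun_prop

theorem isCompact_prod_Icc (hχc : HasCompactSupport χ) (η : ℝ) :
    IsCompact (tsupport χ ×ˢ Icc η (1 - η) : Set (Pt n)) :=
  hχc.isCompact.prod isCompact_Icc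

theorem prod_Icc_subset_film (hη : 0 < η) (hχω : tsupport χ ⊆ ω) :
    (tsupport χ ×ˢ Icc η (1 - η) : Set (Pt n)) ⊆ film ω 1 := by
  rintro x ⟨h1, h2, h3⟩
  exact ⟨hχω h1, by linarith, by linarith⟩

theorem cutoff_eq_indicator (η : ℝ) (χ : EuclideanSpace ℝ (Fin n) → ℝ) (v : Pt n → ℝ) :
    cutoff η χ v = (tsupport χ ×ˢ Icc η (1 - η) : Set (Pt n)).indicator fun y => χ y.1 * v y := by
  ext y
  by_cases h2 : y.2 ∈ Icc η (1 - η)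
  · by_cases h1 : y.1 ∈ tsupport χ
    · have hm : y ∈ (tsupport χ ×ˢ Icc η (1 - η) : Set (Pt n)) := ⟨h1, h2⟩
      rw [indicator_of_mem hm, cutoff, indicator_of_mem (by exact h2)]
    · have hm : y ∉ (tsupport χ ×ˢ Icc η (1 - η) : Set (Pt n)) := fun h => h1 h.1
      rw [indicator_of_notMem hm, cutoff, indicator_of_mem (by exact h2),
        image_eq_zero_of_notMem_tsupport h1, zero_mul]
  · have hm : y ∉ (tsupport χ ×ˢ Icc η (1 - η) : Set (Pt n)) := fun h => h2 h.2
    rw [indicator_of_notMem hm, cutoff, indicator_of_notMem (by exact h2)]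

theorem integrable_cutoff (hp : 1 < p) (hη : 0 < η) (hχ : Continuous χ)
    (hχ1 : ∀ x, χ x ∈ Icc (0 : ℝ) 1) (hχc : HasCompactSupport χ) (hχω : tsupport χ ⊆ ω)
    (hv : MemLpLoc p (film ω 1) v) : Integrable (cutoff η χ v) := by
  have hQ := isCompact_prod_Icc hχc η
  rw [cutoff_eq_indicator, integrable_indicator_iff hQ.measurableSet]
  refine (hv.integrableOn hp (prod_Icc_subset_film hη hχω) hQ).bdd_mul (c := 1)
    (by fun_prop) (Eventually.of_forall fun x => ?_)
  rw [Real.norm_eq_abs, abs_le]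
  exact ⟨by linarith [(hχ1 x.1).1], (hχ1 x.1).2⟩

theorem hasCompactSupport_cutoff (hχc : HasCompactSupport χ) : HasCompactSupport (cutoff η χ v) := by
  rw [cutoff_eq_indicator]
  exact HasCompactSupport.of_support_subset_isCompact (isCompact_prod_Icc hχc η)
    support_indicator_subset

/-- The contraction leaves a margin `2 η` at both faces: one `η` is consumed by the mollifier and
the other keeps the points in a compact part of the film, where `v` is in `L^p`. -/
theorem squeeze_sub_mem_Icc (hη1 : η < 1 / 4) {x : Pt n}
    (hx : x.2 ∈ Ioo (0 : ℝ) 1) {z : Pt n} (hz : ‖z‖ ≤ η) :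
    (squeeze η x - z).2 ∈ Icc η (1 - η) := by
  have h1 : |z.2| ≤ η := (norm_snd_le z).trans hz
  rw [abs_le] at h1
  have h2 := hx.1
  have h3 := hx.2
  constructor
  · simp only [squeeze, Prod.snd_sub]
    nlinarith
  · simp only [squeeze, Prod.snd_sub]
    nlinarith

/-- A vertical increment of the smoothing is an average of vertical increments of `χ v`. The factor
`χ ≤ 1` depends on `x'` only, so it comes out of the increment with no derivative of `χ`; and the
points averaged over lie where the vertical cutoff is one. -/
theorem mul_incr_smoothing_le (hp : 1 < p) (hη : 0 < η) (hη1 : η < 1 / 4) (h : IsMollifier η ρ)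
    (hω : IsOpen ω) (hχ : Continuous χ)
    (hχ1 : ∀ x, χ x ∈ Icc (0 : ℝ) 1) (hχc : HasCompactSupport χ) (hχω : tsupport χ ⊆ ω)
    (hvm : Measurable v) (hv : MemLpLoc p (film ω 1) v) (t : ℝ) :
    ENNReal.ofReal (1 - 4 * η) * incr p (film ω 1) (smoothing η ρ (cutoff η χ v)) (0, t) ≤
      incr p (film ω 1) v (0, (1 - 4 * η) * t) := by
  have hfm := measurableSet_film hω.measurableSet 1
  have hS : ∀ k, MeasurableSet (shiftSet (film ω 1) k) := fun k =>
    hfm.inter (hfm.preimage (measurable_add_const k))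
  set f := cutoff η χ v with hf
  have hfmeas : Measurable f := measurable_cutoff hχ hvm
  have hfi : Integrable f := integrable_cutoff hp hη hχ hχ1 hχc hχω hv
  set e : Pt n := (0, (1 - 4 * η) * t) with he
  have hrhs : incr p (film ω 1) v e =
      ∫⁻ x, (shiftSet (film ω 1) e).indicator (fun x => ‖v (x + e) - v x‖ₑ ^ p) x := by
    rw [incr, lintegral_indicator (hS _)]
  rw [hrhs]
  refine mul_lintegral_average_rpow_le hp h hη1 (hS _)
    (D := fun x z => f (squeeze η x + e - z) - f (squeeze η x - z)) (fun x => by fun_prop)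
    (fun x _ => ?_) (Measurable.indicator (by fun_prop) (hS _)) (fun x hx z hz => ?_)
  · rw [smoothing_eq, smoothing_eq, squeeze_add, ← he]
    simp_rw [sub_mul]
    rw [integral_sub (h.integrable_mul hfi _) (h.integrable_mul hfi _)]
  · have hz' := h.norm_le hz
    have m1 := squeeze_sub_mem_Icc hη1 hx.1.2 hz'
    have m2 := squeeze_sub_mem_Icc hη1 hx.2.2 hz'
    rw [squeeze_add, ← he, add_sub_right_comm] at m2
    set y := squeeze η x - z with hy
    have hfst : (y + e).1 = y.1 := by simp [he]
    have hfd : f (squeeze η x + e - z) - f y = χ y.1 * (v (y + e) - v y) := by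
      rw [add_sub_right_comm, ← hy, hf, cutoff, indicator_of_mem (by exact m2),
        indicator_of_mem (by exact m1), hfst]
      ring
    rw [hfd]
    by_cases hyω : y.1 ∈ ω
    · have hmem : y ∈ shiftSet (film ω 1) e := by
        refine ⟨⟨hyω, ?_, ?_⟩, ⟨by rw [hfst]; exact hyω, ?_, ?_⟩⟩
        · linarith [m1.1]
        · linarith [m1.2]
        · linarith [m2.1]
        · linarith [m2.2]
      rw [indicator_of_mem hmem, enorm_mul]
      gcongr
      have : ‖χ y.1‖ₑ ≤ 1 := by
        rw [Real.enorm_of_nonneg (hχ1 _).1]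
        simpa using (hχ1 y.1).2
      calc _ ≤ 1 * ‖v (y + e) - v y‖ₑ := by gcongr
        _ = _ := one_mul _
    · rw [image_eq_zero_of_notMem_tsupport (fun h => hyω (hχω h)), zero_mul, enorm_zero,
        ENNReal.zero_rpow_of_pos (by linarith)]
      exact zero_le

theorem hasFDerivAt_squeeze (η : ℝ) (x : Pt n) :
    HasFDerivAt (squeeze η : Pt n → Pt n)
      ((ContinuousLinearMap.fst ℝ (EuclideanSpace ℝ (Fin n)) ℝ).prod
        ((1 - 4 * η) • ContinuousLinearMap.snd ℝ (EuclideanSpace ℝ (Fin n)) ℝ)) x := by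
  refine HasFDerivAt.prodMk hasFDerivAt_fst ?_
  exact (hasFDerivAt_snd.const_smul (1 - 4 * η)).add_const _

theorem contDiff_squeeze (η : ℝ) :
    ContDiff ℝ ((⊤ : ℕ∞) : WithTop ℕ∞) (squeeze η : Pt n → Pt n) := by
  unfold squeeze; fun_prop

theorem fderiv_smoothing (h : IsMollifier η ρ) {f : Pt n → ℝ} (hf : Integrable f) (x : Pt n) :
    fderiv ℝ (smoothing η ρ f) x (0, 1) =
      (1 - 4 * η) * ∫ y, f y * fderiv ℝ ρ (squeeze η x - y) (0, 1) := by
  have hρ1 : ContDiff ℝ 1 ρ := h.contDiff.of_le (by exact_mod_cast le_top)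
  have h1 := h.hasCompactSupport.hasFDerivAt_convolution_right (ContinuousLinearMap.lsmul ℝ ℝ)
    hf.locallyIntegrable hρ1 (squeeze η x)
  have h2 := h1.comp x (hasFDerivAt_squeeze η x)
  have h3 : fderiv ℝ (smoothing η ρ f) x = _ := h2.fderiv
  rw [h3, ContinuousLinearMap.comp_apply]
  have h4 : ((ContinuousLinearMap.fst ℝ (EuclideanSpace ℝ (Fin n)) ℝ).prod
      ((1 - 4 * η) • ContinuousLinearMap.snd ℝ (EuclideanSpace ℝ (Fin n)) ℝ)) (0, 1) =
      (1 - 4 * η) • ((0, 1) : Pt n) := by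
    ext1 <;> simp
  rw [h4, map_smul, convolution_precompR_apply _ hf.locallyIntegrable
    (h.hasCompactSupport.fderiv (𝕜 := ℝ)) (hρ1.continuous_fderiv (by simp)), smul_eq_mul]
  rfl

/-- The vertical derivative of the smoothing is `1 - 4 η` times an average of `χ g`. Since `(1 - 4
η)^p ≤ 1 - 4 η`, this factor absorbs the Jacobian, and the bound holds without loss. -/
theorem lintegral_fderiv_smoothing_le (hp : 1 < p) (hη : 0 < η) (hη1 : η < 1 / 4)
    (h : IsMollifier η ρ) (hω : IsOpen ω) (hχ : ContDiff ℝ ((⊤ : ℕ∞) : WithTop ℕ∞) χ)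
    (hχ1 : ∀ x, χ x ∈ Icc (0 : ℝ) 1) (hχc : HasCompactSupport χ) (hχω : tsupport χ ⊆ ω)
    (hv : MemLpLoc p (film ω 1) v) {g : Pt n → ℝ} (hg : IsWeakVerticalDeriv (film ω 1) v g) :
    ∫⁻ x in film ω 1, ‖fderiv ℝ (smoothing η ρ (cutoff η χ v)) x (0, 1)‖ₑ ^ p ≤
      ∫⁻ x in film ω 1, ‖g x‖ₑ ^ p := by
  have hfm := measurableSet_film hω.measurableSet 1
  have hp0 : 0 < p := by linarith
  have hc : 0 < 1 - 4 * η := by linarith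
  obtain ⟨g', hg'm, hgg'⟩ := hg.2.1.aestronglyMeasurable
  set G : Pt n → ℝ := (film ω 1).indicator (fun y => χ y.1 * g' y) with hG
  have hGm : Measurable G := by
    refine Measurable.indicator ?_ hfm
    have := hg'm.measurable
    have := hχ.continuous.measurable
    fun_prop
  have hfi : Integrable (cutoff η χ v) := integrable_cutoff hp hη hχ.continuous hχ1 hχc hχω hv
  have hT : ∀ x ∈ film ω 1, fderiv ℝ (smoothing η ρ (cutoff η χ v)) x (0, 1) =
      ∫ z, ((1 - 4 * η) * G (squeeze η x - z)) * ρ z := by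
    intro x hx
    rw [fderiv_smoothing h hfi]
    simp_rw [mul_assoc]
    rw [integral_const_mul]
    congr 1
    set Y := squeeze η x with hY
    -- The test function for the weak derivative: its vertical derivative falls on `ρ` alone, and
    -- for `x` in the film its support is compact in the film.
    let φ : Pt n → ℝ := fun y => χ y.1 * ρ (Y - y)
    have hφd : ContDiff ℝ ((⊤ : ℕ∞) : WithTop ℕ∞) φ :=
      (hχ.comp contDiff_fst).mul (h.contDiff.comp (contDiff_const.sub contDiff_id))
    have hmemI : ∀ y, ‖Y - y‖ ≤ η → y.2 ∈ Icc η (1 - η) := by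
      intro y hy
      have := squeeze_sub_mem_Icc hη1 hx.2 hy
      rwa [← hY, sub_sub_cancel] at this
    have hφs : tsupport φ ⊆ tsupport χ ×ˢ Icc η (1 - η) := by
      refine closure_minimal ?_ (isCompact_prod_Icc hχc η).isClosed
      intro y hy
      have hy' : χ y.1 * ρ (Y - y) ≠ 0 := hy
      exact ⟨subset_tsupport χ (left_ne_zero_of_mul hy'),
        hmemI y (h.norm_le (right_ne_zero_of_mul hy'))⟩
    have hφω := hφs.trans (prod_Icc_subset_film hη hχω)
    have hφc : HasCompactSupport φ :=
      (isCompact_prod_Icc hχc η).of_isClosed_subset (isClosed_tsupport φ) hφs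
    have hφe : ∀ y, fderiv ℝ φ y (0, 1) = -(χ y.1 * fderiv ℝ ρ (Y - y) (0, 1)) := by
      intro y
      have d1 : HasFDerivAt (fun y : Pt n => χ y.1)
          ((fderiv ℝ χ y.1).comp (ContinuousLinearMap.fst ℝ _ ℝ)) y :=
        ((hχ.differentiable (by simp)) y.1).hasFDerivAt.comp y hasFDerivAt_fst
      have d2 : HasFDerivAt (fun y : Pt n => ρ (Y - y))
          ((fderiv ℝ ρ (Y - y)).comp (-(ContinuousLinearMap.id ℝ (Pt n)))) y :=
        ((h.contDiff.differentiable (by simp)) (Y - y)).hasFDerivAt.comp y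
          ((hasFDerivAt_id y).const_sub Y)
      have d3 : fderiv ℝ φ y = _ := (d1.mul d2).fderiv
      rw [d3]
      simp
    have hweak := hg.2.2 φ hφd hφc hφω
    have e1 : ∫ y, cutoff η χ v y * fderiv ℝ ρ (Y - y) (0, 1) =
        -∫ y in film ω 1, v y * fderiv ℝ φ y (0, 1) := by
      rw [← integral_neg, ← integral_indicator hfm]
      congr 1 with y
      rw [cutoff_eq_indicator]
      by_cases hy : y ∈ (tsupport χ ×ˢ Icc η (1 - η) : Set (Pt n))
      · rw [indicator_of_mem hy, indicator_of_mem (prod_Icc_subset_film hη hχω hy), hφe]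
        ring
      · rw [indicator_of_notMem hy, zero_mul]
        by_cases hy2 : y ∈ film ω 1
        · have : fderiv ℝ φ y = 0 :=
            image_eq_zero_of_notMem_tsupport (fun hm => hy (hφs (tsupport_fderiv_subset ℝ hm)))
          rw [indicator_of_mem hy2, this]
          simp
        · rw [indicator_of_notMem hy2]
    rw [e1, hweak, neg_neg]
    have e2 : ∫ y in film ω 1, g y * φ y = ∫ y, G y * ρ (Y - y) := by
      rw [setIntegral_congr_ae hfm (g := fun y => g' y * φ y), ← integral_indicator hfm]
      · congr 1 with y
        by_cases hy : y ∈ film ω 1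
        · simp only [hG, indicator_of_mem hy, φ]
          ring
        · simp [hG, hy]
      · rw [Filter.EventuallyEq, ae_restrict_iff' hfm] at hgg'
        filter_upwards [hgg'] with y hy hym
        rw [hy hym]
    rw [e2, ← integral_sub_left_eq_self (fun y => G y * ρ (Y - y)) volume Y]
    simp
  have h1 := mul_lintegral_average_rpow_le hp h hη1 hfm
    (T := fun x => fderiv ℝ (smoothing η ρ (cutoff η χ v)) x (0, 1))
    (D := fun x z => (1 - 4 * η) * G (squeeze η x - z))
    (fun x => by fun_prop) hT (F := fun y => ‖(1 - 4 * η) * G y‖ₑ ^ p) (by fun_prop)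
    (fun x _ z _ => le_rfl)
  have h2 : ∫⁻ y, ‖(1 - 4 * η) * G y‖ₑ ^ p ≤
      ENNReal.ofReal (1 - 4 * η) * ∫⁻ x in film ω 1, ‖g x‖ₑ ^ p := by
    have e1 : ∫⁻ x in film ω 1, ‖g x‖ₑ ^ p = ∫⁻ x in film ω 1, ‖g' x‖ₑ ^ p := by
      refine lintegral_congr_ae ?_
      filter_upwards [hgg'] with x hx
      rw [hx]
    have hg'm' := hg'm.measurable
    rw [e1, ← lintegral_indicator hfm,
      ← lintegral_const_mul _ (Measurable.indicator (by fun_prop) hfm)]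
    refine lintegral_mono fun y => ?_
    by_cases hy : y ∈ film ω 1
    · simp only [hG, indicator_of_mem hy]
      rw [enorm_mul, ENNReal.mul_rpow_of_nonneg _ _ hp0.le, enorm_mul,
        Real.enorm_of_nonneg hc.le, Real.enorm_of_nonneg (hχ1 _).1]
      gcongr
      · calc ENNReal.ofReal (1 - 4 * η) ^ p ≤ ENNReal.ofReal (1 - 4 * η) ^ (1 : ℝ) :=
              ENNReal.rpow_le_rpow_of_exponent_ge (by simp; linarith) hp.le
          _ = _ := ENNReal.rpow_one _
      · calc _ ≤ 1 * ‖g' y‖ₑ := by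
              gcongr
              simpa using (hχ1 y.1).2
          _ = _ := one_mul _
    · simp [hG, hy, hp0]
  exact (ENNReal.mul_le_mul_iff_right (by simpa using hc) ENNReal.ofReal_ne_top).1 (h1.trans h2)

end Approximation

end ThinFilm

namespace ThinFilm

/-! ### Convergence of the smoothings and the approximation theorem. -/

section SmoothingConvergence

variable {n : ℕ} {p η : ℝ} {ρ : Pt n → ℝ} {ω : Set (EuclideanSpace ℝ (Fin n))} {v : Pt n → ℝ}
  {χ : EuclideanSpace ℝ (Fin n) → ℝ}

theorem contDiff_smoothing (h : IsMollifier η ρ) {f : Pt n → ℝ} (hf : Integrable f) :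
    ContDiff ℝ ((⊤ : ℕ∞) : WithTop ℕ∞) (smoothing η ρ f) :=
  (h.hasCompactSupport.contDiff_convolution_right _ hf.locallyIntegrable h.contDiff).comp
    (contDiff_squeeze η)

theorem exists_abs_smoothing_le (h : IsMollifier η ρ) {f : Pt n → ℝ} (hf : Integrable f)
    (hfc : HasCompactSupport f) : ∃ M, ∀ x, |smoothing η ρ f x| ≤ M := by
  obtain ⟨M, hM⟩ := HasCompactSupport.exists_abs_le
    (hfc.convolution (ContinuousLinearMap.lsmul ℝ ℝ) h.hasCompactSupport (μ := volume))
    (h.hasCompactSupport.contDiff_convolution_right (ContinuousLinearMap.lsmul ℝ ℝ)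
      hf.locallyIntegrable h.contDiff).continuous
  exact ⟨M, fun x => hM _⟩

theorem lipschitzWith_squeeze (hη : 0 < η) (hη1 : η < 1 / 4) :
    LipschitzWith 1 (squeeze η : Pt n → Pt n) := by
  refine LipschitzWith.of_dist_le_mul fun x y => ?_
  rw [NNReal.coe_one, one_mul, Prod.dist_eq, Prod.dist_eq]
  refine max_le_max le_rfl ?_
  simp only [squeeze, Real.dist_eq]
  rw [show (1 - 4 * η) * x.2 + 2 * η - ((1 - 4 * η) * y.2 + 2 * η) =
    (1 - 4 * η) * (x.2 - y.2) by ring, abs_mul, abs_of_pos (by linarith : 0 < 1 - 4 * η)]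
  nlinarith [abs_nonneg (x.2 - y.2)]

theorem exists_lipschitzWith_smoothing (hη : 0 < η) (hη1 : η < 1 / 4) (h : IsMollifier η ρ)
    {f : Pt n → ℝ} (hf : Integrable f) (hfc : HasCompactSupport f) :
    ∃ L, LipschitzWith L (smoothing η ρ f) := by
  obtain ⟨L, hL⟩ := ContDiff.lipschitzWith_of_hasCompactSupport
    (hfc.convolution (ContinuousLinearMap.lsmul ℝ ℝ) h.hasCompactSupport (μ := volume))
    (h.hasCompactSupport.contDiff_convolution_right (ContinuousLinearMap.lsmul ℝ ℝ)
      hf.locallyIntegrable h.contDiff) (by simp)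
  exact ⟨L * 1, hL.comp (lipschitzWith_squeeze hη hη1)⟩

theorem dist_squeeze_sub_le (hη : 0 < η) {x : Pt n} (hx : x.2 ∈ Icc (0 : ℝ) 1) {z : Pt n}
    (hz : ‖z‖ ≤ η) : dist (squeeze η x - z) x ≤ 3 * η := by
  have h1 : ‖squeeze η x - x‖ ≤ 2 * η := by
    rw [Prod.norm_def]
    refine max_le (by simp [squeeze]; linarith) ?_
    simp only [squeeze, Prod.snd_sub, Real.norm_eq_abs]
    rw [abs_le]
    constructor <;> nlinarith [hx.1, hx.2]
  rw [dist_eq_norm, sub_right_comm]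
  linarith [norm_sub_le (squeeze η x - x) z]

/-- For `η ≤ 1/8` the Jacobian is at least `1/2`, so the operator norm is at most `2^(1/p) ≤ 2`,
uniformly in `η`. -/
theorem eLpNorm_smoothing_le (hp : 1 < p) (hη1 : η ≤ 1 / 8) (h : IsMollifier η ρ)
    {X : Set (Pt n)} (hX : MeasurableSet X) {f : Pt n → ℝ} (hf : Measurable f) :
    eLpNorm (smoothing η ρ f) (ENNReal.ofReal p) (volume.restrict X) ≤
      2 * eLpNorm f (ENNReal.ofReal p) volume := by
  have hp0 : 0 < p := by linarith
  have h1 := mul_lintegral_average_rpow_le hp h (by linarith) hX (T := smoothing η ρ f)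
    (D := fun x z => f (squeeze η x - z)) (fun x => by fun_prop)
    (fun x _ => smoothing_eq η ρ f x) (F := fun y => ‖f y‖ₑ ^ p) (by fun_prop)
    (fun x _ z _ => le_rfl)
  have hpne : ENNReal.ofReal p ≠ 0 := by simpa using hp0
  rw [eLpNorm_eq_lintegral_rpow_enorm_toReal hpne ENNReal.ofReal_ne_top,
    eLpNorm_eq_lintegral_rpow_enorm_toReal hpne ENNReal.ofReal_ne_top,
    ENNReal.toReal_ofReal hp0.le]
  have h2 : ∫⁻ x in X, ‖smoothing η ρ f x‖ₑ ^ p ≤ 2 ^ p * ∫⁻ x, ‖f x‖ₑ ^ p := by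
    calc _ = 1 * ∫⁻ x in X, ‖smoothing η ρ f x‖ₑ ^ p := (one_mul _).symm
      _ ≤ (2 * ENNReal.ofReal (1 - 4 * η)) * ∫⁻ x in X, ‖smoothing η ρ f x‖ₑ ^ p := by
          gcongr
          rw [← ENNReal.ofReal_one, ← ENNReal.ofReal_ofNat 2,
            ← ENNReal.ofReal_mul (by norm_num)]
          exact ENNReal.ofReal_le_ofReal (by linarith)
      _ ≤ 2 * ∫⁻ x, ‖f x‖ₑ ^ p := by rw [mul_assoc]; gcongr
      _ ≤ _ := by
          gcongr
          calc (2 : ℝ≥0∞) = 2 ^ (1 : ℝ) := (ENNReal.rpow_one _).symm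
            _ ≤ 2 ^ p := ENNReal.rpow_le_rpow_of_exponent_le (by norm_num) hp.le
  calc _ ≤ (2 ^ p * ∫⁻ x, ‖f x‖ₑ ^ p) ^ (1 / p) := by gcongr
    _ = _ := by
        rw [ENNReal.mul_rpow_of_nonneg _ _ (by positivity), ← ENNReal.rpow_mul,
          mul_one_div_cancel hp0.ne', ENNReal.rpow_one]

theorem abs_smoothing_sub_le (hη : 0 < η) (h : IsMollifier η ρ) {g : Pt n → ℝ}
    (hg : Integrable g) {θ κ : ℝ} (hθ : 3 * η < θ)
    (hgc : ∀ a b, dist a b < θ → dist (g a) (g b) < κ) {x : Pt n} (hx : x.2 ∈ Icc (0 : ℝ) 1) :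
    ‖smoothing η ρ g x - g x‖ ≤ κ := by
  have hρi := h.contDiff.continuous.integrable_of_hasCompactSupport h.hasCompactSupport
    (μ := volume)
  have e : smoothing η ρ g x - g x = ∫ z, (g (squeeze η x - z) * ρ z - g x * ρ z) := by
    rw [integral_sub (h.integrable_mul hg _) (hρi.const_mul _), integral_const_mul,
      h.integral_eq_one, mul_one, smoothing_eq]
  rw [e]
  calc _ ≤ ∫ z, κ * ρ z := by
        refine norm_integral_le_of_norm_le (hρi.const_mul κ) (Eventually.of_forall fun z => ?_)
        by_cases hz : ρ z = 0
        · simp [hz]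
        · rw [← sub_mul, norm_mul, Real.norm_of_nonneg (h.nonneg z)]
          have := hgc _ x ((dist_squeeze_sub_le hη hx (h.norm_le hz)).trans_lt hθ)
          rw [dist_eq_norm] at this
          exact mul_le_mul_of_nonneg_right this.le (h.nonneg z)
    _ = κ := by rw [integral_const_mul, h.integral_eq_one, mul_one]

theorem exists_cutoff_function {K : Set (Pt n)} (hK : IsCompact K) (hω : IsOpen ω)
    (hKω : K ⊆ film ω 1) :
    ∃ χ : EuclideanSpace ℝ (Fin n) → ℝ, ContDiff ℝ ((⊤ : ℕ∞) : WithTop ℕ∞) χ ∧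
      (∀ x, χ x ∈ Icc (0 : ℝ) 1) ∧ HasCompactSupport χ ∧ tsupport χ ⊆ ω ∧ ∀ y ∈ K, χ y.1 = 1 := by
  have hK1 : IsCompact (Prod.fst '' K) := hK.image continuous_fst
  have hK1ω : Prod.fst '' K ⊆ ω := by
    rintro _ ⟨y, hy, rfl⟩
    exact (hKω hy).1
  obtain ⟨t, htc, hKt, htω⟩ := exists_compact_between hK1 hω hK1ω
  obtain ⟨f, hf1, hf0, hf⟩ := exists_contMDiffMap_one_nhds_of_subset_interior
    (n := (⊤ : ℕ∞)) (modelWithCornersSelf ℝ (EuclideanSpace ℝ (Fin n))) hK1.isClosed hKt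
  have hsupp : tsupport f ⊆ t := by
    refine closure_minimal (fun x hx => ?_) htc.isClosed
    by_contra hxt
    exact hx (hf0 x hxt)
  refine ⟨f, f.contMDiff.contDiff, hf, htc.of_isClosed_subset (isClosed_tsupport _) hsupp,
    hsupp.trans htω, fun y hy => ?_⟩
  exact hf1.self_of_nhdsSet _ ⟨y, hy, rfl⟩

/-- Near `K` the cutoffs are invisible, so closeness is that of mollification. It is reduced to a
continuous compactly supported `g` close to `v` in `L^p`, for which uniform continuity suffices. -/
theorem exists_approximation (hp : 1 < p) (hω : IsOpen ω) (hvm : Measurable v)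
    (hv : MemLpLoc p (film ω 1) v) {K : Set (Pt n)} (hK : IsCompact K) (hKΩ : K ⊆ film ω 1)
    {δ : ℝ} (hδ : 0 < δ) :
    ∃ w : Pt n → ℝ, (∃ M, ∀ x, |w x| ≤ M) ∧ (∃ L, LipschitzWith L w) ∧ Differentiable ℝ w ∧
      eLpNorm (fun x => w x - v x) (ENNReal.ofReal p) (volume.restrict K) ≤ ENNReal.ofReal δ ∧
      (∃ c ∈ Ioo (0 : ℝ) 1, 1 - δ ≤ c ∧ ∀ t : ℝ,
        ENNReal.ofReal c * incr p (film ω 1) w (0, t) ≤ incr p (film ω 1) v (0, c * t)) ∧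
      ∀ g, IsWeakVerticalDeriv (film ω 1) v g →
        ∫⁻ x in film ω 1, ‖fderiv ℝ w x (0, 1)‖ₑ ^ p ≤ ∫⁻ x in film ω 1, ‖g x‖ₑ ^ p := by
  have hp0 : 0 < p := by linarith
  have hpE : 1 ≤ ENNReal.ofReal p := by simpa using hp.le
  obtain ⟨δ₀, hδ₀, hQΩ⟩ := hK.exists_cthickening_subset_open (hω.prod isOpen_Ioo) hKΩ
  set Q := Metric.cthickening δ₀ K with hQ
  have hQc : IsCompact Q := hK.cthickening
  obtain ⟨χ, hχ, hχ1, hχc, hχω, hχQ⟩ := exists_cutoff_function hQc hω hQΩ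
  set f₀ : Pt n → ℝ := Q.indicator v with hf₀
  have hf₀m : Measurable f₀ := hvm.indicator hQc.measurableSet
  have hf₀p : MemLp f₀ (ENNReal.ofReal p) volume :=
    (memLp_indicator_iff_restrict hQc.measurableSet).2 (hv Q hQΩ hQc)
  have hf₀i : Integrable f₀ :=
    (integrable_indicator_iff hQc.measurableSet).2 (hv.integrableOn hp hQΩ hQc)
  obtain ⟨g, hgc, hgn, hg, -⟩ := hf₀p.exists_hasCompactSupport_eLpNorm_sub_le
    ENNReal.ofReal_ne_top (ε := ENNReal.ofReal (δ / 8)) (by simpa using hδ)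
  have hgi : Integrable g := hg.integrable_of_hasCompactSupport hgc
  set V := (volume K ^ p⁻¹).toReal with hV
  have hVtop : volume K ^ p⁻¹ ≠ ∞ :=
    ENNReal.rpow_ne_top_of_nonneg (by positivity) hK.measure_lt_top.ne
  have hV0 : 0 ≤ V := ENNReal.toReal_nonneg
  obtain ⟨θ, hθ, hgu⟩ := Metric.uniformContinuous_iff.1
    (hgc.uniformContinuous_of_continuous hg) (δ / (4 * (V + 1))) (by positivity)
  -- The bounds serve, in order: the uniform operator norm; `1 - 4 η ≥ 1 - δ`; and, as a point moves
  -- by at most `3 η`, remaining in the thickening `Q` and within the modulus of continuity of `g`.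
  obtain ⟨η, hη, hη'⟩ : ∃ η : ℝ, 0 < η ∧ η < min (min (1 / 8) (δ / 4)) (min (δ₀ / 3) (θ / 3)) :=
    exists_between (by positivity)
  obtain ⟨⟨h8, hδη⟩, hδ₀η, hθη⟩ :
      (η < 1 / 8 ∧ η < δ / 4) ∧ η < δ₀ / 3 ∧ η < θ / 3 := by
    simpa only [lt_min_iff] using hη'
  have hη1 : η < 1 / 4 := by linarith
  obtain ⟨ρ, hρ⟩ := exists_isMollifier n hη
  have hci : Integrable (cutoff η χ v) := integrable_cutoff hp hη hχ.continuous hχ1 hχc hχω hv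
  have hcc : HasCompactSupport (cutoff η χ v) := hasCompactSupport_cutoff hχc
  refine ⟨smoothing η ρ (cutoff η χ v), exists_abs_smoothing_le hρ hci hcc,
    exists_lipschitzWith_smoothing hη hη1 hρ hci hcc,
    (contDiff_smoothing hρ hci).differentiable (by simp), ?_,
    ⟨1 - 4 * η, ⟨by linarith, by linarith⟩, by linarith, fun t =>
      mul_incr_smoothing_le hp hη hη1 hρ hω hχ.continuous hχ1 hχc hχω hvm hv t⟩,
    fun g hg => lintegral_fderiv_smoothing_le hp hη hη1 hρ hω hχ hχ1 hχc hχω hv hg⟩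
  have hI : ∀ x ∈ K, x.2 ∈ Ioo (0 : ℝ) 1 := fun x hx => (hKΩ hx).2
  have hdecomp : ∀ x ∈ K, smoothing η ρ (cutoff η χ v) x - v x =
      (smoothing η ρ (f₀ - g) + (fun x => smoothing η ρ g x - g x) + (g - f₀)) x := by
    intro x hx
    have e1 : smoothing η ρ (cutoff η χ v) x = smoothing η ρ f₀ x := by
      rw [smoothing_eq, smoothing_eq]
      congr 1 with z
      by_cases hz : ρ z = 0
      · simp [hz]
      · have hz' := hρ.norm_le hz
        have hQm : squeeze η x - z ∈ Q := Metric.mem_cthickening_of_dist_le _ x _ _ hx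
          ((dist_squeeze_sub_le hη ⟨(hI x hx).1.le, (hI x hx).2.le⟩ hz').trans (by linarith))
        rw [hf₀, indicator_of_mem hQm, cutoff,
          indicator_of_mem (by exact squeeze_sub_mem_Icc hη1 (hI x hx) hz'), hχQ _ hQm, one_mul]
    have e2 : smoothing η ρ (f₀ - g) x = smoothing η ρ f₀ x - smoothing η ρ g x := by
      simp_rw [smoothing_eq, Pi.sub_apply, sub_mul]
      exact integral_sub (hρ.integrable_mul hf₀i _) (hρ.integrable_mul hgi _)
    have e3 : f₀ x = v x := indicator_of_mem (Metric.self_subset_cthickening K hx) v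
    simp only [Pi.add_apply, Pi.sub_apply, e1, e2, e3]
    ring
  have hsm : Continuous (smoothing η ρ (f₀ - g)) :=
    (contDiff_smoothing hρ (hf₀i.sub hgi)).continuous
  have hsg : Continuous (smoothing η ρ g) := (contDiff_smoothing hρ hgi).continuous
  have hgm := hg.measurable
  have b1 : eLpNorm (smoothing η ρ (f₀ - g)) (ENNReal.ofReal p) (volume.restrict K) ≤
      2 * ENNReal.ofReal (δ / 8) :=
    (eLpNorm_smoothing_le hp h8.le hρ hK.measurableSet (hf₀m.sub hgm)).trans (by gcongr)
  have b2 : eLpNorm (fun x => smoothing η ρ g x - g x) (ENNReal.ofReal p) (volume.restrict K) ≤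
      ENNReal.ofReal (δ / 4) := by
    refine (eLpNorm_le_of_ae_bound (C := δ / (4 * (V + 1))) ?_).trans ?_
    · refine (ae_restrict_iff' hK.measurableSet).2 (Eventually.of_forall fun x hx => ?_)
      exact abs_smoothing_sub_le hη hρ hgi (θ := θ) (by linarith) (fun a b h => hgu h)
        ⟨(hI x hx).1.le, (hI x hx).2.le⟩
    · rw [Measure.restrict_apply_univ, ENNReal.toReal_ofReal hp0.le,
        ← ENNReal.ofReal_toReal hVtop, ← hV, ← ENNReal.ofReal_mul hV0]
      refine ENNReal.ofReal_le_ofReal ?_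
      rw [mul_div_assoc', div_le_div_iff₀ (by positivity) (by norm_num)]
      nlinarith
  have b3 : eLpNorm (g - f₀) (ENNReal.ofReal p) (volume.restrict K) ≤ ENNReal.ofReal (δ / 8) := by
    rw [eLpNorm_sub_comm]
    exact (eLpNorm_mono_measure _ Measure.restrict_le_self).trans hgn
  rw [eLpNorm_congr_ae ((ae_restrict_iff' hK.measurableSet).2
    (Eventually.of_forall hdecomp))]
  have m1 : AEStronglyMeasurable (smoothing η ρ (f₀ - g)) (volume.restrict K) :=
    hsm.aestronglyMeasurable
  have m2 : AEStronglyMeasurable (fun x => smoothing η ρ g x - g x) (volume.restrict K) :=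
    (hsg.sub hg).aestronglyMeasurable
  have m3 : AEStronglyMeasurable (g - f₀) (volume.restrict K) :=
    (hgm.sub hf₀m).aestronglyMeasurable
  calc _ ≤ _ := eLpNorm_add_le (m1.add m2) m3 hpE
    _ ≤ (2 * ENNReal.ofReal (δ / 8) + ENNReal.ofReal (δ / 4)) + ENNReal.ofReal (δ / 8) := by
        gcongr
        exact (eLpNorm_add_le m1 m2 hpE).trans (add_le_add b1 b2)
    _ ≤ _ := by
        rw [← ENNReal.ofReal_ofNat 2, ← ENNReal.ofReal_mul (by norm_num),
          ← ENNReal.ofReal_add (by positivity) (by positivity),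
          ← ENNReal.ofReal_add (by positivity) (by positivity)]
        exact ENNReal.ofReal_le_ofReal (by linarith)

/-- Substituting `c h` for `h` on the right gives the Jacobian `c` and the weight `|c h|^(-(1 + s
p))`; their product is at least the original weight because `c^(s p) ≤ 1`. -/
theorem mul_verticalGagliardo_le_of_incr_le {s c : ℝ} (hp : 0 ≤ p) (hs : 0 ≤ s)
    (hω : MeasurableSet ω) {w : Pt n → ℝ} (hv : Measurable v) (hw : Measurable w)
    (hc : c ∈ Ioo (0 : ℝ) 1) (hincr : ∀ t : ℝ,
      ENNReal.ofReal c * incr p (film ω 1) w (0, t) ≤ incr p (film ω 1) v (0, c * t)) :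
    ENNReal.ofReal c * verticalGagliardo p s ω w ≤ verticalGagliardo p s ω v := by
  have hc0 := hc.1
  have hfm := measurableSet_film hω 1
  have hm : ∀ u : Pt n → ℝ, Measurable u →
      Measurable fun h : ℝ => vertWeight p s h * incr p (film ω 1) u (0, h) := fun u hu =>
    (measurable_vertWeight p s).mul ((measurable_incr p hfm hu).comp (by fun_prop))
  have hmv : Measurable fun h : ℝ =>
      vertWeight p s (c • h) * incr p (film ω 1) v (0, c • h) :=
    (hm v hv).comp (measurable_const_smul c)
  rw [verticalGagliardo_eq hp hω hv, verticalGagliardo_eq hp hω hw,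
    lintegral_eq_mul_lintegral_smul volume (hm v hv) hc0, Module.finrank_self, pow_one,
    ← lintegral_const_mul _ (hm w hw), ← lintegral_const_mul _ hmv]
  refine lintegral_mono fun h => ?_
  have hwt : vertWeight p s h ≤ ENNReal.ofReal c * vertWeight p s (c • h) := by
    rw [vertWeight, vertWeight, ← ENNReal.ofReal_mul hc0.le]
    refine ENNReal.ofReal_le_ofReal ?_
    rcases eq_or_ne h 0 with rfl | hh
    · have : (1 + s * p) ≠ 0 := by positivity
      simp [Real.zero_rpow this]
    · have hh' : 0 < |h| := abs_pos.2 hh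
      rw [smul_eq_mul, abs_mul, abs_of_pos hc0, Real.mul_rpow hc0.le hh'.le, mul_one_div,
        Real.rpow_add hc0, Real.rpow_one, div_le_div_iff₀ (by positivity) (by positivity), one_mul]
      have h1 : c ^ (s * p) ≤ 1 := Real.rpow_le_one hc0.le hc.2.le (by positivity)
      have h2 : 0 ≤ c * |h| ^ (1 + s * p) := by positivity
      nlinarith
  calc _ = vertWeight p s h * (ENNReal.ofReal c * incr p (film ω 1) w (0, h)) := by ring
    _ ≤ (ENNReal.ofReal c * vertWeight p s (c • h)) * incr p (film ω 1) v (0, c * h) := by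
        gcongr
        exact hincr h
    _ = _ := by rw [mul_assoc, smul_eq_mul]

end SmoothingConvergence

end ThinFilm

namespace ThinFilm

/-! ### Recovery sequences and the two Gamma-limits. -/

section Recovery

variable {n : ℕ} {p : ℝ} {ω : Set (EuclideanSpace ℝ (Fin n))} {v : Pt n → ℝ}

theorem exists_tendsto_diagonal {P : ℕ → ℕ → Prop} (h : ∀ k, ∀ᶠ j in atTop, P k j) :
    ∃ κ : ℕ → ℕ, Tendsto κ atTop atTop ∧ ∀ᶠ j in atTop, P (κ j) j := by
  choose N hN using fun k => eventually_atTop.1 (h k)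
  -- The largest `k ≤ j` whose threshold has been passed. It is meaningful once `j ≥ N 0`, since `k
  -- = 0` then qualifies.
  refine ⟨fun j => Nat.findGreatest (fun k => N k ≤ j) j, tendsto_atTop.2 fun k => ?_, ?_⟩
  · filter_upwards [eventually_ge_atTop (max k (N k))] with j hj
    exact Nat.le_findGreatest ((le_max_left _ _).trans hj) ((le_max_right _ _).trans hj)
  · filter_upwards [eventually_ge_atTop (N 0)] with j hj
    exact hN _ j (Nat.findGreatest_spec (P := fun k => N k ≤ j) (Nat.zero_le j) hj)

theorem weakConvLpLoc_of_tendsto_eLpNorm {Ω : Set (Pt n)} (hp : 1 < p) {w : ℕ → Pt n → ℝ}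
    (hw : ∀ k, MemLpLoc p Ω (w k)) (hv : MemLpLoc p Ω v)
    (h : ∀ K, K ⊆ Ω → IsCompact K → Tendsto
      (fun k => eLpNorm (fun x => w k x - v x) (ENNReal.ofReal p) (volume.restrict K))
      atTop (𝓝 0)) : WeakConvLpLoc p Ω w v := by
  refine ⟨hw, hv, fun K hK hKc φ hφ => ?_⟩
  have hpq : p.HolderConjugate (p / (p - 1)) := Real.HolderConjugate.conjExponent hp
  have := hpq.ennrealOfReal
  have hint : ∀ u : Pt n → ℝ, MemLp u (ENNReal.ofReal p) (volume.restrict K) →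
      Integrable (fun x => u x * φ x) (volume.restrict K) := fun u hu => hu.integrable_mul hφ
  refine tendsto_integral_of_L1' _ (hint v (hv K hK hKc)).1
    (Eventually.of_forall fun k => hint _ (hw k K hK hKc)) ?_
  have hlim := ENNReal.Tendsto.mul_const (b := eLpNorm φ (ENNReal.ofReal (p / (p - 1)))
    (volume.restrict K)) (h K hK hKc) (Or.inr hφ.2.ne)
  rw [zero_mul] at hlim
  refine tendsto_of_tendsto_of_tendsto_of_le_of_le tendsto_const_nhds hlim
    (fun _ => zero_le) fun k => ?_
  have hd : MemLp (fun x => w k x - v x) (ENNReal.ofReal p) (volume.restrict K) :=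
    (hw k K hK hKc).sub (hv K hK hKc)
  have e : ((fun x => w k x * φ x) - fun x => v x * φ x) = (fun x => w k x - v x) • φ := by
    ext x
    simp [sub_mul]
  dsimp only
  rw [e]
  exact eLpNorm_smul_le_mul_eLpNorm hφ.1 hd.1

/-- The sets are the points at distance at least `1 / (k + 1)` from the complement. The complement
must be nonempty because `infDist` to the empty set is `0`. -/
theorem exists_compact_exhaustion {X : Type*} [PseudoMetricSpace X] [ProperSpace X] {U : Set X}
    (hU : IsOpen U) (hUb : Bornology.IsBounded U) (hne : Uᶜ.Nonempty) :
    ∃ K : ℕ → Set X, (∀ k, IsCompact (K k)) ∧ (∀ k, K k ⊆ U) ∧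
      ∀ C, C ⊆ U → IsCompact C → ∀ᶠ k in atTop, C ⊆ K k := by
  have hsub : ∀ k : ℕ, {x | 1 / ((k : ℝ) + 1) ≤ Metric.infDist x Uᶜ} ⊆ U := by
    intro k x hx
    by_contra hxU
    have h0 : Metric.infDist x Uᶜ = 0 := Metric.infDist_zero_of_mem hxU
    rw [mem_ofPred_eq, h0] at hx
    have : 0 < 1 / ((k : ℝ) + 1) := by positivity
    linarith
  refine ⟨fun k => {x | 1 / ((k : ℝ) + 1) ≤ Metric.infDist x Uᶜ}, fun k => ?_, hsub,
    fun C hC hCc => ?_⟩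
  · exact Metric.isCompact_of_isClosed_isBounded
      (isClosed_le continuous_const (Metric.continuous_infDist_pt _)) (hUb.subset (hsub k))
  · obtain ⟨δ, hδ, hδU⟩ := hCc.exists_cthickening_subset_open hU hC
    have hlim : Tendsto (fun k : ℕ => 1 / ((k : ℝ) + 1)) atTop (𝓝 0) :=
      tendsto_one_div_add_atTop_nhds_zero_nat
    filter_upwards [hlim.eventually_le_const hδ] with k hk x hx
    refine hk.trans ((Metric.le_infDist hne).2 fun y hy => ?_)
    by_contra hxy
    refine hy (hδU (Metric.mem_cthickening_of_dist_le y x _ _ hx ?_))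
    rw [dist_comm]
    exact (not_le.1 hxy).le

theorem IsWeakVerticalDeriv.congr_ae {Ω : Set (Pt n)} {v' g : Pt n → ℝ}
    (h : v =ᵐ[volume.restrict Ω] v') (hv' : LocallyIntegrableOn v' Ω)
    (hg : IsWeakVerticalDeriv Ω v g) : IsWeakVerticalDeriv Ω v' g := by
  refine ⟨hv', hg.2.1, fun φ h1 h2 h3 => ?_⟩
  rw [← hg.2.2 φ h1 h2 h3]
  refine integral_congr_ae ?_
  filter_upwards [h] with x hx
  rw [hx]

/-- One sequence serves both regimes, and the factors `c k` do not depend on `s`. Approximation on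
the `k`-th set of an exhaustion gives strong, hence weak, local convergence. -/
theorem exists_approximating_sequence (hp : 1 < p) (hω : IsOpen ω)
    (hωb : Bornology.IsBounded ω) (hv : MemLpLoc p (film ω 1) v) :
    ∃ w : ℕ → Pt n → ℝ, (∀ k, ∃ M, ∀ x, |w k x| ≤ M) ∧ (∀ k, ∃ L, LipschitzWith L (w k)) ∧
      (∀ k, Differentiable ℝ (w k)) ∧ WeakConvLpLoc p (film ω 1) w v ∧
      (∃ c : ℕ → ℝ, (∀ k, c k ∈ Ioo (0 : ℝ) 1) ∧ Tendsto c atTop (𝓝 1) ∧ ∀ k s, 0 ≤ s →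
        ENNReal.ofReal (c k) * verticalGagliardo p s ω (w k) ≤ verticalGagliardo p s ω v) ∧
      ∀ k, ∫⁻ x in film ω 1, ‖fderiv ℝ (w k) x (0, 1)‖ₑ ^ p ≤ verticalDirichlet p ω v := by
  have hp0 : 0 < p := by linarith
  have hΩ : IsOpen (film ω 1) := hω.prod isOpen_Ioo
  have hvm := hv.aestronglyMeasurable hp hΩ
  set v' := hvm.mk v with hv'
  have hv'm : Measurable v' := hvm.stronglyMeasurable_mk.measurable
  have hvv' : v =ᵐ[volume.restrict (film ω 1)] v' := hvm.ae_eq_mk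
  have hvvK : ∀ K, K ⊆ film ω 1 → v =ᵐ[volume.restrict K] v' := fun K hK =>
    ae_mono (Measure.restrict_mono hK le_rfl) hvv'
  have hv'p : MemLpLoc p (film ω 1) v' := fun K hK hKc => (hv K hK hKc).ae_eq (hvvK K hK)
  have hne : (film ω 1)ᶜ.Nonempty := ⟨(0, 2), fun h => by
    have := h.2.2
    norm_num at this⟩
  obtain ⟨K, hKc, hKΩ, hKe⟩ := exists_compact_exhaustion hΩ
    (hωb.prod (Metric.isBounded_Ioo 0 1)) hne
  choose w hM hL hd hw hc hg using fun k : ℕ => exists_approximation hp hω hv'm hv'p (hKc k)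
    (hKΩ k) (δ := 1 / ((k : ℝ) + 1)) (by positivity)
  choose c hc0 hcδ hci using hc
  have hlim : Tendsto (fun k : ℕ => 1 / ((k : ℝ) + 1)) atTop (𝓝 0) :=
    tendsto_one_div_add_atTop_nhds_zero_nat
  refine ⟨w, hM, hL, hd, weakConvLpLoc_of_tendsto_eLpNorm hp (fun k C _ hCc => ?_) hv
    fun C hC hCc => ?_, ⟨c, hc0, ?_, fun k s hs => ?_⟩, fun k => ?_⟩
  · obtain ⟨M, hM⟩ := hM k
    have : IsFiniteMeasure (volume.restrict C) := ⟨by simpa using hCc.measure_lt_top⟩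
    exact MemLp.of_bound (hd k).continuous.aestronglyMeasurable M (Eventually.of_forall hM)
  · have hlim' := ENNReal.tendsto_ofReal hlim
    rw [ENNReal.ofReal_zero] at hlim'
    refine tendsto_of_tendsto_of_tendsto_of_le_of_le' tendsto_const_nhds hlim'
      (Eventually.of_forall fun _ => zero_le) ?_
    filter_upwards [hKe C hC hCc] with k hk
    refine le_trans (le_of_eq_of_le (eLpNorm_congr_ae ?_)
      (eLpNorm_mono_measure _ (Measure.restrict_mono hk le_rfl))) (hw k)
    filter_upwards [hvvK C hC] with x hx
    rw [hx]
  · refine tendsto_of_tendsto_of_tendsto_of_le_of_le ?_ tendsto_const_nhds hcδ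
      fun k => (hc0 k).2.le
    simpa using hlim.const_sub 1
  · rw [verticalGagliardo_congr hvv']
    exact mul_verticalGagliardo_le_of_incr_le hp0.le hs hω.measurableSet hv'm
      (hd k).continuous.measurable (hc0 k) (hci k)
  · refine le_iInf₂ fun g hgv => ?_
    simp_rw [← enorm_rpow_eq_ofReal _ hp0.le]
    exact hg k g (hgv.congr_ae hvv' (hv'p.locallyIntegrableOn hp hΩ))

/-- Diagonal argument. Finiteness of `b k` makes the slack `1 / (k + 1)` strict, so that each limsup
bound becomes an eventual bound. -/
theorem exists_recovery_sequence {w : ℕ → Pt n → ℝ} (hw : WeakConvLpLoc p (film ω 1) w v)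
    {ε : ℕ → ℝ} (hε : ∀ j, 0 < ε j) {Φ : ℕ → (Pt n → ℝ) → ℝ≥0∞} {b : ℕ → ℝ≥0∞} {G : ℝ≥0∞}
    (hb : ∀ k, b k ≠ ∞) (hbG : Tendsto b atTop (𝓝 G))
    (hΦ : ∀ k, limsup (fun j => Φ j (unscale (ε j) (w k))) atTop ≤ b k) :
    ∃ u : ℕ → Pt n → ℝ, WeakConvLpLoc p (film ω 1) (fun j => rescale (ε j) (u j)) v ∧
      limsup (fun j => Φ j (u j)) atTop ≤ G := by
  have hlim : Tendsto (fun k : ℕ => b k + ENNReal.ofReal (1 / ((k : ℝ) + 1))) atTop (𝓝 G) := by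
    simpa using hbG.add (ENNReal.tendsto_ofReal tendsto_one_div_add_atTop_nhds_zero_nat)
  obtain ⟨κ, hκ, hκΦ⟩ := exists_tendsto_diagonal
    (P := fun k j => Φ j (unscale (ε j) (w k)) ≤ b k + ENNReal.ofReal (1 / ((k : ℝ) + 1)))
    fun k => by
      have hlt : b k < b k + ENNReal.ofReal (1 / ((k : ℝ) + 1)) :=
        ENNReal.lt_add_right (hb k) (by simp; positivity)
      filter_upwards [eventually_lt_of_limsup_lt ((hΦ k).trans_lt hlt)] with j hj
      exact hj.le
  refine ⟨fun j => unscale (ε j) (w (κ j)), ?_, ?_⟩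
  · simp_rw [rescale_unscale (hε _).ne']
    exact hw.comp hκ
  · exact (limsup_le_limsup hκΦ).trans (hlim.comp hκ).limsup_eq.le

theorem exists_constant_recovery_sequence (hv : MemLpLoc p (film ω 1) v) {ε : ℕ → ℝ}
    (hε : ∀ j, 0 < ε j) :
    ∃ u : ℕ → Pt n → ℝ, WeakConvLpLoc p (film ω 1) (fun j => rescale (ε j) (u j)) v := by
  refine ⟨fun j => unscale (ε j) v, ?_⟩
  simp_rw [rescale_unscale (hε _).ne']
  exact ⟨fun _ => hv, hv, fun _ _ _ _ _ => tendsto_const_nhds⟩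

theorem isGammaLimit_energy (hp : 1 < p) (hω : IsOpen ω) (hωb : Bornology.IsBounded ω) {s₀ : ℝ}
    (hs₀ : s₀ ∈ Ico (0 : ℝ) 1) {s : ℝ → ℝ} (hs : ∀ ε : ℝ, 0 < ε → s ε ∈ Ioo (0 : ℝ) 1)
    (hlim : Tendsto s (𝓝[>] (0 : ℝ)) (𝓝 s₀)) :
    IsGammaLimit p ω (fun ε u => energy p ω (s ε) ε u)
      (fun v => filmConst n s₀ p * verticalGagliardo p s₀ ω v) := by
  intro ε hε hε₀ v hv
  have hΩ : IsOpen (film ω 1) := hω.prod isOpen_Ioo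
  have hsj : Tendsto (fun j => s (ε j)) atTop (𝓝 s₀) :=
    hlim.comp (tendsto_nhdsWithin_iff.2 ⟨hε₀, Eventually.of_forall hε⟩)
  have hsI : ∀ j, s (ε j) ∈ Ioo (0 : ℝ) 1 := fun j => hs _ (hε j)
  refine ⟨fun u hu => ?_, ?_⟩
  · have h := filmConst_mul_le_liminf hp hω.measurableSet hΩ hu hε hsj (fun _ => 1)
      (fun _ => ENNReal.one_ne_top) (L := verticalGagliardo p s₀ ω v) fun ξ => by
        simp_rw [one_mul]
        exact verticalGagliardo_le_liminf_slopeEnergy hp hω.measurableSet hΩ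
          (volume_film_lt_top hωb 1) hu hε₀ hsj ξ
    simpa only [one_mul] using h
  -- An infinite limit value constrains nothing but the convergence, for which `v` itself, unscaled,
  -- is enough; the diagonal argument needs finite values.
  · by_cases hG : filmConst n s₀ p * verticalGagliardo p s₀ ω v = ∞
    · obtain ⟨u, hu⟩ := exists_constant_recovery_sequence hv hε
      exact ⟨u, hu, le_top.trans_eq hG.symm⟩
    · obtain ⟨w, hM, hL, -, hw, ⟨c, hc, hc1, hcw⟩, -⟩ :=
        exists_approximating_sequence hp hω hωb hv
      refine exists_recovery_sequence hw hε (Φ := fun j u => energy p ω (s (ε j)) (ε j) u)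
        -- The approximations may exceed the energy of `v` by the factor `1 / c k`, which tends to
        -- one.
        (b := fun k => (ENNReal.ofReal (c k))⁻¹ *
          (filmConst n s₀ p * verticalGagliardo p s₀ ω v)) (fun k => ?_) ?_ fun k => ?_
      · exact ENNReal.mul_ne_top (ENNReal.inv_ne_top.2 (by simpa using (hc k).1)) hG
      · have h1 := ENNReal.Tendsto.mul_const
          (b := filmConst n s₀ p * verticalGagliardo p s₀ ω v)
          (tendsto_inv_iff.2 (ENNReal.tendsto_ofReal hc1)) (Or.inl (by simp))
        simpa using h1
      · obtain ⟨M, hM⟩ := hM k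
        obtain ⟨L, hL⟩ := hL k
        refine (limsup_energy_unscale_le hp hω hωb hM hL hsI hsj hs₀.1 hs₀.2 hε hε₀).trans ?_
        rw [mul_left_comm]
        gcongr
        rw [← one_mul (verticalGagliardo p s₀ ω (w k)), ← ENNReal.inv_mul_cancel
          (a := ENNReal.ofReal (c k)) (by simpa using (hc k).1) ENNReal.ofReal_ne_top, mul_assoc]
        gcongr
        exact hcw k s₀ hs₀.1

theorem isGammaLimit_one_sub_mul_energy (hp : 1 < p) (hω : IsOpen ω)
    (hωb : Bornology.IsBounded ω) {s : ℝ → ℝ} (hs : ∀ ε : ℝ, 0 < ε → s ε ∈ Ioo (0 : ℝ) 1)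
    (hlim : Tendsto s (𝓝[>] (0 : ℝ)) (𝓝 1)) :
    IsGammaLimit p ω (fun ε u => ENNReal.ofReal (1 - s ε) * energy p ω (s ε) ε u)
      (fun v => ENNReal.ofReal (2 / p) * filmConst n 1 p * verticalDirichlet p ω v) := by
  intro ε hε hε₀ v hv
  have hΩ : IsOpen (film ω 1) := hω.prod isOpen_Ioo
  have hsj : Tendsto (fun j => s (ε j)) atTop (𝓝 1) :=
    hlim.comp (tendsto_nhdsWithin_iff.2 ⟨hε₀, Eventually.of_forall hε⟩)
  have hsI : ∀ j, s (ε j) ∈ Ioo (0 : ℝ) 1 := fun j => hs _ (hε j)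
  have hcomm : ENNReal.ofReal (2 / p) * filmConst n 1 p * verticalDirichlet p ω v =
      filmConst n 1 p * (ENNReal.ofReal (2 / p) * verticalDirichlet p ω v) := by ring
  simp only [hcomm]
  refine ⟨fun u hu => ?_, ?_⟩
  · exact filmConst_mul_le_liminf hp hω.measurableSet hΩ hu hε hsj
      (fun j => ENNReal.ofReal (1 - s (ε j))) (fun _ => ENNReal.ofReal_ne_top) fun ξ =>
        verticalDirichlet_le_liminf_slopeEnergy hp hΩ (volume_film_lt_top hωb 1) hu hε₀
          (fun j => (hsI j).2) hsj ξ
  · by_cases hG : filmConst n 1 p * (ENNReal.ofReal (2 / p) * verticalDirichlet p ω v) = ∞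
    · obtain ⟨u, hu⟩ := exists_constant_recovery_sequence hv hε
      exact ⟨u, hu, le_top.trans_eq hG.symm⟩
    · obtain ⟨w, hM, hL, hd, hw, -, hwD⟩ := exists_approximating_sequence hp hω hωb hv
      refine exists_recovery_sequence hw hε
        (Φ := fun j u => ENNReal.ofReal (1 - s (ε j)) * energy p ω (s (ε j)) (ε j) u)
        -- The Dirichlet energy of the approximations never exceeds that of `v`, so the bound is
        -- constant in `k`.
        (b := fun _ => filmConst n 1 p * (ENNReal.ofReal (2 / p) * verticalDirichlet p ω v))
        (fun _ => hG) tendsto_const_nhds fun k => ?_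
      obtain ⟨M, hM⟩ := hM k
      obtain ⟨L, hL⟩ := hL k
      refine (limsup_one_sub_mul_energy_unscale_le hp hω hωb hM hL (hd k) hsI hsj hε hε₀).trans ?_
      gcongr
      exact hwD k

end Recovery

end ThinFilm

theorem theorem6p1 (n : ℕ) (hn : 1 ≤ n) (p : ℝ) (hp : 1 < p)
    (ω : Set (EuclideanSpace ℝ (Fin n))) (hωo : IsOpen ω) (hωb : Bornology.IsBounded ω)
    (s₀ : ℝ) (hs₀ : s₀ ∈ Set.Icc (0 : ℝ) 1)
    (s : ℝ → ℝ) (hs : ∀ ε : ℝ, 0 < ε → s ε ∈ Set.Ioo (0 : ℝ) 1)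
    (hlim : Filter.Tendsto s (𝓝[>] (0 : ℝ)) (𝓝 s₀)) :
    (s₀ < 1 →
      ThinFilm.IsGammaLimit p ω
        (fun ε u => ThinFilm.energy p ω (s ε) ε u)
        (fun v => ThinFilm.filmConst n s₀ p * ThinFilm.verticalGagliardo p s₀ ω v)) ∧
    (s₀ = 1 →
      ThinFilm.IsGammaLimit p ω
        (fun ε u => ENNReal.ofReal (1 - s ε) * ThinFilm.energy p ω (s ε) ε u)
        (fun v => ENNReal.ofReal (2 / p) * ThinFilm.filmConst n 1 p *
          ThinFilm.verticalDirichlet p ω v)) := by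
  refine ⟨fun h => ThinFilm.isGammaLimit_energy hp hωo hωb ⟨hs₀.1, h⟩ hs hlim, ?_⟩
  rintro rfl
  exact ThinFilm.isGammaLimit_one_sub_mul_energy hp hωo hωb hs hlim
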